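/- Let $\mathfrak g$ be a finite-dimensional complex semisimple Lie algebra, $\mathfrak h\subset\mathfrak g$ a Cartan subalgebra with Weyl group $W$, and fix a system of simple roots, with positive roots $R_+$ and triangular decomposition $\mathfrak g=\mathfrak n_-\oplus\mathfrak h\oplus\mathfrak n_+$, where $\mathfrak n_\pm=\bigoplus_{\alpha\in R_+}\mathfrak g_{\pm\alpha}$. Let $Z(\mathfrak g)$ be the centre of $U(\mathfrak g)$, let $\rho$ be half the sum of the positive roots, and put $w\bullet\lambda=w(\lambda+\rho)-\rho$ for $w\in W$, $\lambda\in\mathfrak h^*$. Identify $U(\mathfrak h)=S\mathfrak h=\mathbb C[\mathfrak h^*]$. The multiplication map $\mu:U(\mathfrak n_-)\otimes U(\mathfrak h)\otimes U(\mathfrak n_+)\to U(\mathfrak g)$ is a linear isomorphism, and the Harish-Chandra map is $HC=\beta\circ\mu^{-1}:U(\mathfrak g)\to S\mathfrak h$, where $\beta(a_-\otimes h\otimes a_+)=\varepsilon(a_-)\varepsilon(a_+)h$ and $\varepsilon$ is the counit. Then: (i) $HC(bc)=HC(b)HC(c)$ for all $b\in U(\mathfrak g)$ and $c\in Z(\mathfrak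 g)$. In particular, $HC|_{Z(\mathfrak g)}$ is a homomorphism of algebras. (ii) $\rho$ is also the sum of the fundamental weights, and $HC$ maps $Z(\mathfrak g)$ into the algebra of invariants $\mathbb C[\mathfrak h^*]^{W\bullet}$ of the shifted action. That is, for every $b\in Z(\mathfrak g)$ there is $f_b\in\mathbb C[\mathfrak h^*]^W$ with $HC(b)(\lambda)=f_b(\lambda+\rho)$ for all $\lambda\in\mathfrak h^*$. (iii) Let $V$ be a highest weight $\mathfrak g$-module with highest weight $\lambda$, generated by the highest weight vector $v_\lambda\neq0$. There is a unique $v_\lambda^*\in V^*$ of weight $-\lambda$ that is annihilated by $\mathfrak n_-$ and satisfies $(v_\lambda^*,v_\lambda)=1$. For all $b\in U(\mathfrak g)$ we have $HC(b)(\lambda)=(v_\lambda^*,bv_\lambda)$; hence $f_b(\lambda+\rho)=(v^*_\lambda,bv_\lambda)$ for $b\in Z(\mathfrak g)$. Every $b\in Z(\mathfrak g)$ acts on $V$ by the scalar $HC(b)(\lambda)$. (iv) Filter $U(\mathfrak g)$ and $S\mathfrak h$ by degree, with $\deg\mathfrak g=\deg\mathfrak h=1$, and give $Z(\mathfrak g)$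 and $\mathbb C[\mathfrak h^*]^{W\bullet}$ the induced filtrations. Then $HC:Z(\mathfrak g)\to\mathbb C[\mathfrak h^*]^{W\bullet}$ is a filtered map. Under the canonical identification $\mathrm{gr}\,U(\mathfrak g)=S\mathfrak g$ (which takes the class of $x_1\cdots x_n$ to $x_1\cdots x_n$) one has $\mathrm{gr}\,Z(\mathfrak g)=(S\mathfrak g)^{\mathfrak g}$, under $\mathrm{gr}\,S\mathfrak h=S\mathfrak h$ one has $\mathrm{gr}\,\mathbb C[\mathfrak h^*]^{W\bullet}=(S\mathfrak h)^W$, and $\mathrm{gr}(HC)$ is the Chevalley restriction homomorphism $\mathrm{Res}:(S\mathfrak g)^{\mathfrak g}\to(S\mathfrak h)^W$. Here $\mathrm{Res}$ is induced by the projection $\mathfrak g\to\mathfrak h$ along $\mathfrak n_-\oplus\mathfrak n_+$; that is, it is the restriction of polynomial functions from $\mathfrak g^*$ to $\mathfrak h^*$, where $\mathfrak h^*\subset\mathfrak g^*$ is the space of functionals vanishing on $\mathfrak n_-\oplus\mathfrak n_+$. (v) $HC:Z(\mathfrak g)\to\mathbb C[\mathfrak h^*]^{W\bullet}$ is an isomorphism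 of algebras. -/

import Mathlib

open scoped TensorProduct

/-! ### Filtrations and associated graded spaces -/

namespace HarishChandra

section Filtration

variable {M A B : Type*} [AddCommGroup M] [Module ℂ M]
  [Ring A] [Algebra ℂ A] [AddCommGroup B] [Module ℂ B]

/-- The span of all products `f x₁ * ⋯ * f xₙ` of exactly `n` generators. -/
def piece (f : M →ₗ[ℂ] A) (n : ℕ) : Submodule ℂ A :=
  LinearMap.range f ^ n

/-- The span of all products of fewer than `n` generators, i.e. the part of filtration
degree `< n`; the part of degree `≤ n` is `fil f (n + 1)`. -/
def fil (f : M →ₗ[ℂ] A) (n : ℕ) : Submodule ℂ A :=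
  ⨆ i : Fin n, piece f i

theorem piece_le_fil (f : M →ₗ[ℂ] A) (n : ℕ) : piece f n ≤ fil f (n + 1) :=
  le_iSup (fun i : Fin (n + 1) => piece f i) (Fin.last n)

/-- The product `f x₁ * ⋯ * f xₙ`. -/
def monomial (f : M →ₗ[ℂ] A) {n : ℕ} (x : Fin n → M) : piece f n :=
  ⟨(List.ofFn fun i => f (x i)).prod, by
    induction n with
    | zero => exact Submodule.mem_one.2 ⟨1, by simp⟩
    | succ n ih =>
      rw [List.ofFn_succ, List.prod_cons, piece, pow_succ']
      exact Submodule.mul_mem_mul ⟨_, rfl⟩ (ih fun i => x i.succ)⟩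

/-- The `n`-th graded component `F_{≤ n} / F_{< n}` of a filtration, where `F n` is the part of
degree `< n`. -/
abbrev Gr (F : ℕ → Submodule ℂ B) (n : ℕ) : Type _ :=
  F (n + 1) ⧸ (F n).submoduleOf (F (n + 1))

/-- The map induced on the `n`-th graded components by a filtered linear map. -/
def grMap {C : Type*} [AddCommGroup C] [Module ℂ C] {F : ℕ → Submodule ℂ B}
    {F' : ℕ → Submodule ℂ C} (g : B →ₗ[ℂ] C) (hg : ∀ n, F n ≤ (F' n).comap g) (n : ℕ) :
    Gr F n →ₗ[ℂ] Gr F' n :=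
  Submodule.mapQ _ _ (g.restrict fun _ hx => hg (n + 1) hx) fun _ hx => hg n hx

/-- The filtration induced on a subspace. -/
def subFil (S : Submodule ℂ B) (F : ℕ → Submodule ℂ B) (n : ℕ) : Submodule ℂ B :=
  S ⊓ F n

/-- The inclusion of the graded components of a subspace with its induced filtration. -/
def grIncl (S : Submodule ℂ B) (F : ℕ → Submodule ℂ B) (n : ℕ) :
    Gr (subFil S F) n →ₗ[ℂ] Gr F n :=
  grMap LinearMap.id (fun _ => (inf_le_right : S ⊓ F _ ≤ F _)) n

/-- The class in `F_{≤ n} / F_{< n}` of a combination of products of `n` generators. -/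
def toGr (f : M →ₗ[ℂ] A) (n : ℕ) : piece f n →ₗ[ℂ] Gr (fil f) n :=
  Submodule.mkQ _ ∘ₗ Submodule.inclusion (piece_le_fil f n)

end Filtration

/-! ### Symmetric algebras -/

section Symmetric

variable {M : Type*} [AddCommGroup M] [Module ℂ M]

/-- The value of an element of `S(M) = ℂ[M*]` at a point of `M*`. -/
noncomputable def evalAt (l : Module.Dual ℂ M) : SymmetricAlgebra ℂ M →ₐ[ℂ] ℂ :=
  SymmetricAlgebra.lift l

/-- The algebra map `S(M) → S(N)` induced by a linear map. -/
noncomputable def symMap {N : Type*} [AddCommGroup N] [Module ℂ N] (p : M →ₗ[ℂ] N) :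
    SymmetricAlgebra ℂ M →ₐ[ℂ] SymmetricAlgebra ℂ N :=
  SymmetricAlgebra.lift (SymmetricAlgebra.ι ℂ N ∘ₗ p)

theorem symMap_mem_piece {N : Type*} [AddCommGroup N] [Module ℂ N] (p : M →ₗ[ℂ] N) (n : ℕ)
    (s : SymmetricAlgebra ℂ M) (hs : s ∈ piece (SymmetricAlgebra.ι ℂ M) n) :
    symMap p s ∈ piece (SymmetricAlgebra.ι ℂ N) n := by
  have h : (piece (SymmetricAlgebra.ι ℂ M) n).map (symMap p).toLinearMap ≤
      piece (SymmetricAlgebra.ι ℂ N) n := by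
    rw [piece, piece, Submodule.map_pow]
    refine pow_le_pow_left' ?_ n
    rintro _ ⟨_, ⟨x, rfl⟩, rfl⟩
    exact ⟨p x, by simp [symMap]⟩
  exact h ⟨s, hs, rfl⟩

/-- `symMap` on components of degree `n`. -/
noncomputable def symMapPiece {N : Type*} [AddCommGroup N] [Module ℂ N] (p : M →ₗ[ℂ] N) (n : ℕ) :
    piece (SymmetricAlgebra.ι ℂ M) n →ₗ[ℂ] piece (SymmetricAlgebra.ι ℂ N) n :=
  (symMap p).toLinearMap.restrict (symMap_mem_piece p n)

/-- The algebra map `S(M) → S(M)[ε]`, `y ↦ y + ε D y`, attached to an endomorphism `D` of `M`. -/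
noncomputable def symDual (D : M →ₗ[ℂ] M) :
    SymmetricAlgebra ℂ M →ₐ[ℂ]
      TrivSqZeroExt (SymmetricAlgebra ℂ M) (SymmetricAlgebra ℂ M) :=
  SymmetricAlgebra.lift
    ((TrivSqZeroExt.inlAlgHom ℂ (SymmetricAlgebra ℂ M) (SymmetricAlgebra ℂ M)).toLinearMap ∘ₗ
        SymmetricAlgebra.ι ℂ M +
      (TrivSqZeroExt.inrHom (SymmetricAlgebra ℂ M) (SymmetricAlgebra ℂ M)).restrictScalars ℂ ∘ₗ
        SymmetricAlgebra.ι ℂ M ∘ₗ D)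

theorem fst_symDual (D : M →ₗ[ℂ] M) (s : SymmetricAlgebra ℂ M) : (symDual D s).fst = s := by
  have : (TrivSqZeroExt.fstHom ℂ (SymmetricAlgebra ℂ M) (SymmetricAlgebra ℂ M)).comp
      (symDual D) = AlgHom.id ℂ _ := by
    ext x
    simp [symDual]
  exact congr($this s)

/-- The unique derivation of `S(M)` that extends an endomorphism `D` of `M`. -/
noncomputable def symDer (D : M →ₗ[ℂ] M) :
    Derivation ℂ (SymmetricAlgebra ℂ M) (SymmetricAlgebra ℂ M) :=
  Derivation.mk'
    ((TrivSqZeroExt.sndHom (SymmetricAlgebra ℂ M) (SymmetricAlgebra ℂ M)).restrictScalars ℂ ∘ₗ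
      (symDual D).toLinearMap) (by
    intro a c
    simp [fst_symDual, mul_comm])

theorem symDer_ι (D : M →ₗ[ℂ] M) (x : M) :
    symDer D (SymmetricAlgebra.ι ℂ M x) = SymmetricAlgebra.ι ℂ M (D x) := by
  simp [symDer, symDual]

end Symmetric

/-! ### Enveloping algebras -/

section Enveloping

attribute [local instance] LieRing.ofAssociativeRing

variable {L : Type*} [LieRing L] [LieAlgebra ℂ L]

/-- The space of invariants `S(𝔤)^𝔤` for the adjoint action (by derivations). -/
noncomputable def symInvariants (L : Type*) [LieRing L] [LieAlgebra ℂ L] :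
    Submodule ℂ (SymmetricAlgebra ℂ L) :=
  ⨅ x : L, LinearMap.ker (symDer (LieModule.toEnd ℂ L L x)).toLinearMap

/-- The canonical linear map `𝔤 → U(𝔤)`. -/
noncomputable def uι (L : Type*) [LieRing L] [LieAlgebra ℂ L] :
    L →ₗ[ℂ] UniversalEnvelopingAlgebra ℂ L :=
  (UniversalEnvelopingAlgebra.ι ℂ : L →ₗ⁅ℂ⁆ UniversalEnvelopingAlgebra ℂ L)

/-- The algebra map `U(𝔨) → U(𝔤)` induced by the inclusion of a subalgebra. -/
noncomputable def uIncl (K : LieSubalgebra ℂ L) :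
    UniversalEnvelopingAlgebra ℂ K →ₐ[ℂ] UniversalEnvelopingAlgebra ℂ L :=
  UniversalEnvelopingAlgebra.lift ℂ ((UniversalEnvelopingAlgebra.ι ℂ).comp K.incl)

/-- The counit `ε : U(𝔤) → ℂ`. -/
noncomputable def counit (L : Type*) [LieRing L] [LieAlgebra ℂ L] :
    UniversalEnvelopingAlgebra ℂ L →ₐ[ℂ] ℂ :=
  UniversalEnvelopingAlgebra.lift ℂ (0 : L →ₗ⁅ℂ⁆ ℂ)

/-- The identification `U(𝔥) = S(𝔥)` for an abelian Lie algebra. -/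
noncomputable def uToSym (L : Type*) [LieRing L] [LieAlgebra ℂ L] [IsLieAbelian L] :
    UniversalEnvelopingAlgebra ℂ L →ₐ[ℂ] SymmetricAlgebra ℂ L :=
  UniversalEnvelopingAlgebra.lift ℂ
    { SymmetricAlgebra.ι ℂ L with
      map_lie' := by
        intro x y
        simp [LieRing.of_associative_ring_bracket, mul_comm, trivial_lie_zero L L x y] }

/-- The action of `U(𝔤)` on a `𝔤`-module. -/
noncomputable def uAct (V : Type*) [AddCommGroup V] [Module ℂ V] [LieRingModule L V]
    [LieModule ℂ L V] : UniversalEnvelopingAlgebra ℂ L →ₐ[ℂ] Module.End ℂ V :=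
  UniversalEnvelopingAlgebra.lift ℂ (LieModule.toEnd ℂ L V)

end Enveloping

/-! ### The triangular decomposition attached to a Cartan subalgebra and a base -/

open LieAlgebra LieAlgebra.IsKilling LieModule

section Triangular

variable {L : Type*} [LieRing L] [LieAlgebra ℂ L]

/-- The sum of the root spaces of the elements of `s`. -/
noncomputable def rootSum {H : LieSubalgebra ℂ L} [LieRing.IsNilpotent H] (s : Set (H → ℂ)) :
    LieSubmodule ℂ H L :=
  ⨆ χ, ⨆ (_ : χ ∈ s), rootSpace H χ

theorem lie_mem_rootSum {H : LieSubalgebra ℂ L} [LieRing.IsNilpotent H] {s : Set (H → ℂ)}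
    (hs : ∀ χ₁ ∈ s, ∀ χ₂ ∈ s, rootSpace H (χ₁ + χ₂) ≠ ⊥ → χ₁ + χ₂ ∈ s) {x y : L}
    (hx : x ∈ rootSum s) (hy : y ∈ rootSum s) : ⁅x, y⁆ ∈ rootSum s := by
  unfold rootSum at *
  induction hx using LieSubmodule.iSup_induction' with
  | zero => simp
  | add _ _ _ _ hu hv => rw [add_lie]; exact add_mem hu hv
  | mem χ₁ u hu =>
    by_cases hχ₁ : χ₁ ∈ s; swap
    · simp_all
    replace hu : u ∈ rootSpace H χ₁ := by simpa [hχ₁] using hu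
    induction hy using LieSubmodule.iSup_induction' with
    | zero => simp
    | add _ _ _ _ hv hw => rw [lie_add]; exact add_mem hv hw
    | mem χ₂ v hv =>
      by_cases hχ₂ : χ₂ ∈ s; swap
      · simp_all
      replace hv : v ∈ rootSpace H χ₂ := by simpa [hχ₂] using hv
      have huv := lie_mem_genWeightSpace_of_mem_genWeightSpace hu hv
      by_cases hb : rootSpace H (χ₁ + χ₂) = ⊥
      · have h0 : ⁅u, v⁆ = 0 := by
          have h1 : ⁅u, v⁆ ∈ rootSpace H (χ₁ + χ₂) := huv
          rw [hb] at h1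
          simpa using h1
        rw [h0]
        exact zero_mem _
      · apply LieSubmodule.mem_iSup_of_mem (χ₁ + χ₂)
        simpa [hs _ hχ₁ _ hχ₂ hb] using huv

variable [FiniteDimensional ℂ L] [IsSemisimple ℂ L]
  {H : LieSubalgebra ℂ L} [H.IsCartanSubalgebra]

/-- The set `R₊` of positive roots. -/
def posRoots (b : (rootSystem H).Base) : Set (H → ℂ) :=
  {χ | ∃ α : H.root, b.IsPos α ∧ χ = (α : Weight ℂ H L)}

/-- The set `R₋ = -R₊` of negative roots. -/
def negRoots (b : (rootSystem H).Base) : Set (H → ℂ) :=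
  {χ | -χ ∈ posRoots b}

theorem posRoots_add (b : (rootSystem H).Base) (χ₁ : H → ℂ) (h₁ : χ₁ ∈ posRoots b) (χ₂ : H → ℂ)
    (h₂ : χ₂ ∈ posRoots b) (h : rootSpace H (χ₁ + χ₂) ≠ ⊥) : χ₁ + χ₂ ∈ posRoots b := by
  obtain ⟨α, hα, rfl⟩ := h₁
  obtain ⟨β, hβ, rfl⟩ := h₂
  have hne : (α.1 : H → ℂ) + (β.1 : H → ℂ) ≠ 0 := by
    intro h0
    let := (rootSystem H).indexNeg
    have hαβ : β = -α := by
      apply (rootSystem H).root.injective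
      rw [RootPairing.indexNeg_neg, RootPairing.root_reflectionPerm,
        RootPairing.reflection_apply_self]
      ext x
      have := congrFun h0 x
      simp only [Pi.add_apply, Pi.zero_apply] at this
      simpa using (eq_neg_of_add_eq_zero_right this)
    rw [hαβ, RootPairing.Base.IsPos.neg_iff_not] at hβ
    exact hβ hα
  let γ : H.root := ⟨⟨_, h⟩, by
    simp only [LieSubalgebra.root, Finset.mem_filter]
    exact ⟨Finset.mem_univ _, hne⟩⟩
  exact ⟨γ, hα.add hβ (by ext x; simp [γ]), rfl⟩

theorem negRoots_add (b : (rootSystem H).Base) (χ₁ : H → ℂ) (h₁ : χ₁ ∈ negRoots b) (χ₂ : H → ℂ)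
    (h₂ : χ₂ ∈ negRoots b) (h : rootSpace H (χ₁ + χ₂) ≠ ⊥) : χ₁ + χ₂ ∈ negRoots b := by
  have h' : rootSpace H (-χ₁ + -χ₂) ≠ ⊥ := by
    have := (-(⟨_, h⟩ : Weight ℂ H L)).genWeightSpace_ne_bot
    rw [Weight.coe_neg] at this
    rwa [← neg_add]
  have := posRoots_add b _ h₁ _ h₂ h'
  rwa [← neg_add] at this

/-- `𝔫₊`, the sum of the root spaces of the positive roots. -/
noncomputable def nPlus (b : (rootSystem H).Base) : LieSubalgebra ℂ L where
  toSubmodule := (rootSum (posRoots b)).toSubmodule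
  lie_mem' := lie_mem_rootSum (posRoots_add b)

/-- `𝔫₋`, the sum of the root spaces of the negative roots. -/
noncomputable def nMinus (b : (rootSystem H).Base) : LieSubalgebra ℂ L where
  toSubmodule := (rootSum (negRoots b)).toSubmodule
  lie_mem' := lie_mem_rootSum (negRoots_add b)

theorem zero_notMem_roots (b : (rootSystem H).Base) : (0 : H → ℂ) ∉ negRoots b ∪ posRoots b := by
  have h : (0 : H → ℂ) ∉ posRoots b := by
    rintro ⟨α, -, h⟩
    have := α.2
    simp only [LieSubalgebra.root, Finset.mem_filter] at this
    exact this.2 h.symm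
  rintro (h' | h')
  · exact h (by simpa [negRoots] using h')
  · exact h h'

theorem isCompl_cartan (b : (rootSystem H).Base) :
    IsCompl H.toSubmodule ((nMinus b).toSubmodule ⊔ (nPlus b).toSubmodule) := by
  have h0 : H.toLieSubmodule = rootSpace H (0 : H → ℂ) := by
    rw [rootSpace_zero_eq]
  have hsup : rootSum (negRoots b) ⊔ rootSum (posRoots b) =
      ⨆ χ ∈ negRoots b ∪ posRoots b, rootSpace H χ := by
    rw [iSup_union, rootSum, rootSum]
  have hc : IsCompl H.toLieSubmodule (rootSum (negRoots b) ⊔ rootSum (posRoots b)) := by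
    constructor
    · rw [hsup, h0]
      exact (iSupIndep_genWeightSpace ℂ H L).disjoint_biSup (zero_notMem_roots b)
    · rw [codisjoint_iff, eq_top_iff, ← cartan_sup_iSup_rootSpace_eq_top (K := ℂ) (H := H)]
      refine sup_le_sup_left (iSup₂_le fun α hα => ?_) _
      rw [hsup]
      refine le_iSup₂_of_le (α : H → ℂ) ?_ le_rfl
      let a : H.root := ⟨α, by simpa using hα⟩
      let := (rootSystem H).indexNeg
      rcases RootPairing.Base.IsPos.or_neg b a with h | h
      · exact Or.inr ⟨a, h, rfl⟩
      · refine Or.inl ⟨-a, h, ?_⟩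
        have : (rootSystem H).root (-a) = -(rootSystem H).root a := by
          rw [RootPairing.indexNeg_neg, RootPairing.root_reflectionPerm,
            RootPairing.reflection_apply_self]
        ext x
        exact congr($this x).symm
  have := LieSubmodule.isCompl_toSubmodule.2 hc
  rwa [LieSubmodule.sup_toSubmodule] at this

/-- The projection `𝔤 → 𝔥` along `𝔫₋ ⊕ 𝔫₊`. -/
noncomputable def cartanProj (b : (rootSystem H).Base) : L →ₗ[ℂ] H :=
  Submodule.projectionOnto _ _ (isCompl_cartan b)

/-- Half the sum of the positive roots. -/
noncomputable def rho (b : (rootSystem H).Base) : Module.Dual ℂ H :=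
  open Classical in (2⁻¹ : ℂ) • ∑ α : H.root with b.IsPos α, (rootSystem H).root α

/-- The fundamental weights: the basis of `𝔥*` dual to the simple coroots. -/
noncomputable def fundamentalWeight (b : (rootSystem H).Base) (i : b.support) :
    Module.Dual ℂ H :=
  b.toCoweightBasis.coord i

/-- The shifted action `w • l = w (l + ρ) - ρ` of the Weyl group. -/
noncomputable def dotAct (b : (rootSystem H).Base) (w : (rootSystem H).weylGroup)
    (l : Module.Dual ℂ H) : Module.Dual ℂ H :=
  w • (l + rho b) - rho b

/-- `ℂ[𝔥*]^W`. -/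
noncomputable def weylInvariants (H : LieSubalgebra ℂ L) [H.IsCartanSubalgebra] :
    Subalgebra ℂ (SymmetricAlgebra ℂ H) :=
  ⨅ (w : (rootSystem H).weylGroup) (l : Module.Dual ℂ H),
    AlgHom.equalizer (evalAt (w • l)) (evalAt l)

/-- `ℂ[𝔥*]^{W•}`, the invariants of the shifted action. -/
noncomputable def dotInvariants (b : (rootSystem H).Base) :
    Subalgebra ℂ (SymmetricAlgebra ℂ H) :=
  ⨅ (w : (rootSystem H).weylGroup) (l : Module.Dual ℂ H),
    AlgHom.equalizer (evalAt (dotAct b w l)) (evalAt l)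

/-- The multiplication map `μ : U(𝔫₋) ⊗ U(𝔥) ⊗ U(𝔫₊) → U(𝔤)`. -/
noncomputable def triMul (b : (rootSystem H).Base) :
    (UniversalEnvelopingAlgebra ℂ (nMinus b) ⊗[ℂ] UniversalEnvelopingAlgebra ℂ H) ⊗[ℂ]
      UniversalEnvelopingAlgebra ℂ (nPlus b) →ₗ[ℂ] UniversalEnvelopingAlgebra ℂ L :=
  LinearMap.mul' ℂ _ ∘ₗ TensorProduct.map
    (LinearMap.mul' ℂ _ ∘ₗ TensorProduct.map (uIncl (nMinus b)).toLinearMap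
      (uIncl H).toLinearMap)
    (uIncl (nPlus b)).toLinearMap

/-- The map `β : a₋ ⊗ h ⊗ a₊ ↦ ε(a₋) ε(a₊) h`, with values in `U(𝔥) = S(𝔥)`. -/
noncomputable def triProj (b : (rootSystem H).Base) :
    (UniversalEnvelopingAlgebra ℂ (nMinus b) ⊗[ℂ] UniversalEnvelopingAlgebra ℂ H) ⊗[ℂ]
      UniversalEnvelopingAlgebra ℂ (nPlus b) →ₗ[ℂ] SymmetricAlgebra ℂ H :=
  LinearMap.mul' ℂ _ ∘ₗ TensorProduct.map
    (LinearMap.mul' ℂ _ ∘ₗ TensorProduct.map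
      (Algebra.linearMap ℂ (SymmetricAlgebra ℂ H) ∘ₗ (counit (nMinus b)).toLinearMap)
      (uToSym H).toLinearMap)
    (Algebra.linearMap ℂ (SymmetricAlgebra ℂ H) ∘ₗ (counit (nPlus b)).toLinearMap)

open Classical in
/-- The Harish-Chandra map `β ∘ μ⁻¹ : U(𝔤) → S(𝔥)`. That `μ` is bijective (so that the second
case never occurs) is part of the main statement. -/
noncomputable def HC (b : (rootSystem H).Base) :
    UniversalEnvelopingAlgebra ℂ L →ₗ[ℂ] SymmetricAlgebra ℂ H :=
  if h : Function.Bijective (triMul b) then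
    triProj b ∘ₗ (LinearEquiv.ofBijective (triMul b) h).symm.toLinearMap
  else 0

/-- The restriction map `S(𝔤) = ℂ[𝔤*] → ℂ[𝔥*] = S(𝔥)`; here `𝔥*` sits in `𝔤*` as the functionals
that vanish on `𝔫₋ ⊕ 𝔫₊`. -/
noncomputable def res (b : (rootSystem H).Base) :
    SymmetricAlgebra ℂ L →ₐ[ℂ] SymmetricAlgebra ℂ H :=
  symMap (cartanProj b)

/-- The restriction map on components of degree `n`. -/
noncomputable def resPiece (b : (rootSystem H).Base) (n : ℕ) :
    piece (SymmetricAlgebra.ι ℂ L) n →ₗ[ℂ] piece (SymmetricAlgebra.ι ℂ H) n :=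
  symMapPiece (cartanProj b) n

/-- `V` is a highest weight module with highest weight `l`, generated by the highest weight
vector `v`. -/
structure IsHighestWeight (b : (rootSystem H).Base) (l : Module.Dual ℂ H) {V : Type*}
    [AddCommGroup V] [Module ℂ V] [LieRingModule L V] [LieModule ℂ L V] (v : V) : Prop where
  ne_zero : v ≠ 0
  weight : ∀ h : H, ⁅(h : L), v⁆ = l h • v
  singular : ∀ x ∈ nPlus b, ⁅x, v⁆ = 0
  generates : LieSubmodule.lieSpan ℂ L {v} = ⊤

/-- `f` is a vector of weight `-l` in the dual module `V*`, annihilated by `𝔫₋`. -/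
structure IsLowestWeightDual (b : (rootSystem H).Base) (l : Module.Dual ℂ H) {V : Type*}
    [AddCommGroup V] [Module ℂ V] [LieRingModule L V] [LieModule ℂ L V]
    (f : Module.Dual ℂ V) : Prop where
  weight : ∀ h : H, ⁅(h : L), (f : V →ₗ[ℂ] ℂ)⁆ = -l h • f
  singular : ∀ y ∈ nMinus b, ⁅y, (f : V →ₗ[ℂ] ℂ)⁆ = 0

end Triangular

/-- The centre `Z(𝔤)` of the enveloping algebra. -/
abbrev centerU (L : Type*) [LieRing L] [LieAlgebra ℂ L] :
    Subalgebra ℂ (UniversalEnvelopingAlgebra ℂ L) :=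
  Subalgebra.center ℂ _

end HarishChandra

open HarishChandra LieAlgebra LieAlgebra.IsKilling

namespace HarishChandra

/-! ### Filtrations generated by a linear map -/

section FiltrationLemmas

variable {M A : Type*} [AddCommGroup M] [Module ℂ M] [Ring A] [Algebra ℂ A] (f : M →ₗ[ℂ] A)

/-! Everything is controlled by leading terms for the degree filtrations. The symmetrization map
`symmetrize` is equivariant and identifies `Sⁿ(𝔤)` with `grₙ U(𝔤)`, so it lifts invariants to
central elements and `gr Z(𝔤) = S(𝔤)^𝔤`. `HC` of a product of `n` elements of `𝔤` is the product of
their projections to `𝔥` up to lower degree (`HC_prod_sub_mem`), so `gr HC` is restriction.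
Translation by `ρ` does not affect leading terms. Hence (v) follows, by induction on the degree,
from the shifted invariance of `HC(Z(𝔤))` and Chevalley's theorem that restriction maps `S(𝔤)^𝔤`
bijectively onto `S(𝔥)^W`.

The bijectivity of `μ` and of the symbol map rests on the Poincaré–Birkhoff–Witt theorem. It is
obtained from the confluence of the rewriting of words by commutation relations (`wordMap_swap`),
which yields a linear map `U(𝔤) → S(𝔤)` sending sorted words to monomials.

The pairing `(v*, u v)` computes `HC(u)` at the highest weight (`evalAt_HC_eq`), and central
elements act by scalars. Since Verma modules exist for all weights and polynomials are determined by
their values, (i) follows. For a simple root `α` with `l(α^∨) = n` a natural number, `f^(n+1) v` is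
a singular vector of the Verma module, so the scalars at `l` and at `s_α • l` agree; such `l` are
Zariski dense, which gives (ii).

Injectivity of restriction (`eq_zero_of_res_eq_zero`) is infinitesimal: the part of an invariant of
lowest degree in `𝔫₋ ⊕ 𝔫₊` is killed by rank one derivations that together generate the Euler
operator in these directions, so this degree is zero.

Surjectivity uses traces. On a finite-dimensional module the trace of the `n`-th power of the
generic matrix is an invariant whose restriction is the sum of `n`-th powers of the weights.
Induction over dominant weights extracts single orbit sums (`orbitSum_mem_resImage`), and by
polarization these span `Sⁿ(𝔥)^W`. The finite-dimensional modules themselves are built as quotients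
of `U(𝔤)`. -/

theorem fil_mono : Monotone (fil f) := fun _ _ h =>
  iSup_le fun i => le_iSup_of_le (Fin.castLE h i) le_rfl

theorem fil_zero : fil f 0 = ⊥ := by simp [fil]

theorem piece_le_fil_of_lt {m n : ℕ} (h : m < n) : piece f m ≤ fil f n :=
  (piece_le_fil f m).trans (fil_mono f h)

theorem fil_succ (n : ℕ) : fil f (n + 1) = fil f n ⊔ piece f n := by
  refine le_antisymm (iSup_le fun i => ?_)
    (sup_le (fil_mono f n.le_succ) (piece_le_fil f n))
  rcases Nat.lt_succ_iff_lt_or_eq.1 i.2 with h | h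
  · exact le_sup_of_le_left (piece_le_fil_of_lt f h)
  · rw [h]; exact le_sup_right

theorem fil_induction {n : ℕ} {p : A → Prop} (h0 : p 0) (hadd : ∀ a c, p a → p c → p (a + c))
    (hp : ∀ m < n, ∀ a ∈ piece f m, p a) {a : A} (ha : a ∈ fil f n) : p a :=
  Submodule.iSup_induction _ (motive := p) ha (fun i x hx => hp i i.2 x hx) h0 hadd

theorem mul_mem_piece {m n : ℕ} {a c : A} (ha : a ∈ piece f m) (hc : c ∈ piece f n) :
    a * c ∈ piece f (m + n) := by
  rw [piece, pow_add]; exact Submodule.mul_mem_mul ha hc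

theorem mem_piece_one (x : M) : f x ∈ piece f 1 := by
  rw [piece, pow_one]; exact ⟨x, rfl⟩

theorem one_mem_piece : (1 : A) ∈ piece f 0 := by
  rw [piece, pow_zero]; exact Submodule.one_le.1 le_rfl

theorem piece_mul_mem_fil {m n : ℕ} {a c : A} (ha : a ∈ piece f m) (hc : c ∈ fil f n) :
    a * c ∈ fil f (m + n) := by
  refine fil_induction f (p := fun c => a * c ∈ fil f (m + n)) (by simp)
    (fun _ _ h h' => by rw [mul_add]; exact add_mem h h') (fun k hk c hc => ?_) hc
  exact piece_le_fil_of_lt f (by omega) (mul_mem_piece f ha hc)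

/-- The index bounds the degree strictly, so degree `≤ m` times degree `< n` is degree `< m + n`;
this is why only one factor carries a successor. -/
theorem mul_mem_fil {m n : ℕ} {a c : A} (ha : a ∈ fil f (m + 1)) (hc : c ∈ fil f n) :
    a * c ∈ fil f (m + n) := by
  refine fil_induction f (p := fun a => a * c ∈ fil f (m + n)) (by simp)
    (fun _ _ h h' => by rw [add_mul]; exact add_mem h h') (fun k hk a ha => ?_) ha
  exact fil_mono f (by omega) (piece_mul_mem_fil f ha hc)

theorem prod_mem_piece (l : List M) : (l.map f).prod ∈ piece f l.length := by
  induction l with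
  | nil => simpa using one_mem_piece f
  | cons x l ih =>
    rw [List.map_cons, List.prod_cons, List.length_cons, add_comm]
    exact mul_mem_piece f (mem_piece_one f x) ih

theorem prod_mem_fil (l : List M) : (l.map f).prod ∈ fil f (l.length + 1) :=
  piece_le_fil f _ (prod_mem_piece f l)

/-- Products of `n` elements of a spanning set span the `n`-th piece. -/
theorem piece_eq_span {s : Set M} (hs : Submodule.span ℂ s = ⊤) (n : ℕ) :
    piece f n = Submodule.span ℂ
      {a | ∃ l : List M, l.length = n ∧ (∀ x ∈ l, x ∈ s) ∧ (l.map f).prod = a} := by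
  refine le_antisymm ?_ (Submodule.span_le.2 ?_)
  · induction n with
    | zero =>
      rw [piece, pow_zero, Submodule.one_le]
      exact Submodule.subset_span ⟨[], by simp⟩
    | succ n ih =>
      rw [piece, pow_succ', ← piece]
      refine (mul_le_mul' le_rfl ih).trans ?_
      rw [LinearMap.range_eq_map, ← hs, Submodule.map_span, Submodule.span_mul_span]
      refine Submodule.span_mono ?_
      rintro _ ⟨_, ⟨x, hx, rfl⟩, _, ⟨l, hl, hls, rfl⟩, rfl⟩
      exact ⟨x :: l, by simp [hl], by simpa [hx] using hls, by simp⟩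
  · rintro _ ⟨l, rfl, -, rfl⟩
    exact prod_mem_piece f l

theorem piece_induction {s : Set M} (hs : Submodule.span ℂ s = ⊤) {n : ℕ} {p : A → Prop}
    (h0 : p 0) (hadd : ∀ a c, p a → p c → p (a + c)) (hsmul : ∀ (t : ℂ) a, p a → p (t • a))
    (hp : ∀ l : List M, l.length = n → (∀ x ∈ l, x ∈ s) → p (l.map f).prod)
    {a : A} (ha : a ∈ piece f n) : p a := by
  rw [piece_eq_span f hs] at ha
  induction ha using Submodule.span_induction with
  | mem _ h => obtain ⟨l, hl, hls, rfl⟩ := h; exact hp l hl hls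
  | zero => exact h0
  | add a c _ _ ha hc => exact hadd _ _ ha hc
  | smul t a _ ha => exact hsmul _ _ ha

/-- If commutators of generators are generators, permuting the factors of a product changes it
by terms of lower degree. -/
theorem prod_sub_prod_mem_fil_of_perm (hf : ∀ x y, f x * f y - f y * f x ∈ piece f 1)
    {l l' : List M} (h : l.Perm l') : (l.map f).prod - (l'.map f).prod ∈ fil f l.length := by
  induction h with
  | nil => simp
  | @cons x l l' h ih =>
    simp only [List.map_cons, List.prod_cons, List.length_cons]
    rw [← mul_sub, add_comm]
    exact piece_mul_mem_fil f (mem_piece_one f x) ih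
  | swap x y l =>
    simp only [List.map_cons, List.prod_cons, List.length_cons]
    rw [← mul_assoc, ← mul_assoc, ← sub_mul]
    exact piece_le_fil_of_lt f (by omega) (mul_mem_piece f (hf y x) (prod_mem_piece f l))
  | trans h _ ih ih' =>
    rw [← h.length_eq] at ih'
    simpa using add_mem ih ih'

theorem exists_mem_fil (hf : Algebra.adjoin ℂ (Set.range f) = ⊤) (a : A) : ∃ n, a ∈ fil f n := by
  have ha : a ∈ Algebra.adjoin ℂ (Set.range f) := hf ▸ Algebra.mem_top
  induction ha using Algebra.adjoin_induction with
  | mem _ h =>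
    obtain ⟨x, rfl⟩ := h
    exact ⟨2, piece_le_fil_of_lt f one_lt_two (mem_piece_one f x)⟩
  | algebraMap r =>
    rw [Algebra.algebraMap_eq_smul_one]
    exact ⟨1, Submodule.smul_mem _ _ (piece_le_fil f 0 (one_mem_piece f))⟩
  | add _ _ _ _ h h' =>
    obtain ⟨⟨m, hm⟩, n, hn⟩ := h, h'
    exact ⟨max m n, add_mem (fil_mono f (le_max_left m n) hm) (fil_mono f (le_max_right m n) hn)⟩
  | mul _ _ _ _ h h' =>
    obtain ⟨⟨m, hm⟩, n, hn⟩ := h, h'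
    exact ⟨m + n, mul_mem_fil f (fil_mono f m.le_succ hm) hn⟩

/-- An element of the subspace that has lower degree already has lower degree for the induced
filtration. -/
theorem grIncl_injective {B : Type*} [AddCommGroup B] [Module ℂ B] (S : Submodule ℂ B)
    (F : ℕ → Submodule ℂ B) (n : ℕ) : Function.Injective (grIncl S F n) := by
  rw [injective_iff_map_eq_zero]
  intro a ha
  obtain ⟨⟨x, hx⟩, rfl⟩ := Submodule.mkQ_surjective _ a
  have h := (Submodule.Quotient.mk_eq_zero _).1 ha
  exact (Submodule.Quotient.mk_eq_zero _).2 ⟨hx.1, h⟩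

end FiltrationLemmas

/-! ### The grading of the symmetric algebra -/

section SymmetricGrading

variable (M : Type*) [AddCommGroup M] [Module ℂ M]

theorem adjoin_range_ι : Algebra.adjoin ℂ (Set.range (SymmetricAlgebra.ι ℂ M)) = ⊤ := by
  rw [eq_top_iff]
  rintro s -
  induction s using SymmetricAlgebra.induction with
  | algebraMap r => exact Subalgebra.algebraMap_mem _ r
  | ι x => exact Algebra.subset_adjoin ⟨x, rfl⟩
  | mul _ _ h h' => exact mul_mem h h'
  | add _ _ h h' => exact add_mem h h'

/-- The algebra map `S(M) → S(M)[X]` that multiplies elements of degree `n` by `X ^ n`. -/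
noncomputable def symGrade : SymmetricAlgebra ℂ M →ₐ[ℂ] Polynomial (SymmetricAlgebra ℂ M) :=
  SymmetricAlgebra.lift
    ((Polynomial.monomial 1).restrictScalars ℂ ∘ₗ SymmetricAlgebra.ι ℂ M)

/-- The component of degree `n`. -/
noncomputable def symComp (n : ℕ) : SymmetricAlgebra ℂ M →ₗ[ℂ] SymmetricAlgebra ℂ M :=
  (Polynomial.lcoeff _ n).restrictScalars ℂ ∘ₗ (symGrade M).toLinearMap

variable {M}

theorem symGrade_of_mem_piece {n : ℕ} {s : SymmetricAlgebra ℂ M}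
    (hs : s ∈ piece (SymmetricAlgebra.ι ℂ M) n) : symGrade M s = Polynomial.monomial n s := by
  refine piece_induction (SymmetricAlgebra.ι ℂ M) Submodule.span_univ
    (p := fun s => symGrade M s = Polynomial.monomial n s) (by simp)
    (fun _ _ h h' => by simp [h, h']) (fun t a h => by
      simp only [map_smul, h, Polynomial.smul_monomial]) (fun l hl _ => ?_) hs
  subst hl
  clear hs
  induction l with
  | nil => simp
  | cons x l ih =>
    rw [List.map_cons, List.prod_cons, map_mul, ih (by simp)]
    simp [symGrade, Polynomial.monomial_mul_monomial, add_comm]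

theorem symComp_of_mem_piece {m : ℕ} (n : ℕ) {s : SymmetricAlgebra ℂ M}
    (hs : s ∈ piece (SymmetricAlgebra.ι ℂ M) m) : symComp M n s = if m = n then s else 0 := by
  simp [symComp, symGrade_of_mem_piece hs, Polynomial.coeff_monomial]

theorem symComp_self {n : ℕ} {s : SymmetricAlgebra ℂ M}
    (hs : s ∈ piece (SymmetricAlgebra.ι ℂ M) n) : symComp M n s = s := by
  simp [symComp_of_mem_piece n hs]

theorem symComp_of_mem_fil {m n : ℕ} (h : m ≤ n) {s : SymmetricAlgebra ℂ M}
    (hs : s ∈ fil (SymmetricAlgebra.ι ℂ M) m) : symComp M n s = 0 := by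
  refine fil_induction _ (p := fun s => symComp M n s = 0) (by simp)
    (fun _ _ h h' => by rw [map_add, h, h', add_zero]) (fun k hk a ha => ?_) hs
  rw [symComp_of_mem_piece n ha, if_neg (by omega)]

theorem symComp_mem (n : ℕ) (s : SymmetricAlgebra ℂ M) :
    symComp M n s ∈ piece (SymmetricAlgebra.ι ℂ M) n := by
  obtain ⟨m, hm⟩ := exists_mem_fil _ (adjoin_range_ι M) s
  refine fil_induction _ (p := fun s => symComp M n s ∈ piece (SymmetricAlgebra.ι ℂ M) n)
    (by simp) (fun _ _ h h' => by rw [map_add]; exact add_mem h h') (fun k hk a ha => ?_) hm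
  rw [symComp_of_mem_piece n ha]
  split_ifs with h
  · exact h ▸ ha
  · exact zero_mem _

theorem sum_symComp {n : ℕ} {s : SymmetricAlgebra ℂ M}
    (hs : s ∈ fil (SymmetricAlgebra.ι ℂ M) n) : ∑ i ∈ Finset.range n, symComp M i s = s := by
  refine fil_induction _ (p := fun s => ∑ i ∈ Finset.range n, symComp M i s = s)
    (by simp) (fun _ _ h h' => by simp only [map_add, Finset.sum_add_distrib, h, h'])
    (fun k hk a ha => ?_) hs
  simp only [symComp_of_mem_piece _ ha, Finset.sum_ite_eq, Finset.mem_range, hk, if_true]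

/-- Directness of the grading; it turns congruences modulo lower degree between homogeneous elements
into equalities. -/
theorem eq_zero_of_mem_piece_of_mem_fil {n : ℕ} {s : SymmetricAlgebra ℂ M}
    (hs : s ∈ piece (SymmetricAlgebra.ι ℂ M) n) (hs' : s ∈ fil (SymmetricAlgebra.ι ℂ M) n) :
    s = 0 := by
  rw [← symComp_self hs, symComp_of_mem_fil le_rfl hs']

theorem toGr_surjective {A : Type*} [Ring A] [Algebra ℂ A] (f : M →ₗ[ℂ] A) (n : ℕ) :
    Function.Surjective (toGr f n) := by
  intro a
  obtain ⟨⟨x, hx⟩, rfl⟩ := Submodule.mkQ_surjective _ a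
  rw [fil_succ] at hx
  obtain ⟨y, hy, z, hz, rfl⟩ := Submodule.mem_sup.1 hx
  refine ⟨⟨z, hz⟩, (Submodule.Quotient.eq _).2 ?_⟩
  have : z - (y + z) ∈ fil f n := by simpa using hy
  exact this

theorem toGr_ι_bijective (n : ℕ) : Function.Bijective (toGr (SymmetricAlgebra.ι ℂ M) n) := by
  refine ⟨?_, toGr_surjective _ n⟩
  rw [injective_iff_map_eq_zero]
  intro a ha
  have h := (Submodule.Quotient.mk_eq_zero _).1 ha
  exact Subtype.ext (eq_zero_of_mem_piece_of_mem_fil a.2 h)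

/-- Elements of `S(M)` are determined by their values on `M*`. -/
theorem ext_evalAt [FiniteDimensional ℂ M] {s t : SymmetricAlgebra ℂ M}
    (h : ∀ l : Module.Dual ℂ M, evalAt l s = evalAt l t) : s = t := by
  let b := Module.finBasis ℂ M
  apply (SymmetricAlgebra.equivMvPolynomial b).injective
  apply MvPolynomial.funext
  intro x
  have key : (evalAt (b.constr ℂ x)) =
      (MvPolynomial.aeval x).comp (SymmetricAlgebra.equivMvPolynomial b).toAlgHom := by
    apply SymmetricAlgebra.algHom_ext
    refine b.ext fun i => ?_
    simp [evalAt]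
  simpa [key, MvPolynomial.aeval_eq_eval] using h (b.constr ℂ x)

theorem symDer_mem_piece (D : M →ₗ[ℂ] M) (n : ℕ) {s : SymmetricAlgebra ℂ M}
    (hs : s ∈ piece (SymmetricAlgebra.ι ℂ M) n) :
    symDer D s ∈ piece (SymmetricAlgebra.ι ℂ M) n := by
  refine piece_induction (SymmetricAlgebra.ι ℂ M) Submodule.span_univ
    (p := fun s => symDer D s ∈ piece (SymmetricAlgebra.ι ℂ M) n) (by simp)
    (fun _ _ h h' => by rw [map_add]; exact add_mem h h') (fun t a h => by
      rw [Derivation.map_smul]; exact Submodule.smul_mem _ _ h) (fun l hl _ => ?_) hs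
  subst hl
  clear hs
  induction l with
  | nil => simp
  | cons x l ih =>
    rw [List.map_cons, List.prod_cons, Derivation.leibniz, symDer_ι, List.length_cons, add_comm,
      smul_eq_mul, smul_eq_mul]
    refine add_mem (mul_mem_piece _ (mem_piece_one _ x) (ih (by simp))) ?_
    rw [mul_comm]
    exact mul_mem_piece _ (mem_piece_one _ _) (prod_mem_piece _ l)

theorem symComp_symDer (D : M →ₗ[ℂ] M) (n : ℕ) (s : SymmetricAlgebra ℂ M) :
    symComp M n (symDer D s) = symDer D (symComp M n s) := by
  obtain ⟨m, hm⟩ := exists_mem_fil _ (adjoin_range_ι M) s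
  refine fil_induction _ (p := fun s => symComp M n (symDer D s) = symDer D (symComp M n s))
    (by simp) (fun _ _ h h' => by simp only [map_add, h, h']) (fun k hk a ha => ?_) hm
  rw [symComp_of_mem_piece n ha, symComp_of_mem_piece n (symDer_mem_piece D k ha)]
  split_ifs <;> simp

end SymmetricGrading

end HarishChandra

namespace HarishChandra

/-! ### The Poincaré–Birkhoff–Witt theorem -/

section PBW

theorem basis_induction {M I : Type*} [AddCommGroup M] [Module ℂ M] (β : Module.Basis I ℂ M)
    {p : M → Prop} (zero : p 0) (add : ∀ x y, p x → p y → p (x + y))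
    (smul : ∀ (t : ℂ) x, p x → p (t • x)) (basis : ∀ i, p (β i)) (x : M) : p x := by
  have hx : x ∈ Submodule.span ℂ (Set.range β) := β.mem_span x
  induction hx using Submodule.span_induction with
  | mem _ h => obtain ⟨i, rfl⟩ := h; exact basis i
  | zero => exact zero
  | add _ _ _ _ h h' => exact add _ _ h h'
  | smul t _ _ h => exact smul t _ h

/-- The number of inversions of a word. -/
def inversions {I : Type*} [LinearOrder I] : List I → ℕ
  | [] => 0
  | a :: l => l.countP (· < a) + inversions l

/-- A letter of the prefix sees only the multiset of what follows, so its contribution is unchanged.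
This decrease drives all inductions on words below. -/
theorem inversions_swap {I : Type*} [LinearOrder I] (u v : List I) {a c : I} (h : c < a) :
    inversions (u ++ c :: a :: v) < inversions (u ++ a :: c :: v) := by
  induction u with
  | nil =>
    simp [inversions, h, h.not_gt]
    omega
  | cons x u ih =>
    have hp : (u ++ c :: a :: v).Perm (u ++ a :: c :: v) := (List.Perm.swap _ _ _).append_left u
    simp only [List.cons_append, inversions, hp.countP_eq]
    omega

variable {L I : Type*} [LieRing L] [LieAlgebra ℂ L] [LinearOrder I] (β : Module.Basis I ℂ L)

open Classical in
/-- The value in `S(L)` of a word in the elements of an ordered basis of `L`, obtained by sorting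
the word with the commutation relations of `U(L)`. -/
noncomputable def wordMap (l : List I) : SymmetricAlgebra ℂ L :=
  -- The inverted pair to be swapped is an arbitrary choice; that the result does not depend on it
  -- is the content of `wordMap_swap`.
  if h : ∃ (u : List I) (a c : I) (v : List I), c < a ∧ l = u ++ a :: c :: v then
    wordMap (h.choose ++ h.choose_spec.choose_spec.choose :: h.choose_spec.choose ::
        h.choose_spec.choose_spec.choose_spec.choose) +
      β.constr ℂ (fun k => wordMap (h.choose ++ k ::
        h.choose_spec.choose_spec.choose_spec.choose))
        ⁅β h.choose_spec.choose, β h.choose_spec.choose_spec.choose⁆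
  else ((l.map β).map (SymmetricAlgebra.ι ℂ L)).prod
-- The swapped word has fewer inversions, the commutator term is shorter.
termination_by (l.length, inversions l)
decreasing_by
  · have hs := h.choose_spec.choose_spec.choose_spec.choose_spec
    rw [Prod.lex_def]
    right
    refine ⟨?_, ?_⟩
    · conv_rhs => rw [hs.2]
      simp
    · conv_rhs => rw [hs.2]
      exact inversions_swap _ _ hs.1
  · have hs := h.choose_spec.choose_spec.choose_spec.choose_spec
    rw [Prod.lex_def]
    left
    conv_rhs => rw [hs.2]
    simp

/-- Insertion of an element of `L` between two words. -/
noncomputable def wordInsert (u v : List I) : L →ₗ[ℂ] SymmetricAlgebra ℂ L :=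
  β.constr ℂ fun k => wordMap β (u ++ k :: v)

theorem wordInsert_basis (u v : List I) (k : I) :
    wordInsert β u v (β k) = wordMap β (u ++ k :: v) := by
  simp [wordInsert]

theorem exists_wordMap_eq {l : List I}
    (h : ∃ (u : List I) (a c : I) (v : List I), c < a ∧ l = u ++ a :: c :: v) :
    ∃ (u : List I) (a c : I) (v : List I), c < a ∧ l = u ++ a :: c :: v ∧
      wordMap β l = wordMap β (u ++ c :: a :: v) + wordInsert β u v ⁅β a, β c⁆ := by
  have hs := h.choose_spec.choose_spec.choose_spec.choose_spec
  refine ⟨_, _, _, _, hs.1, hs.2, ?_⟩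
  rw [wordMap, dif_pos h]
  rfl

theorem wordMap_eq_prod {l : List I}
    (h : ¬∃ (u : List I) (a c : I) (v : List I), c < a ∧ l = u ++ a :: c :: v) :
    wordMap β l = ((l.map β).map (SymmetricAlgebra.ι ℂ L)).prod := by
  rw [wordMap, dif_neg h]

/-- The commutation relation for all pairs of letters, given that for inverted pairs. -/
theorem wordMap_sub_of_lt {n : ℕ}
    (h : ∀ (u v : List I) (a c : I), c < a → (u ++ a :: c :: v).length = n →
      wordMap β (u ++ a :: c :: v) =
        wordMap β (u ++ c :: a :: v) + wordInsert β u v ⁅β a, β c⁆)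
    (u v : List I) (a c : I) (hl : (u ++ a :: c :: v).length = n) :
    wordMap β (u ++ a :: c :: v) =
        wordMap β (u ++ c :: a :: v) + wordInsert β u v ⁅β a, β c⁆ := by
  rcases lt_trichotomy a c with hac | rfl | hac
  · rw [h u v c a hac (by simpa using hl), ← lie_skew, map_neg]
    abel
  · simp
  · exact h u v a c hac hl

/-- Two disjoint inverted pairs. -/
theorem wordMap_confluent_disjoint {n : ℕ}
    (h : ∀ (u v : List I) (a c : I), (u ++ a :: c :: v).length < n →
      wordMap β (u ++ a :: c :: v) =
        wordMap β (u ++ c :: a :: v) + wordInsert β u v ⁅β a, β c⁆)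
    (u w v : List I) (a c a' c' : I) (hl : (u ++ a :: c :: (w ++ a' :: c' :: v)).length = n) :
    wordInsert β u (w ++ a' :: c' :: v) ⁅β a, β c⁆ +
        wordInsert β (u ++ c :: a :: w) v ⁅β a', β c'⁆ =
      wordInsert β (u ++ a :: c :: w) v ⁅β a', β c'⁆ +
        wordInsert β u (w ++ c' :: a' :: v) ⁅β a, β c⁆ := by
  -- `B` inserts one vector at each of the two places. Both orders of rewriting leave the same term
  -- `B ⁅β a, β c⁆ ⁅β a', β c'⁆`, computed with words shorter than `n`.
  let B : L →ₗ[ℂ] L →ₗ[ℂ] SymmetricAlgebra ℂ L :=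
    β.constr ℂ fun k => wordInsert β (u ++ k :: w) v
  have hB1 : ∀ k, B (β k) = wordInsert β (u ++ k :: w) v := fun k => by simp [B]
  have hB2 : ∀ k, B.flip (β k) = wordInsert β u (w ++ k :: v) := fun k => by
    refine β.ext fun j => ?_
    rw [LinearMap.flip_apply, hB1, wordInsert_basis, wordInsert_basis]
    simp
  have h1 : wordInsert β u (w ++ a' :: c' :: v) - wordInsert β u (w ++ c' :: a' :: v) =
      B.flip ⁅β a', β c'⁆ := by
    refine β.ext fun k => ?_
    rw [LinearMap.sub_apply, wordInsert_basis, wordInsert_basis, LinearMap.flip_apply, hB1]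
    have := h (u ++ k :: w) v a' c' (by simp at hl ⊢; omega)
    simp only [List.append_assoc, List.cons_append] at this
    rw [this, add_sub_cancel_left]
  have h2 : wordInsert β (u ++ a :: c :: w) v - wordInsert β (u ++ c :: a :: w) v =
      B ⁅β a, β c⁆ := by
    refine β.ext fun k => ?_
    rw [LinearMap.sub_apply, wordInsert_basis, wordInsert_basis, ← LinearMap.flip_apply, hB2]
    have := h u (w ++ k :: v) a c (by simp at hl ⊢; omega)
    simp only [List.append_assoc, List.cons_append] at this ⊢
    rw [this, add_sub_cancel_left]
  have h3 := congr($h1 ⁅β a, β c⁆)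
  have h4 := congr($h2 ⁅β a', β c'⁆)
  rw [LinearMap.flip_apply, LinearMap.sub_apply] at h3
  rw [LinearMap.sub_apply] at h4
  rw [← sub_eq_zero]
  rw [← sub_eq_zero, ← h4] at h3
  rw [← h3]
  abel

/-- Two overlapping inverted pairs. -/
theorem wordMap_confluent_overlap {n : ℕ}
    (h : ∀ (u v : List I) (a c : I), (u ++ a :: c :: v).length < n →
      wordMap β (u ++ a :: c :: v) =
        wordMap β (u ++ c :: a :: v) + wordInsert β u v ⁅β a, β c⁆)
    (u v : List I) (a c d : I) (hl : (u ++ a :: c :: d :: v).length = n) :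
    wordInsert β u (a :: v) ⁅β c, β d⁆ + wordInsert β (u ++ [c]) v ⁅β a, β d⁆ +
        wordInsert β u (d :: v) ⁅β a, β c⁆ =
      wordInsert β (u ++ [d]) v ⁅β a, β c⁆ + wordInsert β u (c :: v) ⁅β a, β d⁆ +
        wordInsert β (u ++ [a]) v ⁅β c, β d⁆ := by
  -- Moving the letter `k` past an inserted vector costs a commutator; the words involved are one
  -- letter shorter, so `h` applies.
  have key : ∀ (k : I) (z : L), wordInsert β u (k :: v) z =
      wordInsert β (u ++ [k]) v z + wordInsert β u v ⁅z, β k⁆ := by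
    intro k z
    have : wordInsert β u (k :: v) = wordInsert β (u ++ [k]) v +
        wordInsert β u v ∘ₗ (LieModule.toEnd ℂ L L (-β k) : L →ₗ[ℂ] L) := by
      refine β.ext fun j => ?_
      rw [LinearMap.add_apply, wordInsert_basis, wordInsert_basis,
        h u v j k (by simp at hl ⊢; omega), ← lie_skew, map_neg]
      simp
    rw [this, LinearMap.add_apply, ← lie_skew z, map_neg]
    simp only [LinearMap.comp_apply, LinearMap.neg_apply,
      LieModule.toEnd_apply_apply, map_neg]
  rw [key a, key d, key c]
  -- After all letters are moved to the same side, the remaining double commutators cancel by the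
  -- Jacobi identity.
  have hJ : ⁅⁅β c, β d⁆, β a⁆ + ⁅⁅β a, β c⁆, β d⁆ = ⁅⁅β a, β d⁆, β c⁆ := by
    rw [lie_lie (β a) (β c), ← lie_skew, ← lie_skew (⁅β a, β d⁆)]
    abel
  rw [← hJ, map_add]
  abel

/-- This is the diamond lemma. The definition of `wordMap` gives the relation for one inverted pair;
any other pair overlaps it or is disjoint from it, and the two results then agree by rewriting
further, with induction first on the length and then on the number of inversions. -/
theorem wordMap_swap (n m : ℕ) : ∀ (u v : List I) (a c : I), c < a →
    (u ++ a :: c :: v).length = n → inversions (u ++ a :: c :: v) = m →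
    wordMap β (u ++ a :: c :: v) =
      wordMap β (u ++ c :: a :: v) + wordInsert β u v ⁅β a, β c⁆ := by
  induction n using Nat.strong_induction_on generalizing m with | _ n ihn
  induction m using Nat.strong_induction_on with | _ m ihm
  have hlow : ∀ (u v : List I) (a c : I), (u ++ a :: c :: v).length < n →
      wordMap β (u ++ a :: c :: v) =
        wordMap β (u ++ c :: a :: v) + wordInsert β u v ⁅β a, β c⁆ :=
    fun u v a c hl => wordMap_sub_of_lt β
      (fun u v a c hac hl' => ihn _ hl _ u v a c hac hl' rfl) u v a c rfl
  have hsame : ∀ (u v : List I) (a c : I), c < a → (u ++ a :: c :: v).length = n →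
      inversions (u ++ a :: c :: v) < m → wordMap β (u ++ a :: c :: v) =
        wordMap β (u ++ c :: a :: v) + wordInsert β u v ⁅β a, β c⁆ :=
    fun u v a c hac hl hm => ihm _ hm u v a c hac hl rfl
  -- the statement for one pair implies that for any other pair
  have aux : ∀ (u w v : List I) (a c a' c' : I), c < a → c' < a' →
      (u ++ a :: c :: v).length = n → inversions (u ++ a :: c :: v) = m →
      a :: c :: v = w ++ a' :: c' :: (v.drop w.length) →
      wordMap β (u ++ c :: a :: v) + wordInsert β u v ⁅β a, β c⁆ =
        wordMap β ((u ++ w) ++ c' :: a' :: (v.drop w.length)) +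
          wordInsert β (u ++ w) (v.drop w.length) ⁅β a', β c'⁆ := by
    intro u w v a c a' c' hca hca' hl hm hw
    -- The second pair starts zero, one or at least two letters to the right of the first: the same
    -- pair, an overlap, or disjoint pairs.
    rcases w with - | ⟨x, w⟩
    · simp only [List.length_nil, List.drop_zero, List.nil_append, List.cons.injEq] at hw
      obtain ⟨rfl, rfl, -⟩ := hw
      simp
    rcases w with - | ⟨y, w⟩
    · simp only [List.length_cons, List.length_nil, zero_add, List.cons_append, List.nil_append,
        List.cons.injEq] at hw
      obtain ⟨rfl, rfl, hv⟩ := hw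
      obtain ⟨d, v, rfl⟩ : ∃ d v', v = d :: v' := ⟨_, _, hv⟩
      simp only [List.drop_one, List.tail_cons, List.cons.injEq, and_true] at hv
      subst hv
      have hda : d < a := hca'.trans hca
      simp only [List.length_cons, List.length_nil, zero_add, List.drop_one, List.tail_cons,
        List.append_assoc, List.cons_append, List.nil_append]
      have i1 := inversions_swap u (d :: v) hca
      have i2 := inversions_swap (u ++ [a]) v hca'
      have i3 := inversions_swap (u ++ [c]) v hda
      have i4 := inversions_swap u (c :: v) hda
      simp only [List.append_assoc, List.cons_append, List.nil_append] at i1 i2 i3 i4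
      have e1 := hsame (u ++ [c]) v a d hda (by simp at hl ⊢; omega) (by simp; omega)
      have e2 := hsame u (a :: v) c d hca' (by simp at hl ⊢; omega) (by omega)
      have e3 := hsame u (c :: v) a d hda (by simp at hl ⊢; omega) (by omega)
      have e4 := hsame (u ++ [d]) v a c hca (by simp at hl ⊢; omega) (by simp; omega)
      simp only [List.append_assoc, List.cons_append, List.nil_append] at e1 e2 e3 e4
      have := wordMap_confluent_overlap β hlow u v a c d hl
      rw [e1, e2, e3, e4, add_assoc, add_assoc, ← add_assoc (wordInsert β u (a :: v) _), this]
      abel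
    · simp only [List.length_cons, List.cons_append, List.cons.injEq] at hw
      obtain ⟨rfl, rfl, hv⟩ := hw
      set v' := v.drop (w.length + 1 + 1) with hv'
      clear_value v'
      subst hv
      have i1 := inversions_swap u (w ++ a' :: c' :: v') hca
      have i2 := inversions_swap (u ++ a :: c :: w) v' hca'
      simp only [List.append_assoc, List.cons_append] at i1 i2
      have e1 := hsame (u ++ c :: a :: w) v' a' c' hca' (by simp at hl ⊢; omega) (by simp; omega)
      have e2 := hsame u (w ++ c' :: a' :: v') a c hca (by simp at hl ⊢; omega) (by omega)
      have := wordMap_confluent_disjoint β hlow u w v' a c a' c' hl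
      simp only [List.length_cons, ← hv']
      simp only [List.append_assoc, List.cons_append] at e1 e2 this ⊢
      rw [e1, e2, add_assoc, add_comm (wordInsert β (u ++ c :: a :: w) v' _), this]
      abel
  intro u v a c hca hl hm
  obtain ⟨u', a', c', v', hca', he, hw⟩ := exists_wordMap_eq β ⟨u, a, c, v, hca, rfl⟩
  rw [hw]
  -- Either the given pair or the chosen one is further left; `aux` is symmetric under exchanging
  -- their roles.
  rcases List.append_eq_append_iff.1 he with ⟨w, rfl, hw'⟩ | ⟨w, rfl, hw'⟩
  · have hd : v.drop w.length = v' := by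
      have := congr(List.drop (w.length + 2) $hw')
      simpa [List.drop_append, List.drop_eq_nil_of_le] using this
    have := aux u w v a c a' c' hca hca' hl hm (by rw [hd, hw'])
    rw [hd] at this
    exact this.symm
  · have hd : v'.drop w.length = v := by
      have := congr(List.drop (w.length + 2) $hw')
      simpa [List.drop_append, List.drop_eq_nil_of_le] using this
    have := aux u' w v' a' c' a c hca' hca (by rw [← he]; exact hl) (by rw [← he]; exact hm)
      (by rw [hd, hw'])
    rw [hd] at this
    exact this

theorem wordMap_comm (u v : List I) (a c : I) : wordMap β (u ++ a :: c :: v) =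
    wordMap β (u ++ c :: a :: v) + wordInsert β u v ⁅β a, β c⁆ :=
  wordMap_sub_of_lt β (fun u v a c hac hl => wordMap_swap β _ _ u v a c hac hl rfl) u v a c rfl

/-- The values of words differ from the products of their letters by terms of lower degree. -/
theorem wordMap_sub_prod_mem (n m : ℕ) : ∀ l : List I, l.length = n → inversions l = m →
    wordMap β l - ((l.map β).map (SymmetricAlgebra.ι ℂ L)).prod ∈
      fil (SymmetricAlgebra.ι ℂ L) n := by
  induction n using Nat.strong_induction_on generalizing m with | _ n ihn
  induction m using Nat.strong_induction_on with | _ m ihm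
  intro l hl hm
  by_cases h : ∃ (u : List I) (a c : I) (v : List I), c < a ∧ l = u ++ a :: c :: v
  · obtain ⟨u, a, c, v, hca, rfl, hw⟩ := exists_wordMap_eq β h
    have h1 := ihm _ (by rw [← hm]; exact inversions_swap u v hca) (u ++ c :: a :: v)
      (by simpa using hl) rfl
    have h2 : wordInsert β u v ⁅β a, β c⁆ ∈ fil (SymmetricAlgebra.ι ℂ L) n := by
      have : ∀ z, wordInsert β u v z ∈ fil (SymmetricAlgebra.ι ℂ L) n := by
        intro z
        induction z using basis_induction β with
        | zero => simp
        | add _ _ h h' => rw [map_add]; exact add_mem h h'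
        | smul t _ h => rw [map_smul]; exact Submodule.smul_mem _ t h
        | basis k =>
          rw [wordInsert_basis]
          have hlen : (u ++ k :: v).length + 1 = n := by simp at hl ⊢; omega
          have h3 := ihn (u ++ k :: v).length (by omega) _ (u ++ k :: v) rfl rfl
          have h4 := prod_mem_fil (SymmetricAlgebra.ι ℂ L) ((u ++ k :: v).map β)
          rw [List.length_map, hlen] at h4
          rw [← sub_add_cancel (wordMap β (u ++ k :: v))]
          exact add_mem (fil_mono _ (by omega) h3) h4
      exact this _
    have h5 : (((u ++ c :: a :: v).map β).map (SymmetricAlgebra.ι ℂ L)).prod =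
        (((u ++ a :: c :: v).map β).map (SymmetricAlgebra.ι ℂ L)).prod :=
      ((((List.Perm.swap _ _ _).append_left u).map _).map _).prod_eq
    rw [hw, ← h5, add_sub_right_comm]
    exact add_mem h1 h2
  · rw [wordMap_eq_prod β h, sub_self]
    exact zero_mem _

/-- Left multiplication of words by a letter. -/
noncomputable def wordCons (a : I) : (List I →₀ ℂ) →ₗ[ℂ] (List I →₀ ℂ) :=
  Finsupp.lmapDomain ℂ ℂ (List.cons a)

/-- Combinations of words that are mapped to zero after left multiplication by any word. -/
noncomputable def wordKer : Submodule ℂ (List I →₀ ℂ) :=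
  ⨅ p : List I, LinearMap.ker (Finsupp.linearCombination ℂ fun l => wordMap β (p ++ l))

theorem wordCons_mem_wordKer (a : I) : wordKer β ≤ (wordKer β).comap (wordCons a) := by
  intro x hx
  simp only [wordKer, Submodule.mem_iInf, LinearMap.mem_ker, Submodule.mem_comap] at hx ⊢
  intro p
  have := hx (p ++ [a])
  rw [wordCons, Finsupp.lmapDomain_apply, Finsupp.linearCombination_mapDomain]
  simpa [Function.comp_def] using this

/-- The action of `L` on words modulo `wordKer`, as a linear map. -/
noncomputable def wordActAux : L →ₗ[ℂ] Module.End ℂ ((List I →₀ ℂ) ⧸ wordKer β) :=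
  β.constr ℂ fun a => (wordKer β).mapQ _ (wordCons a) (wordCons_mem_wordKer β a)

theorem wordActAux_basis (a : I) (x : List I →₀ ℂ) :
    wordActAux β (β a) ((wordKer β).mkQ x) = (wordKer β).mkQ (wordCons a x) := by
  simp [wordActAux]

/-- Words modulo `wordKer` satisfy the commutation relation because `wordMap_comm` holds behind
every prefix. Hence left multiplication becomes a representation of `L`. -/
theorem wordActAux_lie (x y : L) : wordActAux β ⁅x, y⁆ =
    wordActAux β x * wordActAux β y - wordActAux β y * wordActAux β x := by
  induction x using basis_induction β with
  | zero => simp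
  | add _ _ h h' => simp only [add_lie, map_add, h, h', add_mul, mul_add]; abel
  | smul t _ h => simp only [smul_lie, map_smul, h, smul_mul_assoc, mul_smul_comm, smul_sub]
  | basis a =>
  induction y using basis_induction β with
  | zero => simp
  | add _ _ h h' => simp only [lie_add, map_add, h, h', add_mul, mul_add]; abel
  | smul t _ h => simp only [lie_smul, map_smul, h, smul_mul_assoc, mul_smul_comm, smul_sub]
  | basis c =>
  refine Submodule.linearMap_qext _ (Finsupp.lhom_ext fun l t => ?_)
  rw [LinearMap.comp_apply, LinearMap.comp_apply]
  have hz : ∀ z : L, wordActAux β z ((wordKer β).mkQ (Finsupp.single l t)) =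
      (wordKer β).mkQ (Finsupp.linearCombination ℂ
        (fun a => wordCons a (Finsupp.single l t)) (β.repr z)) := by
    intro z
    induction z using basis_induction β with
    | zero => simp
    | add _ _ h h' => simp only [map_add, LinearMap.add_apply, h, h']
    | smul r _ h => simp only [map_smul, LinearMap.smul_apply, h]
    | basis k => rw [wordActAux_basis]; simp
  rw [LinearMap.sub_apply, Module.End.mul_apply, Module.End.mul_apply, hz]
  simp only [wordActAux_basis]
  rw [← map_sub, ← sub_eq_zero, ← map_sub, Submodule.mkQ_apply, Submodule.Quotient.mk_eq_zero]
  simp only [wordKer, Submodule.mem_iInf, LinearMap.mem_ker]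
  intro p
  have h7 : ∀ (z : L), Finsupp.linearCombination ℂ (fun l => wordMap β (p ++ l))
      (Finsupp.linearCombination ℂ (fun a => wordCons a (Finsupp.single l t)) (β.repr z)) =
      t • wordInsert β p l z := by
    intro z
    induction z using basis_induction β with
    | zero => simp
    | add _ _ h h' => simp only [map_add, smul_add, h, h']
    | smul r _ h => rw [map_smul, map_smul, map_smul, h, map_smul, smul_comm]
    | basis k => simp [wordCons, wordInsert_basis]
  rw [map_sub, h7, map_sub]
  simp only [wordCons, Finsupp.lmapDomain_apply, Finsupp.mapDomain_single,
    Finsupp.linearCombination_single]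
  rw [wordMap_comm]
  simp [smul_add]

attribute [local instance] LieRing.ofAssociativeRing

/-- The action of `U(L)` on words modulo `wordKer`. -/
noncomputable def wordAct :
    UniversalEnvelopingAlgebra ℂ L →ₐ[ℂ] Module.End ℂ ((List I →₀ ℂ) ⧸ wordKer β) :=
  UniversalEnvelopingAlgebra.lift ℂ
    { wordActAux β with
      map_lie' := by
        intro x y
        exact wordActAux_lie β x y }

theorem wordAct_uι (x : L) : wordAct β (uι L x) = wordActAux β x :=
  UniversalEnvelopingAlgebra.lift_ι_apply ℂ _ x

theorem wordAct_prod (l : List I) : wordAct β ((l.map β).map (uι L)).prod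
    ((wordKer β).mkQ (Finsupp.single [] 1)) = (wordKer β).mkQ (Finsupp.single l 1) := by
  induction l with
  | nil => simp
  | cons a l ih =>
    simp only [List.map_cons, List.prod_cons, map_mul, Module.End.mul_apply, ih, wordAct_uι,
      wordActAux_basis]
    simp [wordCons]

/-- The linear map `U(L) → S(L)` attached to an ordered basis: it maps sorted words to the
corresponding monomials. -/
noncomputable def pbwMap : UniversalEnvelopingAlgebra ℂ L →ₗ[ℂ] SymmetricAlgebra ℂ L :=
  (wordKer β).liftQ (Finsupp.linearCombination ℂ (wordMap β)) (by
    refine (iInf_le _ []).trans ?_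
    simp) ∘ₗ
  LinearMap.applyₗ ((wordKer β).mkQ (Finsupp.single [] 1)) ∘ₗ (wordAct β).toLinearMap

theorem pbwMap_prod (l : List I) : pbwMap β ((l.map β).map (uι L)).prod = wordMap β l := by
  simp only [pbwMap, LinearMap.comp_apply, AlgHom.toLinearMap_apply, LinearMap.applyₗ_apply_apply,
    wordAct_prod]
  erw [Submodule.liftQ_apply]
  simp

/-- Nothing has to be rewritten in a sorted word. Distinct sorted words thus have distinct monomials
as images, which is the linear independence in the Poincaré–Birkhoff–Witt theorem. -/
theorem pbwMap_prod_of_pairwise {l : List I} (hl : l.Pairwise (· ≤ ·)) :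
    pbwMap β ((l.map β).map (uι L)).prod = ((l.map β).map (SymmetricAlgebra.ι ℂ L)).prod := by
  rw [pbwMap_prod, wordMap_eq_prod]
  rintro ⟨u, a, c, v, hca, rfl⟩
  rw [List.pairwise_append, List.pairwise_cons] at hl
  exact (hl.2.1.1 c (by simp)).not_gt hca

theorem pbwMap_prod_sub_mem (l : List I) : pbwMap β ((l.map β).map (uι L)).prod -
    ((l.map β).map (SymmetricAlgebra.ι ℂ L)).prod ∈ fil (SymmetricAlgebra.ι ℂ L) l.length := by
  rw [pbwMap_prod]
  exact wordMap_sub_prod_mem β _ _ l rfl rfl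

end PBW

end HarishChandra

namespace HarishChandra

/-! ### Symmetric multilinear maps -/

section SymmetricMultilinear

/-- Two words with the same letters become equal after sorting; the permutation is composed of the
two sorting permutations. -/
theorem exists_perm_of_sum_single_eq {n d : ℕ} {x y : Fin n → Fin d}
    (h : ∑ i, Finsupp.single (x i) 1 = ∑ i, Finsupp.single (y i) 1) :
    ∃ σ : Equiv.Perm (Fin n), y = x ∘ σ := by
  have hm : ∀ z : Fin n → Fin d,
      Finsupp.toMultiset (∑ i, Finsupp.single (z i) 1) = (List.ofFn z : Multiset (Fin d)) := by
    intro z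
    rw [map_sum, ← Fin.univ_val_map, ← Multiset.sum_map_singleton (Multiset.map z _),
      Multiset.map_map]
    simp only [Finsupp.toMultiset_single, one_smul]
    rfl
  have hp : (List.ofFn x).Perm (List.ofFn y) := by
    rw [← Multiset.coe_eq_coe, ← hm, ← hm, h]
  have hp' : (List.ofFn (x ∘ Tuple.sort x)).Perm (List.ofFn (y ∘ Tuple.sort y)) :=
    ((Equiv.Perm.ofFn_comp_perm _ x).trans hp).trans (Equiv.Perm.ofFn_comp_perm _ y).symm
  have he : x ∘ Tuple.sort x = y ∘ Tuple.sort y :=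
    List.ofFn_injective (hp'.eq_of_pairwise' (Tuple.monotone_sort x).sortedLE_ofFn.pairwise
      (Tuple.monotone_sort y).sortedLE_ofFn.pairwise)
  refine ⟨(Tuple.sort y).symm.trans (Tuple.sort x), ?_⟩
  ext i
  have := congrFun he ((Tuple.sort y).symm i)
  simpa using congr(($this).val).symm

variable {M : Type*} [AddCommGroup M] [Module ℂ M] [FiniteDimensional ℂ M]

/-- A symmetric multilinear map factors through the symmetric algebra. -/
theorem exists_symLift {E : Type*} [AddCommGroup E] [Module ℂ E] {n : ℕ}
    (φ : MultilinearMap ℂ (fun _ : Fin n => M) E)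
    (hφ : ∀ (σ : Equiv.Perm (Fin n)) (x : Fin n → M), φ (x ∘ σ) = φ x) :
    ∃ T : SymmetricAlgebra ℂ M →ₗ[ℂ] E, ∀ x : Fin n → M,
      T (List.ofFn fun i => SymmetricAlgebra.ι ℂ M (x i)).prod = φ x := by
  classical
  let β := Module.finBasis ℂ M
  -- On a monomial of degree `n`, `φ` is evaluated at any word with these exponents; symmetry makes
  -- the choice harmless. Other degrees are sent to zero.
  let g : (Fin (Module.finrank ℂ M) →₀ ℕ) → E := fun m =>
    if h : ∃ x : Fin n → Fin (Module.finrank ℂ M), ∑ i, Finsupp.single (x i) 1 = m then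
      φ (β ∘ h.choose) else 0
  let T := β.symmetricAlgebra.constr ℂ g
  refine ⟨T, fun x => ?_⟩
  suffices h : T.compMultilinearMap ((MultilinearMap.mkPiAlgebraFin ℂ n _).compLinearMap
      fun _ => SymmetricAlgebra.ι ℂ M) = φ from congr($h x)
  refine Module.Basis.ext_multilinear (fun _ => β) fun j => ?_
  have hj : (List.ofFn fun i => SymmetricAlgebra.ι ℂ M (β (j i))).prod =
      β.symmetricAlgebra (∑ i, Finsupp.single (j i) 1) := by
    rw [Module.Basis.symmetricAlgebra, Module.Basis.map_apply, MvPolynomial.coe_basisMonomials]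
    apply (SymmetricAlgebra.equivMvPolynomial β).injective
    simp [List.prod_ofFn, MvPolynomial.monomial_sum_one, MvPolynomial.X]
  change T (List.ofFn fun i => SymmetricAlgebra.ι ℂ M (β (j i))).prod = _
  have h : ∃ x : Fin n → Fin (Module.finrank ℂ M),
    ∑ i, Finsupp.single (x i) 1 = ∑ i, Finsupp.single (j i) 1 := ⟨j, rfl⟩
  obtain ⟨σ, hσ⟩ := exists_perm_of_sum_single_eq h.choose_spec
  rw [hj, Module.Basis.constr_basis]
  simp only [g]
  rw [dif_pos h]
  have : (fun i => β (j i)) = (β ∘ h.choose) ∘ σ := by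
    rw [Function.comp_assoc, ← hσ]; rfl
  rw [this, hφ]

end SymmetricMultilinear

/-- A Leibniz rule for products of lists. -/
theorem leibniz_prod_ofFn {M A : Type*} [AddCommGroup M] [Module ℂ M] [Ring A] [Algebra ℂ A]
    (f : M →ₗ[ℂ] A) (D : M →ₗ[ℂ] M) (d : A → A) (hd : ∀ a c, d (a * c) = a * d c + d a * c)
    (hf : ∀ x, d (f x) = f (D x)) {n : ℕ} (x : Fin n → M) :
    d (List.ofFn fun i => f (x i)).prod =
      ∑ i, (List.ofFn fun j => f (Function.update x i (D (x i)) j)).prod := by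
  induction n with
  | zero =>
    have : d 1 = d 1 + d 1 := by simpa using hd 1 1
    simpa using this
  | succ n ih =>
    rw [List.ofFn_succ, List.prod_cons, hd, ih, Fin.sum_univ_succ, add_comm, hf, Finset.mul_sum]
    congr 1
    · simp [List.ofFn_succ]
    · refine Finset.sum_congr rfl fun i _ => ?_
      rw [List.ofFn_succ, List.prod_cons, Function.update_of_ne (Fin.succ_ne_zero i).symm]
      congr 4
      ext j
      rw [Function.update_apply, Function.update_apply]
      simp only [Fin.succ_inj]

/-! ### Enveloping algebras -/

section EnvelopingLemmas

variable {L : Type*} [LieRing L] [LieAlgebra ℂ L]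

attribute [local instance] LieRing.ofAssociativeRing

theorem uι_lie (x y : L) : uι L ⁅x, y⁆ = uι L x * uι L y - uι L y * uι L x :=
  (UniversalEnvelopingAlgebra.ι ℂ : L →ₗ⁅ℂ⁆ UniversalEnvelopingAlgebra ℂ L).map_lie x y

theorem uι_mul_uι (x y : L) : uι L x * uι L y = uι L y * uι L x + uι L ⁅x, y⁆ := by
  rw [uι_lie]; abel

theorem uι_comm_mem (x y : L) : uι L x * uι L y - uι L y * uι L x ∈ piece (uι L) 1 := by
  rw [← uι_lie]; exact mem_piece_one _ _

theorem uι_perm {l l' : List L} (h : l.Perm l') :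
    (l.map (uι L)).prod - (l'.map (uι L)).prod ∈ fil (uι L) l.length :=
  prod_sub_prod_mem_fil_of_perm _ uι_comm_mem h

-- By the universal property, `U(L)` maps to the subalgebra generated by `L`, and composing with the
-- inclusion gives the identity.
variable (L) in
theorem adjoin_range_uι : Algebra.adjoin ℂ (Set.range (uι L)) = ⊤ := by
  let S := Algebra.adjoin ℂ (Set.range (uι L))
  let g : L →ₗ⁅ℂ⁆ S :=
    { toFun := fun x => ⟨uι L x, Algebra.subset_adjoin ⟨x, rfl⟩⟩
      map_add' := fun x y => Subtype.ext (map_add (uι L) x y)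
      map_smul' := fun t x => Subtype.ext (map_smul (uι L) t x)
      map_lie' := fun {x y} => Subtype.ext (uι_lie x y) }
  have h : S.val.comp (UniversalEnvelopingAlgebra.lift ℂ g) = AlgHom.id ℂ _ := by
    apply UniversalEnvelopingAlgebra.hom_ext
    ext x
    exact congr(S.val $(UniversalEnvelopingAlgebra.lift_ι_apply ℂ g x))
  rw [eq_top_iff]
  intro u _
  have := congr($h u)
  rw [AlgHom.id_apply] at this
  rw [← this]
  exact (UniversalEnvelopingAlgebra.lift ℂ g u).2

theorem u_induction {p : UniversalEnvelopingAlgebra ℂ L → Prop}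
    (one : p 1) (add : ∀ a c, p a → p c → p (a + c)) (smul : ∀ (t : ℂ) a, p a → p (t • a))
    (mul : ∀ x a, p a → p (uι L x * a)) (u : UniversalEnvelopingAlgebra ℂ L) : p u := by
  have zero : p 0 := by simpa using smul 0 1 one
  obtain ⟨n, hn⟩ := exists_mem_fil _ (adjoin_range_uι L) u
  refine fil_induction _ zero add (fun m _ a ha => ?_) hn
  refine piece_induction _ Submodule.span_univ zero add smul (fun l hl _ => ?_) ha
  clear ha hn hl
  induction l with
  | nil => simpa using one
  | cons x l ih =>
    rw [List.map_cons, List.prod_cons]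
    exact mul x _ (ih (by simp))

theorem mem_centerU_iff (z : UniversalEnvelopingAlgebra ℂ L) :
    z ∈ centerU L ↔ ∀ x, uι L x * z = z * uι L x := by
  rw [Subalgebra.mem_center_iff]
  refine ⟨fun h x => h _, fun h u => ?_⟩
  induction u using u_induction with
  | one => simp
  | add _ _ h h' => rw [add_mul, mul_add, h, h']
  | smul t _ h => rw [smul_mul_assoc, mul_smul_comm, h]
  | mul x a h' => rw [mul_assoc, h', ← mul_assoc, h, mul_assoc]

/-- Commutators with elements of `L` preserve the filtration. -/
theorem comm_mem_fil (x : L) {n : ℕ} {u : UniversalEnvelopingAlgebra ℂ L}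
    (hu : u ∈ fil (uι L) n) : uι L x * u - u * uι L x ∈ fil (uι L) n := by
  refine fil_induction _ (p := fun u => uι L x * u - u * uι L x ∈ fil (uι L) n) (by simp)
    (fun a c h h' => ?_) (fun m hm a ha => ?_) hu
  · convert add_mem h h' using 1
    rw [mul_add, add_mul]; abel
  · refine piece_induction _ Submodule.span_univ
      (p := fun u => uι L x * u - u * uι L x ∈ fil (uι L) n) (by simp) (fun a c h h' => ?_)
      (fun t a h => ?_) (fun l hl _ => ?_) ha
    · convert add_mem h h' using 1
      rw [mul_add, add_mul]; abel
    · rw [mul_smul_comm, smul_mul_assoc, ← smul_sub]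
      exact Submodule.smul_mem _ _ h
    -- The commutator with a word is the difference of two orderings of `x :: l`, so it loses one
    -- degree.
    · have := uι_perm (l := x :: l) (l' := l ++ [x]) (List.perm_append_singleton x l).symm
      simp only [List.map_cons, List.prod_cons, List.map_append, List.prod_append, List.map_nil,
        List.prod_nil, mul_one, List.length_cons, hl] at this
      exact fil_mono _ hm this

variable (L) in
/-- The average of the products of `n` elements of `L` in all orders. -/
noncomputable def symU (n : ℕ) :
    MultilinearMap ℂ (fun _ : Fin n => L) (UniversalEnvelopingAlgebra ℂ L) :=
  (n.factorial : ℂ)⁻¹ • ∑ σ : Equiv.Perm (Fin n),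
    ((MultilinearMap.mkPiAlgebraFin ℂ n (UniversalEnvelopingAlgebra ℂ L)).compLinearMap
      fun _ => uι L).domDomCongr σ

theorem symU_apply {n : ℕ} (x : Fin n → L) : symU L n x =
    (n.factorial : ℂ)⁻¹ • ∑ σ : Equiv.Perm (Fin n), (List.ofFn fun i => uι L (x (σ i))).prod := by
  simp [symU]

theorem symU_comp_perm {n : ℕ} (σ : Equiv.Perm (Fin n)) (x : Fin n → L) :
    symU L n (x ∘ σ) = symU L n x := by
  rw [symU_apply, symU_apply]
  congr 1
  exact Fintype.sum_equiv (Equiv.mulLeft σ) _ _ fun τ => by simp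

/-- Every reordering of a product changes it only in lower degree, hence so does the average over
all reorderings. -/
theorem symU_sub_prod_mem {n : ℕ} (x : Fin n → L) :
    symU L n x - (List.ofFn fun i => uι L (x i)).prod ∈ fil (uι L) n := by
  have h : symU L n x - (List.ofFn fun i => uι L (x i)).prod =
      (n.factorial : ℂ)⁻¹ • ∑ σ : Equiv.Perm (Fin n), ((List.ofFn fun i => uι L (x (σ i))).prod -
        (List.ofFn fun i => uι L (x i)).prod) := by
    rw [symU_apply, Finset.sum_sub_distrib, smul_sub, Finset.sum_const, Finset.card_univ,
      Fintype.card_perm, Fintype.card_fin, ← Nat.cast_smul_eq_nsmul ℂ, smul_smul,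
      inv_mul_cancel₀ (by exact_mod_cast n.factorial_ne_zero), one_smul]
  rw [h]
  refine Submodule.smul_mem _ _ (Submodule.sum_mem _ fun σ _ => ?_)
  have := uι_perm (Equiv.Perm.ofFn_comp_perm σ x)
  simpa [List.map_ofFn, Function.comp_def] using this

theorem piece_induction_ofFn {M A : Type*} [AddCommGroup M] [Module ℂ M] [Ring A] [Algebra ℂ A]
    (f : M →ₗ[ℂ] A) {n : ℕ} {p : A → Prop}
    (h0 : p 0) (hadd : ∀ a c, p a → p c → p (a + c)) (hsmul : ∀ (t : ℂ) a, p a → p (t • a))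
    (hp : ∀ x : Fin n → M, p (List.ofFn fun i => f (x i)).prod)
    {a : A} (ha : a ∈ piece f n) : p a := by
  refine piece_induction f Submodule.span_univ h0 hadd hsmul (fun l hl _ => ?_) ha
  subst hl
  have := hp l.get
  rwa [← Function.comp_def, ← List.map_ofFn, List.ofFn_get] at this

theorem mem_symInvariants {s : SymmetricAlgebra ℂ L} :
    s ∈ symInvariants L ↔ ∀ y, symDer (LieModule.toEnd ℂ L L y) s = 0 := by
  simp only [symInvariants, Submodule.mem_iInf, LinearMap.mem_ker]
  rfl

theorem pbwMap_mem_fil {I : Type*} [LinearOrder I] (β : Module.Basis I ℂ L) {n : ℕ}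
    {u : UniversalEnvelopingAlgebra ℂ L} (hu : u ∈ fil (uι L) n) :
    pbwMap β u ∈ fil (SymmetricAlgebra.ι ℂ L) n := by
  refine fil_induction _ (p := fun u => pbwMap β u ∈ fil (SymmetricAlgebra.ι ℂ L) n) (by simp)
    (fun _ _ h h' => by rw [map_add]; exact add_mem h h') (fun m hm a ha => ?_) hu
  refine piece_induction _ β.span_eq (p := fun u => pbwMap β u ∈ fil (SymmetricAlgebra.ι ℂ L) n)
    (by simp) (fun _ _ h h' => by rw [map_add]; exact add_mem h h')
    (fun t _ h => by rw [map_smul]; exact Submodule.smul_mem _ _ h) (fun l hl hls => ?_) ha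
  obtain ⟨l, rfl⟩ : ∃ l', l = List.map β l' := by
    have : l ∈ Set.range (List.map β) := by rw [Set.range_list_map]; exact hls
    exact this.imp fun _ h => h.symm
  rw [← sub_add_cancel (pbwMap β _)]
  rw [List.length_map] at hl
  refine add_mem (fil_mono _ (by omega) (pbwMap_prod_sub_mem β l)) ?_
  exact fil_mono _ (by simp; omega) (prod_mem_fil _ _)

variable [FiniteDimensional ℂ L]

variable (L) in
/-- The symmetrization map on `Sⁿ(L)`. -/
noncomputable def symmetrize (n : ℕ) :
    SymmetricAlgebra ℂ L →ₗ[ℂ] UniversalEnvelopingAlgebra ℂ L :=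
  (exists_symLift (symU L n) symU_comp_perm).choose

theorem symmetrize_prod {n : ℕ} (x : Fin n → L) :
    symmetrize L n (List.ofFn fun i => SymmetricAlgebra.ι ℂ L (x i)).prod = symU L n x :=
  (exists_symLift (symU L n) symU_comp_perm).choose_spec x

theorem symmetrize_mem_fil {n : ℕ} {s : SymmetricAlgebra ℂ L}
    (hs : s ∈ piece (SymmetricAlgebra.ι ℂ L) n) : symmetrize L n s ∈ fil (uι L) (n + 1) := by
  refine piece_induction_ofFn _ (p := fun s => symmetrize L n s ∈ fil (uι L) (n + 1)) (by simp)
    (fun _ _ h h' => by rw [map_add]; exact add_mem h h')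
    (fun t _ h => by rw [map_smul]; exact Submodule.smul_mem _ _ h) (fun x => ?_) hs
  rw [symmetrize_prod, ← sub_add_cancel (symU L n x)]
  refine add_mem (fil_mono _ n.le_succ (symU_sub_prod_mem x)) ?_
  exact piece_le_fil _ _ (monomial (uι L) x).2

/-- Symmetrization is equivariant for the adjoint action. -/
theorem symmetrize_symDer {n : ℕ} (y : L) {s : SymmetricAlgebra ℂ L}
    (hs : s ∈ piece (SymmetricAlgebra.ι ℂ L) n) :
    symmetrize L n (symDer (LieModule.toEnd ℂ L L y) s) =
      uι L y * symmetrize L n s - symmetrize L n s * uι L y := by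
  refine piece_induction_ofFn _ (p := fun s => symmetrize L n (symDer (LieModule.toEnd ℂ L L y) s) =
    uι L y * symmetrize L n s - symmetrize L n s * uι L y) (by simp)
    (fun _ _ h h' => by simp only [map_add, h, h', mul_add, add_mul]; abel)
    (fun t _ h => by
      rw [Derivation.map_smul, map_smul, map_smul, h, mul_smul_comm, smul_mul_assoc, smul_sub])
    (fun x => ?_) hs
  rw [leibniz_prod_ofFn (SymmetricAlgebra.ι ℂ L) (LieModule.toEnd ℂ L L y) (symDer _)
    (fun a c => by rw [Derivation.leibniz, smul_eq_mul, smul_eq_mul, mul_comm c])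
    (symDer_ι _), map_sum]
  simp only [symmetrize_prod, symU_apply]
  rw [← Finset.smul_sum, mul_smul_comm, smul_mul_assoc, ← smul_sub, Finset.mul_sum,
    Finset.sum_mul, ← Finset.sum_sub_distrib, Finset.sum_comm]
  congr 1
  refine Finset.sum_congr rfl fun σ _ => ?_
  rw [leibniz_prod_ofFn (uι L) (LieModule.toEnd ℂ L L y) (fun a => uι L y * a - a * uι L y)
    (fun a c => by noncomm_ring) (fun z => (uι_lie y z).symm) (fun i => x (σ i))]
  -- Both sides bracket one factor at a time; `σ` matches a position in the reordered product with
  -- the index of its factor.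
  refine (Fintype.sum_equiv σ _ _ fun i => ?_).symm
  congr 2
  ext j
  congr 1
  rw [Function.update_apply, Function.update_apply]
  simp

/-- Up to lower degree `pbwMap` is a left inverse of symmetrization. This is how the
Poincaré–Birkhoff–Witt theorem gives injectivity of the symbol map. -/
theorem pbwMap_symmetrize_sub_mem {I : Type*} [LinearOrder I] (β : Module.Basis I ℂ L) {n : ℕ}
    {s : SymmetricAlgebra ℂ L} (hs : s ∈ piece (SymmetricAlgebra.ι ℂ L) n) :
    pbwMap β (symmetrize L n s) - s ∈ fil (SymmetricAlgebra.ι ℂ L) n := by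
  refine piece_induction _ β.span_eq
    (p := fun s => pbwMap β (symmetrize L n s) - s ∈ fil (SymmetricAlgebra.ι ℂ L) n)
    (by simp) (fun a c h h' => ?_) (fun t a h => ?_) (fun l hl hls => ?_) hs
  · rw [map_add, map_add, add_sub_add_comm]; exact add_mem h h'
  · rw [map_smul, map_smul, ← smul_sub]; exact Submodule.smul_mem _ _ h
  obtain ⟨l, rfl⟩ : ∃ l', l = List.map β l' := by
    have : l ∈ Set.range (List.map β) := by rw [Set.range_list_map]; exact hls
    exact this.imp fun _ h => h.symm
  rw [List.length_map] at hl
  subst hl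
  have e : ∀ {A : Type _} [Ring A] [Algebra ℂ A] (f : L →ₗ[ℂ] A), ((l.map β).map f).prod =
      (List.ofFn fun i => f (β (l.get i))).prod := by
    intro A _ _ f
    conv_lhs => rw [← List.ofFn_get l]
    rw [List.map_ofFn, List.map_ofFn]; rfl
  have h1 := pbwMap_mem_fil β (symU_sub_prod_mem fun i => β (l.get i))
  have h2 := pbwMap_prod_sub_mem β l
  rw [e, e] at h2
  rw [map_sub] at h1
  rw [e, symmetrize_prod]
  simpa using add_mem h1 h2

/-- Symmetrization is injective modulo lower degree. -/
theorem eq_zero_of_symmetrize_mem_fil {n : ℕ} {s : SymmetricAlgebra ℂ L}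
    (hs : s ∈ piece (SymmetricAlgebra.ι ℂ L) n) (h : symmetrize L n s ∈ fil (uι L) n) : s = 0 := by
  refine eq_zero_of_mem_piece_of_mem_fil hs ?_
  let β := Module.finBasis ℂ L
  have h1 := pbwMap_symmetrize_sub_mem β hs
  have h2 := pbwMap_mem_fil β h
  simpa using sub_mem h2 h1

/-- Every element of degree at most `n` has a symbol in `Sⁿ(L)`. -/
theorem exists_symbol {n : ℕ} {u : UniversalEnvelopingAlgebra ℂ L}
    (hu : u ∈ fil (uι L) (n + 1)) :
    ∃ s ∈ piece (SymmetricAlgebra.ι ℂ L) n, u - symmetrize L n s ∈ fil (uι L) n := by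
  rw [fil_succ] at hu
  obtain ⟨y, hy, z, hz, rfl⟩ := Submodule.mem_sup.1 hu
  suffices h : ∃ s ∈ piece (SymmetricAlgebra.ι ℂ L) n, z - symmetrize L n s ∈ fil (uι L) n by
    obtain ⟨s, hs, h⟩ := h
    exact ⟨s, hs, by rw [add_sub_assoc]; exact add_mem hy h⟩
  refine piece_induction_ofFn _ (p := fun z => ∃ s ∈ piece (SymmetricAlgebra.ι ℂ L) n,
    z - symmetrize L n s ∈ fil (uι L) n) ⟨0, by simp⟩ ?_ ?_ (fun x => ?_) hz
  · rintro a c ⟨s, hs, h⟩ ⟨s', hs', h'⟩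
    exact ⟨s + s', add_mem hs hs', by rw [map_add, add_sub_add_comm]; exact add_mem h h'⟩
  · rintro t a ⟨s, hs, h⟩
    exact ⟨t • s, Submodule.smul_mem _ _ hs, by
      rw [map_smul, ← smul_sub]; exact Submodule.smul_mem _ _ h⟩
  · refine ⟨_, (monomial (SymmetricAlgebra.ι ℂ L) x).2, ?_⟩
    rw [monomial, symmetrize_prod]
    exact sub_mem_comm_iff.1 (symU_sub_prod_mem x)

theorem symmetrize_mem_center {n : ℕ} {s : SymmetricAlgebra ℂ L}
    (hs : s ∈ piece (SymmetricAlgebra.ι ℂ L) n) (hi : s ∈ symInvariants L) :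
    symmetrize L n s ∈ centerU L := by
  rw [mem_centerU_iff]
  intro y
  have h := mem_symInvariants.1 hi y
  have := symmetrize_symDer y hs
  rw [h, map_zero] at this
  exact (sub_eq_zero.1 this.symm)

/-- Since `z` is central, the commutator of `y` with the symmetrized symbol has lower degree. By
equivariance it is the symmetrization of the derivative of `s` along `y`, which therefore vanishes.
-/
theorem symbol_mem_symInvariants {n : ℕ} {s : SymmetricAlgebra ℂ L}
    (hs : s ∈ piece (SymmetricAlgebra.ι ℂ L) n) {z : UniversalEnvelopingAlgebra ℂ L}
    (hz : z ∈ centerU L) (h : z - symmetrize L n s ∈ fil (uι L) n) : s ∈ symInvariants L := by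
  rw [mem_symInvariants]
  intro y
  refine eq_zero_of_symmetrize_mem_fil (symDer_mem_piece _ n hs) ?_
  rw [symmetrize_symDer y hs]
  have h1 := comm_mem_fil y h
  rw [mul_sub, sub_mul, (mem_centerU_iff z).1 hz y, sub_sub_sub_cancel_left] at h1
  exact sub_mem_comm_iff.1 h1

variable (L) in
/-- The identification `Sⁿ(L) = grₙ U(L)`. -/
noncomputable def symbolEquiv (n : ℕ) :
    piece (SymmetricAlgebra.ι ℂ L) n ≃ₗ[ℂ] Gr (fil (uι L)) n :=
  LinearEquiv.ofBijective (Submodule.mkQ _ ∘ₗ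
    (symmetrize L n).restrict fun _ hs => symmetrize_mem_fil hs) (by
    constructor
    · rw [injective_iff_map_eq_zero]
      intro s hs
      have h := (Submodule.Quotient.mk_eq_zero _).1 hs
      exact Subtype.ext (eq_zero_of_symmetrize_mem_fil s.2 h)
    · intro a
      obtain ⟨⟨u, hu⟩, rfl⟩ := Submodule.mkQ_surjective _ a
      obtain ⟨s, hs, h⟩ := exists_symbol hu
      refine ⟨⟨s, hs⟩, (Submodule.Quotient.eq _).2 ?_⟩
      have h' := sub_mem_comm_iff.1 h
      exact h')

theorem symbolEquiv_apply {n : ℕ} (s : piece (SymmetricAlgebra.ι ℂ L) n) :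
    symbolEquiv L n s = Submodule.mkQ ((fil (uι L) n).submoduleOf (fil (uι L) (n + 1)))
      ⟨symmetrize L n s, symmetrize_mem_fil s.2⟩ := rfl

theorem symbolEquiv_monomial {n : ℕ} (x : Fin n → L) :
    symbolEquiv L n (monomial (SymmetricAlgebra.ι ℂ L) x) =
      toGr (uι L) n (monomial (uι L) x) := by
  rw [symbolEquiv_apply]
  refine (Submodule.Quotient.eq _).2 ?_
  have h := symU_sub_prod_mem x
  rw [← symmetrize_prod] at h
  exact h

theorem mkQ_eq_symbolEquiv_iff {n : ℕ} (u : fil (uι L) (n + 1))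
    (s : piece (SymmetricAlgebra.ι ℂ L) n) :
    Submodule.mkQ ((fil (uι L) n).submoduleOf (fil (uι L) (n + 1))) u = symbolEquiv L n s ↔
      (u : UniversalEnvelopingAlgebra ℂ L) - symmetrize L n s ∈ fil (uι L) n := by
  rw [symbolEquiv_apply]
  exact Submodule.Quotient.eq _

/-- Symbols of central elements are invariant; conversely, symmetrization lifts an invariant to an
element that is central itself, not only up to lower degree. -/
theorem range_grIncl_centerU (n : ℕ) :
    LinearMap.range (grIncl (Subalgebra.toSubmodule (centerU L)) (fil (uι L)) n) =
      ((symInvariants L).submoduleOf (piece (SymmetricAlgebra.ι ℂ L) n)).map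
        (symbolEquiv L n).toLinearMap := by
  ext a
  constructor
  · rintro ⟨z, rfl⟩
    obtain ⟨⟨z, hz⟩, rfl⟩ := Submodule.mkQ_surjective _ z
    obtain ⟨s, hs, h⟩ := exists_symbol hz.2
    refine ⟨⟨s, hs⟩, symbol_mem_symInvariants hs hz.1 h, ?_⟩
    exact ((mkQ_eq_symbolEquiv_iff ⟨z, hz.2⟩ ⟨s, hs⟩).2 h).symm
  · rintro ⟨s, hs, rfl⟩
    refine ⟨Submodule.mkQ _ ⟨symmetrize L n s, symmetrize_mem_center s.2 hs,
      symmetrize_mem_fil s.2⟩, ?_⟩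
    rfl

end EnvelopingLemmas

end HarishChandra

namespace HarishChandra

/-! ### Triangular decompositions of enveloping algebras -/

section SortedWords

variable {L : Type*} [LieRing L] [LieAlgebra ℂ L] {I : Type*} (β : Module.Basis I ℂ L)

theorem exists_eq_map_of_mem_range {l : List L} (hl : ∀ x ∈ l, x ∈ Set.range β) :
    ∃ l', l = List.map β l' := by
  have : l ∈ Set.range (List.map β) := by rw [Set.range_list_map]; exact hl
  exact this.imp fun _ h => h.symm

theorem symmetricAlgebra_basis_eq_prod [DecidableEq I] (l : List I) :
    β.symmetricAlgebra (Multiset.toFinsupp (l : Multiset I)) =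
      ((l.map β).map (SymmetricAlgebra.ι ℂ L)).prod := by
  have h : MvPolynomial.monomial (Multiset.toFinsupp (l : Multiset I)) (1 : ℂ) =
      (l.map MvPolynomial.X).prod := by
    induction l with
    | nil => simp
    | cons a l ih =>
      rw [← Multiset.cons_coe, ← Multiset.singleton_add, map_add, ← one_mul (1 : ℂ),
        ← MvPolynomial.monomial_mul, ih, List.map_cons, List.prod_cons,
        Multiset.toFinsupp_singleton]
      rfl
  rw [Module.Basis.symmetricAlgebra, Module.Basis.map_apply, MvPolynomial.coe_basisMonomials]
  apply (SymmetricAlgebra.equivMvPolynomial β).injective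
  simp only [h, map_list_prod, List.map_map]
  simp [Function.comp_def]

variable [LinearOrder I]

theorem fil_le_span_sorted (n : ℕ) : fil (uι L) n ≤ Submodule.span ℂ
    {u | ∃ l : List I, l.Pairwise (· ≤ ·) ∧ ((l.map β).map (uι L)).prod = u} := by
  induction n with
  | zero => simp [fil_zero]
  | succ n ih =>
    rw [fil_succ]
    refine sup_le ih fun a ha => ?_
    refine piece_induction _ β.span_eq (zero_mem _) (fun _ _ h h' => add_mem h h')
      (fun t _ h => Submodule.smul_mem _ t h) (fun l hl hls => ?_) ha
    obtain ⟨l, rfl⟩ := exists_eq_map_of_mem_range β hls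
    have hp : (l.map β).Perm ((l.insertionSort (· ≤ ·)).map β) :=
      (List.perm_insertionSort (· ≤ ·) l).symm.map _
    have h1 := uι_perm hp
    rw [hl] at h1
    rw [← sub_add_cancel ((l.map β).map (uι L)).prod]
    exact add_mem (ih h1) (Submodule.subset_span
      ⟨_, List.pairwise_insertionSort (· ≤ ·) l, rfl⟩)

theorem span_sorted_eq_top : Submodule.span ℂ
    {u | ∃ l : List I, l.Pairwise (· ≤ ·) ∧ ((l.map β).map (uι L)).prod = u} = ⊤ := by
  rw [eq_top_iff]
  intro u _
  obtain ⟨n, hn⟩ := exists_mem_fil _ (adjoin_range_uι L) u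
  exact fil_le_span_sorted β n hn

end SortedWords

/-! ### Values of the structure maps on generators. -/

section EnvelopingMaps

variable {L : Type*} [LieRing L] [LieAlgebra ℂ L]

attribute [local instance] LieRing.ofAssociativeRing

theorem uIncl_uι (K : LieSubalgebra ℂ L) (x : K) : uIncl K (uι K x) = uι L x :=
  UniversalEnvelopingAlgebra.lift_ι_apply ℂ _ x

theorem counit_uι (x : L) : counit L (uι L x) = 0 :=
  UniversalEnvelopingAlgebra.lift_ι_apply ℂ _ x

theorem uToSym_uι [IsLieAbelian L] (x : L) : uToSym L (uι L x) = SymmetricAlgebra.ι ℂ L x :=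
  UniversalEnvelopingAlgebra.lift_ι_apply ℂ _ x

theorem uAct_uι {V : Type*} [AddCommGroup V] [Module ℂ V] [LieRingModule L V] [LieModule ℂ L V]
    (x : L) (v : V) : uAct V (uι L x) v = ⁅x, v⁆ :=
  congr($(UniversalEnvelopingAlgebra.lift_ι_apply ℂ (LieModule.toEnd ℂ L V) x) v)

theorem uIncl_prod (K : LieSubalgebra ℂ L) (l : List K) :
    uIncl K (l.map (uι K)).prod = ((l.map K.subtype).map (uι L)).prod := by
  rw [map_list_prod, List.map_map, List.map_map]
  congr 1
  exact List.map_congr_left fun x _ => uIncl_uι K x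

end EnvelopingMaps

/-! ### Factorization of an enveloping algebra along three complementary subalgebras. -/

section Triangular

variable {L : Type*} [LieRing L] [LieAlgebra ℂ L]

/-- The multiplication map `U(A) ⊗ U(B) ⊗ U(C) → U(L)`. -/
noncomputable def tripleMul (A B C : LieSubalgebra ℂ L) :
    (UniversalEnvelopingAlgebra ℂ A ⊗[ℂ] UniversalEnvelopingAlgebra ℂ B) ⊗[ℂ]
      UniversalEnvelopingAlgebra ℂ C →ₗ[ℂ] UniversalEnvelopingAlgebra ℂ L :=
  LinearMap.mul' ℂ _ ∘ₗ TensorProduct.map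
    (LinearMap.mul' ℂ _ ∘ₗ TensorProduct.map (uIncl A).toLinearMap
      (uIncl B).toLinearMap)
    (uIncl C).toLinearMap

variable (A B C : LieSubalgebra ℂ L)

theorem tripleMul_tmul (a : UniversalEnvelopingAlgebra ℂ A) (c : UniversalEnvelopingAlgebra ℂ B)
    (d : UniversalEnvelopingAlgebra ℂ C) :
    tripleMul A B C ((a ⊗ₜ c) ⊗ₜ d) = uIncl A a * uIncl B c * uIncl C d := by
  simp [tripleMul]

/-- A word in elements of three subspaces can be rearranged so that the letters from the first
one come first and those from the third one last. -/
theorem exists_perm_triple {l : List L} (hl : ∀ x ∈ l, x ∈ A ∨ x ∈ B ∨ x ∈ C) :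
    ∃ (lA : List A) (lB : List B) (lC : List C), l.Perm
      (lA.map A.subtype ++ (lB.map B.subtype ++ lC.map C.subtype)) := by
  induction l with
  | nil => exact ⟨[], [], [], by simp⟩
  | cons x l ih =>
    obtain ⟨lA, lB, lC, h⟩ := ih fun y hy => hl y (by simp [hy])
    rcases hl x (by simp) with hx | hx | hx
    · exact ⟨⟨x, hx⟩ :: lA, lB, lC, by simpa using h⟩
    · refine ⟨lA, ⟨x, hx⟩ :: lB, lC, (h.cons x).trans ?_⟩
      simpa using (List.perm_middle (a := x)).symm
    · refine ⟨lA, lB, ⟨x, hx⟩ :: lC, (h.cons x).trans ?_⟩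
      simpa using (List.perm_middle (a := x)
        (l₁ := lA.map A.subtype ++ lB.map B.subtype) (l₂ := lC.map C.subtype)).symm

theorem prod_triple_eq (lA : List A) (lB : List B) (lC : List C) :
    ((lA.map A.subtype ++ (lB.map B.subtype ++ lC.map C.subtype)).map (uι L)).prod =
      uIncl A (lA.map (uι A)).prod * uIncl B (lB.map (uι B)).prod *
        uIncl C (lC.map (uι C)).prod := by
  rw [uIncl_prod, uIncl_prod, uIncl_prod, List.map_append, List.map_append, List.prod_append,
    List.prod_append, mul_assoc]

theorem span_triple_eq_top (h : A.toSubmodule ⊔ B.toSubmodule ⊔ C.toSubmodule = ⊤) :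
    Submodule.span ℂ {x | x ∈ A ∨ x ∈ B ∨ x ∈ C} = ⊤ := by
  rw [eq_top_iff, ← h]
  refine sup_le (sup_le ?_ ?_) ?_ <;> intro x hx <;> apply Submodule.subset_span
  · exact Or.inl hx
  · exact Or.inr (Or.inl hx)
  · exact Or.inr (Or.inr hx)

/-- Letters can be brought into the order `A`, `B`, `C` at the cost of terms of lower degree, which
are covered by induction. -/
theorem tripleMul_surjective (h : A.toSubmodule ⊔ B.toSubmodule ⊔ C.toSubmodule = ⊤) :
    Function.Surjective (tripleMul A B C) := by
  have key : ∀ n, fil (uι L) n ≤ LinearMap.range (tripleMul A B C) := by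
    intro n
    induction n with
    | zero => simp [fil_zero]
    | succ n ih =>
      rw [fil_succ]
      refine sup_le ih fun a ha => ?_
      refine piece_induction _ (span_triple_eq_top A B C h) (zero_mem _)
        (fun _ _ h h' => add_mem h h') (fun t _ h => Submodule.smul_mem _ t h)
        (fun l hl hls => ?_) ha
      obtain ⟨lA, lB, lC, hp⟩ := exists_perm_triple A B C hls
      have h1 := uι_perm hp
      rw [hl] at h1
      rw [← sub_add_cancel (l.map (uι L)).prod]
      exact add_mem (ih h1)
        ⟨((lA.map (uι A)).prod ⊗ₜ (lB.map (uι B)).prod) ⊗ₜ (lC.map (uι C)).prod, by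
          rw [tripleMul_tmul, prod_triple_eq]⟩
  intro u
  obtain ⟨n, hn⟩ := exists_mem_fil _ (adjoin_range_uι L) u
  exact key n hn

/-- Sorted words in an ordered set. -/
abbrev SortedWord (I : Type*) [LinearOrder I] := {l : List I // l.Pairwise (· ≤ ·)}

/-- In the lexicographic sum order, juxtaposed sorted words of `A`, `B` and `C` form a sorted word
of `L`. So `pbwMap` sends the products of sorted words, which span the tensor product, to pairwise
distinct monomials. -/
theorem tripleMul_injective {p q r : ℕ} (α : Module.Basis (Fin p) ℂ A)
    (β : Module.Basis (Fin q) ℂ B) (γ : Module.Basis (Fin r) ℂ C)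
    (δ : Module.Basis (Fin p ⊕ₗ (Fin q ⊕ₗ Fin r)) ℂ L)
    (hα : ∀ i, δ (toLex (Sum.inl i)) = α i)
    (hβ : ∀ i, δ (toLex (Sum.inr (toLex (Sum.inl i)))) = β i)
    (hγ : ∀ i, δ (toLex (Sum.inr (toLex (Sum.inr i)))) = γ i) :
    Function.Injective (tripleMul A B C) := by
  classical
  let X := (SortedWord (Fin p) × SortedWord (Fin q)) × SortedWord (Fin r)
  let wA : SortedWord (Fin p) → UniversalEnvelopingAlgebra ℂ A := fun l =>
    ((l.1.map α).map (uι A)).prod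
  let wB : SortedWord (Fin q) → UniversalEnvelopingAlgebra ℂ B := fun l =>
    ((l.1.map β).map (uι B)).prod
  let wC : SortedWord (Fin r) → UniversalEnvelopingAlgebra ℂ C := fun l =>
    ((l.1.map γ).map (uι C)).prod
  have hA : Submodule.span ℂ (Set.range wA) = ⊤ := by
    rw [← span_sorted_eq_top α]; congr 1; ext u; simp [wA]
  have hB : Submodule.span ℂ (Set.range wB) = ⊤ := by
    rw [← span_sorted_eq_top β]; congr 1; ext u; simp [wB]
  have hC : Submodule.span ℂ (Set.range wC) = ⊤ := by
    rw [← span_sorted_eq_top γ]; congr 1; ext u; simp [wC]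
  let w : X → (UniversalEnvelopingAlgebra ℂ A ⊗[ℂ] UniversalEnvelopingAlgebra ℂ B) ⊗[ℂ]
      UniversalEnvelopingAlgebra ℂ C := fun x => (wA x.1.1 ⊗ₜ wB x.1.2) ⊗ₜ wC x.2
  have hw : Submodule.span ℂ (Set.range w) = ⊤ := by
    have h1 : Submodule.span ℂ (Set.image2 (· ⊗ₜ[ℂ] ·) (Set.range wA) (Set.range wB)) = ⊤ := by
      have := TensorProduct.map₂_mk_top_top_eq_top ℂ (UniversalEnvelopingAlgebra ℂ A)
        (UniversalEnvelopingAlgebra ℂ B)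
      rw [← hA, ← hB, Submodule.map₂_span_span] at this
      exact this
    have := TensorProduct.map₂_mk_top_top_eq_top ℂ
      (UniversalEnvelopingAlgebra ℂ A ⊗[ℂ] UniversalEnvelopingAlgebra ℂ B)
        (UniversalEnvelopingAlgebra ℂ C)
    rw [← hC, ← h1, Submodule.map₂_span_span] at this
    rw [← this]
    congr 1
    ext u
    simp [w, X]
  let emb : X → List (Fin p ⊕ₗ (Fin q ⊕ₗ Fin r)) := fun x =>
    x.1.1.1.map (fun i => toLex (Sum.inl i)) ++
      (x.1.2.1.map (fun i => toLex (Sum.inr (toLex (Sum.inl i)))) ++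
        x.2.1.map (fun i => toLex (Sum.inr (toLex (Sum.inr i)))))
  have hemb : ∀ x, (emb x).Pairwise (· ≤ ·) := by
    rintro ⟨⟨⟨lA, h1⟩, ⟨lB, h2⟩⟩, ⟨lC, h3⟩⟩
    simp only [emb, List.pairwise_append, List.pairwise_map, List.mem_map, List.mem_append,
      Sum.Lex.inl_le_inl_iff, Sum.Lex.inr_le_inr_iff]
    refine ⟨h1, ⟨h2, h3, ?_⟩, ?_⟩
    · rintro _ ⟨i, -, rfl⟩ _ ⟨j, -, rfl⟩
      exact Sum.Lex.inr_le_inr_iff.2 (Sum.Lex.inl_lt_inr _ _).le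
    · rintro _ ⟨i, -, rfl⟩ _ (⟨j, -, rfl⟩ | ⟨j, -, rfl⟩) <;> exact (Sum.Lex.inl_lt_inr _ _).le
  have hval : ∀ x, pbwMap δ (tripleMul A B C (w x)) =
      δ.symmetricAlgebra (Multiset.toFinsupp (Multiset.ofList (emb x))) := by
    intro x
    rw [symmetricAlgebra_basis_eq_prod, ← pbwMap_prod_of_pairwise δ (hemb x)]
    congr 1
    rw [tripleMul_tmul, uIncl_prod, uIncl_prod, uIncl_prod]
    simp only [emb, List.map_append, List.prod_append, List.map_map, mul_assoc]
    simp [Function.comp_def, hα, hβ, hγ]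
  -- The letters of each of the three kinds can be filtered out of the multiset, and a sorted word
  -- is determined by its letters.
  have hinj : Function.Injective fun x => Multiset.toFinsupp (Multiset.ofList (emb x)) := by
    rintro ⟨⟨⟨lA, h1⟩, ⟨lB, h2⟩⟩, ⟨lC, h3⟩⟩ ⟨⟨⟨lA', h1'⟩, ⟨lB', h2'⟩⟩, ⟨lC', h3'⟩⟩ h
    have hp : (emb _).Perm (emb _) := Multiset.coe_eq_coe.1 (Multiset.toFinsupp.injective h)
    have pA := hp.filterMap fun x => (ofLex x).getLeft?
    have pB := hp.filterMap fun x => (ofLex x).getRight?.bind fun y => (ofLex y).getLeft?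
    have pC := hp.filterMap fun x => (ofLex x).getRight?.bind fun y => (ofLex y).getRight?
    simp only [emb, List.filterMap_append, List.filterMap_map, Function.comp_def, ofLex_toLex,
      Sum.getLeft?_inl, Sum.getLeft?_inr, Sum.getRight?_inl, Sum.getRight?_inr,
      Option.bind_some, Option.bind_none, List.filterMap_some, List.filterMap_none,
      List.append_nil, List.nil_append] at pA pB pC
    obtain rfl := pA.eq_of_pairwise' h1 h1'
    obtain rfl := pB.eq_of_pairwise' h2 h2'
    obtain rfl := pC.eq_of_pairwise' h3 h3'
    rfl
  have hli : LinearIndependent ℂ ((pbwMap δ ∘ₗ tripleMul A B C) ∘ w) := by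
    have he : (pbwMap δ ∘ₗ tripleMul A B C) ∘ w =
      δ.symmetricAlgebra ∘ fun x => Multiset.toFinsupp (Multiset.ofList (emb x)) := funext hval
    rw [he]
    exact δ.symmetricAlgebra.linearIndependent.comp _ hinj
  rw [injective_iff_map_eq_zero]
  intro t ht
  obtain ⟨c, rfl⟩ : ∃ c, Finsupp.linearCombination ℂ w c = t := by
    have : t ∈ Submodule.span ℂ (Set.range w) := hw ▸ Submodule.mem_top
    rwa [← Finsupp.range_linearCombination] at this
  have hc : Finsupp.linearCombination ℂ ((pbwMap δ ∘ₗ tripleMul A B C) ∘ w) c = 0 := by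
    rw [← Finsupp.apply_linearCombination, LinearMap.comp_apply, ht, map_zero]
  rw [linearIndependent_iff.1 hli c hc, map_zero]

end Triangular

end HarishChandra

namespace HarishChandra

/-! ### The triangular decomposition of a semisimple Lie algebra -/

theorem rootSum_eq_span {L : Type*} [LieRing L] [LieAlgebra ℂ L] {H : LieSubalgebra ℂ L}
    [LieRing.IsNilpotent H] (s : Set (H → ℂ)) : (rootSum (L := L) s).toSubmodule =
    Submodule.span ℂ {x | ∃ χ ∈ s, x ∈ rootSpace H χ} := by
  refine le_antisymm ?_ (Submodule.span_le.2 ?_)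
  · rw [rootSum, LieSubmodule.iSup_toSubmodule]
    refine iSup_le fun χ => ?_
    rw [LieSubmodule.iSup_toSubmodule]
    exact iSup_le fun hχ x hx => Submodule.subset_span ⟨χ, hχ, hx⟩
  · rintro x ⟨χ, hχ, hx⟩
    exact (le_iSup₂_of_le χ hχ le_rfl : rootSpace H χ ≤ rootSum s) hx

section RootVectors

variable {L : Type*} [LieRing L] [LieAlgebra ℂ L] [FiniteDimensional ℂ L] [IsSemisimple ℂ L]
  {H : LieSubalgebra ℂ L} [H.IsCartanSubalgebra] (b : (rootSystem H).Base)

theorem nPlus_eq_span : (nPlus b).toSubmodule =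
    Submodule.span ℂ {x | ∃ α : H.root, b.IsPos α ∧ x ∈ rootSpace H α.1} := by
  refine (rootSum_eq_span (posRoots b)).trans (congrArg _ ?_)
  ext x
  constructor
  · rintro ⟨_, ⟨α, hα, rfl⟩, hx⟩; exact ⟨α, hα, hx⟩
  · rintro ⟨α, hα, hx⟩; exact ⟨_, ⟨α, hα, rfl⟩, hx⟩

theorem nMinus_eq_span : (nMinus b).toSubmodule =
    Submodule.span ℂ {x | ∃ α : H.root, b.IsPos α ∧ x ∈ rootSpace H (-(α.1 : H → ℂ))} := by
  refine (rootSum_eq_span (negRoots b)).trans (congrArg _ ?_)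
  ext x
  constructor
  · rintro ⟨χ, ⟨α, hα, h⟩, hx⟩
    refine ⟨α, hα, ?_⟩
    rwa [← h, neg_neg]
  · rintro ⟨α, hα, hx⟩; exact ⟨_, ⟨α, hα, neg_neg _⟩, hx⟩

theorem mem_nPlus_of_mem_rootSpace {α : H.root} (hα : b.IsPos α) {x : L}
    (hx : x ∈ rootSpace H α.1) : x ∈ nPlus b := by
  rw [← LieSubalgebra.mem_toSubmodule, nPlus_eq_span]
  exact Submodule.subset_span ⟨α, hα, hx⟩

theorem mem_nMinus_of_mem_rootSpace {α : H.root} (hα : b.IsPos α) {x : L}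
    (hx : x ∈ rootSpace H (-(α.1 : H → ℂ))) : x ∈ nMinus b := by
  rw [← LieSubalgebra.mem_toSubmodule, nMinus_eq_span]
  exact Submodule.subset_span ⟨α, hα, hx⟩

theorem nPlus_induction {p : L → Prop} (zero : p 0) (add : ∀ x y, p x → p y → p (x + y))
    (smul : ∀ (t : ℂ) x, p x → p (t • x))
    (root : ∀ α : H.root, b.IsPos α → ∀ x ∈ rootSpace H α.1, p x) {x : L} (hx : x ∈ nPlus b) :
    p x := by
  rw [← LieSubalgebra.mem_toSubmodule, nPlus_eq_span] at hx
  induction hx using Submodule.span_induction with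
  | mem _ h => obtain ⟨α, hα, hx⟩ := h; exact root α hα _ hx
  | zero => exact zero
  | add _ _ _ _ h h' => exact add _ _ h h'
  | smul t _ _ h => exact smul t _ h

theorem nMinus_induction {p : L → Prop} (zero : p 0) (add : ∀ x y, p x → p y → p (x + y))
    (smul : ∀ (t : ℂ) x, p x → p (t • x))
    (root : ∀ α : H.root, b.IsPos α → ∀ x ∈ rootSpace H (-(α.1 : H → ℂ)), p x) {x : L}
    (hx : x ∈ nMinus b) : p x := by
  rw [← LieSubalgebra.mem_toSubmodule, nMinus_eq_span] at hx
  induction hx using Submodule.span_induction with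
  | mem _ h => obtain ⟨α, hα, hx⟩ := h; exact root α hα _ hx
  | zero => exact zero
  | add _ _ _ _ h h' => exact add _ _ h h'
  | smul t _ _ h => exact smul t _ h

/-- The element of `𝔥` at which every simple root takes the value one. -/
noncomputable def gradeElt : H :=
  (Module.evalEquiv ℂ H).symm (b.toWeightBasis.constr ℂ fun _ => (1 : ℂ))

theorem apply_gradeElt (l : Module.Dual ℂ H) :
    l (gradeElt b) = b.toWeightBasis.constr ℂ (fun _ => (1 : ℂ)) l := by
  rw [gradeElt, ← Module.Dual.eval_apply ℂ H, ← Module.evalEquiv_toLinearMap]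
  simp

theorem simpleRoot_gradeElt {i : H.root} (hi : i ∈ b.support) :
    (rootSystem H).root i (gradeElt b) = 1 := by
  rw [apply_gradeElt]
  have : (rootSystem H).root i = b.toWeightBasis ⟨i, hi⟩ := by simp
  rw [this, Module.Basis.constr_basis]

theorem root_gradeElt (α : H.root) : (rootSystem H).root α (gradeElt b) = b.height α := by
  obtain ⟨f, -, -, hf⟩ := b.exists_root_eq_sum_int α
  rw [RootPairing.Base.height_eq_sum hf, hf]
  simp only [LinearMap.sum_apply, LinearMap.smul_apply]
  rw [Int.cast_sum]
  refine Finset.sum_congr rfl fun i hi => ?_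
  rw [simpleRoot_gradeElt b hi]
  simp

/-- Root spaces are independent, and no root is both positive and negative, because its height would
have both signs. -/
theorem disjoint_nMinus_nPlus : Disjoint (nMinus b).toSubmodule (nPlus b).toSubmodule := by
  have hd : Disjoint (negRoots b) (posRoots b) := by
    rw [Set.disjoint_left]
    rintro χ ⟨α, hα, h⟩ ⟨γ, hγ, rfl⟩
    have h1 := root_gradeElt b α
    have h2 := root_gradeElt b γ
    have h3 := congrFun h (gradeElt b)
    simp only [rootSystem_root_apply, LieModule.Weight.toLinear_apply] at h1 h2
    simp only [Pi.neg_apply, h1, h2] at h3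
    have h4 : -b.height γ = b.height α := by exact_mod_cast h3
    rw [RootPairing.Base.isPos_iff] at hα hγ
    omega
  have := (LieModule.iSupIndep_genWeightSpace ℂ H L).disjoint_biSup_biSup hd
  exact LieSubmodule.disjoint_toSubmodule.2 this

theorem nMinus_sup_cartan_sup_nPlus :
    (nMinus b).toSubmodule ⊔ H.toSubmodule ⊔ (nPlus b).toSubmodule = ⊤ := by
  rw [sup_comm (nMinus b).toSubmodule, sup_assoc]
  exact (isCompl_cartan b).sup_eq_top

theorem eq_zero_of_add_eq_zero {x h y : L} (hx : x ∈ nMinus b) (hh : h ∈ H) (hy : y ∈ nPlus b)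
    (h0 : x + h + y = 0) : x = 0 ∧ h = 0 ∧ y = 0 := by
  have h1 : h = 0 := by
    refine Submodule.disjoint_def.1 (isCompl_cartan b).disjoint h hh ?_
    have : h = -(x + y) := by rw [eq_neg_iff_add_eq_zero, ← h0]; abel
    rw [this]
    exact neg_mem (Submodule.add_mem_sup hx hy)
  subst h1
  rw [add_zero] at h0
  have h2 : x = 0 := by
    refine Submodule.disjoint_def.1 (disjoint_nMinus_nPlus b) x hx ?_
    rw [eq_neg_of_add_eq_zero_left h0]
    exact neg_mem (S := Submodule ℂ L) hy
  exact ⟨h2, rfl, by simpa [h2] using h0⟩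

/-- The linear isomorphism `𝔫₋ × 𝔥 × 𝔫₊ ≃ 𝔤`. -/
noncomputable def triEquiv : (nMinus b × (H × nPlus b)) ≃ₗ[ℂ] L :=
  LinearEquiv.ofBijective ((nMinus b).toSubmodule.subtype.coprod
    (H.toSubmodule.subtype.coprod (nPlus b).toSubmodule.subtype)) (by
    constructor
    · rw [injective_iff_map_eq_zero]
      rintro ⟨x, h, y⟩ h0
      obtain ⟨h1, h2, h3⟩ := eq_zero_of_add_eq_zero b x.2 h.2 y.2
        (by rw [add_assoc]; exact h0)
      ext
      · exact h1
      · exact h2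
      · exact h3
    · rw [← LinearMap.range_eq_top, LinearMap.range_coprod, LinearMap.range_coprod,
        Submodule.range_subtype, Submodule.range_subtype, Submodule.range_subtype, ← sup_assoc]
      exact nMinus_sup_cartan_sup_nPlus b)

theorem triEquiv_apply (x : nMinus b) (h : H) (y : nPlus b) :
    triEquiv b (x, h, y) = (x : L) + (h + y) := rfl

theorem triEquiv_left (x : nMinus b) : triEquiv b (x, 0) = x :=
  (triEquiv_apply b x 0 0).trans (by simp)

theorem triMul_bijective : Function.Bijective (triMul b) := by
  let α := Module.finBasis ℂ (nMinus b)
  let β := Module.finBasis ℂ H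
  let γ := Module.finBasis ℂ (nPlus b)
  let δ := ((α.prod ((β.prod γ).reindex toLex)).reindex toLex).map (triEquiv b)
  refine ⟨tripleMul_injective (nMinus b) H (nPlus b) α β γ δ ?_ ?_ ?_,
    tripleMul_surjective (nMinus b) H (nPlus b) (nMinus_sup_cartan_sup_nPlus b)⟩
  · intro i
    simp [δ, triEquiv_left]
  · intro i
    simp [δ, triEquiv_apply]
  · intro i
    simp [δ, triEquiv_apply]

theorem triMul_tmul (a : UniversalEnvelopingAlgebra ℂ (nMinus b))
    (h : UniversalEnvelopingAlgebra ℂ H) (c : UniversalEnvelopingAlgebra ℂ (nPlus b)) :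
    triMul b ((a ⊗ₜ h) ⊗ₜ c) = uIncl (nMinus b) a * uIncl H h * uIncl (nPlus b) c := by
  simp [triMul]

/-- Induction over the triangular decomposition. -/
theorem tri_induction {p : UniversalEnvelopingAlgebra ℂ L → Prop} (zero : p 0)
    (add : ∀ u w, p u → p w → p (u + w))
    (mul : ∀ a h c, p (uIncl (nMinus b) a * uIncl H h * uIncl (nPlus b) c))
    (u : UniversalEnvelopingAlgebra ℂ L) : p u := by
  obtain ⟨t, rfl⟩ := (triMul_bijective b).2 u
  induction t using TensorProduct.induction_on with
  | zero => simpa using zero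
  | add _ _ h h' => rw [map_add]; exact add _ _ h h'
  | tmul t c =>
    induction t using TensorProduct.induction_on with
    | zero => simpa using zero
    | add _ _ h h' => rw [TensorProduct.add_tmul, map_add]; exact add _ _ h h'
    | tmul a h => rw [triMul_tmul]; exact mul a h c

theorem HC_triMul (t) : HC b (triMul b t) = triProj b t := by
  rw [HC, dif_pos (triMul_bijective b), LinearMap.comp_apply]
  congr 1
  exact (LinearEquiv.ofBijective (triMul b) (triMul_bijective b)).symm_apply_apply t

theorem HC_mul (a : UniversalEnvelopingAlgebra ℂ (nMinus b)) (h : UniversalEnvelopingAlgebra ℂ H)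
    (c : UniversalEnvelopingAlgebra ℂ (nPlus b)) :
    HC b (uIncl (nMinus b) a * uIncl H h * uIncl (nPlus b) c) =
      (counit (nMinus b) a * counit (nPlus b) c) • uToSym H h := by
  rw [← triMul_tmul, HC_triMul]
  simp only [triProj, LinearMap.comp_apply, TensorProduct.map_tmul, LinearMap.mul'_apply,
    AlgHom.toLinearMap_apply, Algebra.linearMap_apply]
  rw [mul_comm, ← mul_assoc, ← map_mul, ← Algebra.smul_def, mul_comm (counit (nPlus b) c)]

theorem cartanProj_cartan (h : H) : cartanProj b h = h :=
  Submodule.projectionOnto_apply_left _ h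

theorem cartanProj_nMinus {x : L} (hx : x ∈ nMinus b) : cartanProj b x = 0 :=
  Submodule.projectionOnto_apply_eq_zero_iff _ |>.2 (Submodule.mem_sup_left hx)

theorem cartanProj_nPlus {x : L} (hx : x ∈ nPlus b) : cartanProj b x = 0 :=
  Submodule.projectionOnto_apply_eq_zero_iff _ |>.2 (Submodule.mem_sup_right hx)

/-- For products in triangular order the symbol is exact: a factor from `𝔫₋` or `𝔫₊` makes both
sides zero, and otherwise all factors lie in `𝔥`. -/
theorem HC_prod_triple (lA : List (nMinus b)) (lB : List H) (lC : List (nPlus b)) :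
    HC b (((lA.map (nMinus b).subtype ++ (lB.map H.subtype ++ lC.map (nPlus b).subtype)).map
      (uι L)).prod) = (((lA.map (nMinus b).subtype ++ (lB.map H.subtype ++
        lC.map (nPlus b).subtype)).map (cartanProj b)).map (SymmetricAlgebra.ι ℂ H)).prod := by
  rw [prod_triple_eq, HC_mul]
  rcases lA with - | ⟨x, lA⟩
  · rcases lC with - | ⟨y, lC⟩
    · simp only [List.map_nil, List.prod_nil, map_one, mul_one, one_smul, List.nil_append,
        List.append_nil, map_list_prod, List.map_map]
      congr 1
      refine List.map_congr_left fun h _ => ?_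
      simp [uToSym_uι, cartanProj_cartan]
    · simp [counit_uι, cartanProj_nPlus b y.2]
  · simp [counit_uι, cartanProj_nMinus b x.2]

/-- `HC` is filtered, and its symbol is the restriction map. -/
theorem HC_prod_sub_mem (n : ℕ) :
    (∀ l : List L, l.length = n → HC b (l.map (uι L)).prod -
      ((l.map (cartanProj b)).map (SymmetricAlgebra.ι ℂ H)).prod ∈
        fil (SymmetricAlgebra.ι ℂ H) n) ∧
    ∀ u ∈ fil (uι L) n, HC b u ∈ fil (SymmetricAlgebra.ι ℂ H) n := by
  induction n using Nat.strong_induction_on with | _ n ih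
  -- The two claims support each other: that `HC` is filtered at `n` uses symbols in degrees below
  -- `n`, and the symbol in degree `n` uses filteredness at `n` for the error made by reordering.
  have hfil : ∀ u ∈ fil (uι L) n, HC b u ∈ fil (SymmetricAlgebra.ι ℂ H) n := by
    intro u hu
    refine fil_induction _ (p := fun u => HC b u ∈ fil (SymmetricAlgebra.ι ℂ H) n) (by simp)
      (fun _ _ h h' => by rw [map_add]; exact add_mem h h') (fun m hm a ha => ?_) hu
    refine piece_induction _ Submodule.span_univ
      (p := fun u => HC b u ∈ fil (SymmetricAlgebra.ι ℂ H) n) (by simp)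
      (fun _ _ h h' => by rw [map_add]; exact add_mem h h')
      (fun t _ h => by rw [map_smul]; exact Submodule.smul_mem _ _ h) (fun l hl _ => ?_) ha
    rw [← sub_add_cancel (HC b _)]
    refine add_mem (fil_mono _ hm.le ((ih m hm).1 l hl)) (fil_mono _ ?_ (prod_mem_fil _ _))
    simp [hl]; omega
  refine ⟨fun l hl => ?_, hfil⟩
  have key : ∀ x : Fin n → L, HC b (List.ofFn fun i => uι L (x i)).prod -
      (List.ofFn fun i => SymmetricAlgebra.ι ℂ H (cartanProj b (x i))).prod ∈
        fil (SymmetricAlgebra.ι ℂ H) n := by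
    let φ : MultilinearMap ℂ (fun _ : Fin n => L) (SymmetricAlgebra ℂ H ⧸
        fil (SymmetricAlgebra.ι ℂ H) n) :=
      (Submodule.mkQ _).compMultilinearMap ((HC b).compMultilinearMap
        ((MultilinearMap.mkPiAlgebraFin ℂ n _).compLinearMap fun _ => uι L))
    let ψ : MultilinearMap ℂ (fun _ : Fin n => L) (SymmetricAlgebra ℂ H ⧸
        fil (SymmetricAlgebra.ι ℂ H) n) :=
      (Submodule.mkQ _).compMultilinearMap
        ((MultilinearMap.mkPiAlgebraFin ℂ n _).compLinearMap
          fun _ => SymmetricAlgebra.ι ℂ H ∘ₗ cartanProj b)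
    suffices h : φ = ψ by
      intro x
      exact (Submodule.Quotient.eq _).1 congr($h x)
    -- By multilinearity the factors may be taken from a basis adapted to `𝔫₋ ⊕ 𝔥 ⊕ 𝔫₊`, where every
    -- product can be put in triangular order.
    let δ := ((Module.finBasis ℂ (nMinus b)).prod ((Module.finBasis ℂ H).prod
      (Module.finBasis ℂ (nPlus b)))).map (triEquiv b)
    have hδ : ∀ i, δ i ∈ nMinus b ∨ δ i ∈ H ∨ δ i ∈ nPlus b := by
      rintro (i | i | i)
      · left; simp [δ, triEquiv_left]
      · right; left; simp [δ, triEquiv_apply]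
      · right; right; simp [δ, triEquiv_apply]
    refine Module.Basis.ext_multilinear (fun _ => δ) fun j => ?_
    refine (Submodule.Quotient.eq _).2 ?_
    change HC b (List.ofFn fun i => uι L (δ (j i))).prod -
      (List.ofFn fun i => SymmetricAlgebra.ι ℂ H (cartanProj b (δ (j i)))).prod ∈ _
    have e1 : (List.ofFn fun i => uι L (δ (j i))) = (List.ofFn fun i => δ (j i)).map (uι L) := by
      rw [List.map_ofFn]; rfl
    have e2 : (List.ofFn fun i => SymmetricAlgebra.ι ℂ H (cartanProj b (δ (j i)))) =
        ((List.ofFn fun i => δ (j i)).map (cartanProj b)).map (SymmetricAlgebra.ι ℂ H) := by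
      rw [List.map_ofFn, List.map_ofFn]; rfl
    rw [e1, e2]
    obtain ⟨lA, lB, lC, hp⟩ := exists_perm_triple (nMinus b) H (nPlus b)
      (l := List.ofFn fun i => δ (j i)) (by
        intro x hx
        obtain ⟨i, rfl⟩ := List.mem_ofFn.1 hx
        exact hδ _)
    have h0 := uι_perm hp
    rw [List.length_ofFn] at h0
    have h1 := hfil _ h0
    rw [map_sub, HC_prod_triple, ← ((hp.map (cartanProj b)).map (SymmetricAlgebra.ι ℂ H)).prod_eq]
      at h1
    exact h1
  subst hl
  have := key l.get
  have e1 : (List.ofFn fun i => uι L (l.get i)) = l.map (uι L) := by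
    conv_rhs => rw [← List.ofFn_get l, List.map_ofFn]
    rfl
  have e2 : (List.ofFn fun i => SymmetricAlgebra.ι ℂ H (cartanProj b (l.get i))) =
      (l.map (cartanProj b)).map (SymmetricAlgebra.ι ℂ H) := by
    conv_rhs => rw [← List.ofFn_get l, List.map_ofFn, List.map_ofFn]
    rfl
  rwa [e1, e2] at this

theorem HC_mem_fil {n : ℕ} {u : UniversalEnvelopingAlgebra ℂ L} (hu : u ∈ fil (uι L) n) :
    HC b u ∈ fil (SymmetricAlgebra.ι ℂ H) n :=
  (HC_prod_sub_mem b n).2 u hu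

/-- This is `gr HC = Res` on homogeneous representatives, the form in which all later comparisons of
degree use it. -/
theorem HC_symmetrize_sub_mem {n : ℕ} {s : SymmetricAlgebra ℂ L}
    (hs : s ∈ piece (SymmetricAlgebra.ι ℂ L) n) :
    HC b (symmetrize L n s) - res b s ∈ fil (SymmetricAlgebra.ι ℂ H) n := by
  refine piece_induction_ofFn _ (p := fun s => HC b (symmetrize L n s) - res b s ∈
    fil (SymmetricAlgebra.ι ℂ H) n) (by simp) (fun a c h h' => ?_) (fun t a h => ?_)
    (fun x => ?_) hs
  · simp only [map_add]; rw [add_sub_add_comm]; exact add_mem h h'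
  · simp only [map_smul]; rw [← smul_sub]; exact Submodule.smul_mem _ _ h
  · rw [symmetrize_prod]
    have h1 := HC_mem_fil b (symU_sub_prod_mem x)
    have h2 := (HC_prod_sub_mem b n).1 (List.ofFn x) (by simp)
    have e : ((List.ofFn x).map (cartanProj b)).map (SymmetricAlgebra.ι ℂ H) =
        (List.ofFn fun i => SymmetricAlgebra.ι ℂ L (x i)).map (res b) := by
      rw [List.map_ofFn, List.map_ofFn, List.map_ofFn]
      congr 1
      ext i
      simp [res, symMap]
    rw [map_sub] at h1
    rw [e, ← map_list_prod (res b), List.map_ofFn, Function.comp_def] at h2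
    simpa using add_mem h1 h2

end RootVectors

end HarishChandra

namespace HarishChandra

/-! ### Highest weight modules -/

section HighestWeight

variable {L : Type*} [LieRing L] [LieAlgebra ℂ L] [FiniteDimensional ℂ L] [IsSemisimple ℂ L]
  {H : LieSubalgebra ℂ L} [H.IsCartanSubalgebra] {b : (rootSystem H).Base}
  {V : Type*} [AddCommGroup V] [Module ℂ V] [LieRingModule L V] [LieModule ℂ L V]
  {l : Module.Dual ℂ H} {v : V}

theorem uAct_nPlus (h : ∀ x ∈ nPlus b, ⁅x, v⁆ = 0)
    (c : UniversalEnvelopingAlgebra ℂ (nPlus b)) :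
    uAct V (uIncl (nPlus b) c) v = counit (nPlus b) c • v := by
  induction c using u_induction with
  | one => simp
  | add _ _ h h' => simp only [map_add, LinearMap.add_apply, h, h', add_smul]
  | smul t _ h => simp only [map_smul, LinearMap.smul_apply, h, smul_assoc]
  | mul x a h' =>
    rw [map_mul, map_mul, Module.End.mul_apply, h', map_smul, uIncl_uι, uAct_uι, h x x.2, map_mul,
      counit_uι, smul_zero, zero_mul, zero_smul]

theorem uAct_cartan (h : ∀ x : H, ⁅(x : L), v⁆ = l x • v) (u : UniversalEnvelopingAlgebra ℂ H) :
    uAct V (uIncl H u) v = evalAt l (uToSym H u) • v := by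
  induction u using u_induction with
  | one => simp
  | add _ _ h h' => simp only [map_add, LinearMap.add_apply, h, h', add_smul]
  | smul t _ h => simp only [map_smul, LinearMap.smul_apply, h, smul_assoc]
  | mul x a h' =>
    rw [map_mul, map_mul, Module.End.mul_apply, h', map_smul, uIncl_uι, uAct_uι, h x, map_mul,
      map_mul, uToSym_uι, smul_smul, mul_comm]
    simp [evalAt]

theorem uAct_tri (h₁ : ∀ x : H, ⁅(x : L), v⁆ = l x • v) (h₂ : ∀ x ∈ nPlus b, ⁅x, v⁆ = 0)
    (a : UniversalEnvelopingAlgebra ℂ (nMinus b)) (h : UniversalEnvelopingAlgebra ℂ H)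
    (c : UniversalEnvelopingAlgebra ℂ (nPlus b)) :
    uAct V (uIncl (nMinus b) a * uIncl H h * uIncl (nPlus b) c) v =
      (counit (nPlus b) c * evalAt l (uToSym H h)) • uAct V (uIncl (nMinus b) a) v := by
  rw [map_mul, map_mul, Module.End.mul_apply, Module.End.mul_apply, uAct_nPlus h₂, map_smul,
    uAct_cartan h₁, map_smul, map_smul, smul_smul]

theorem IsLowestWeightDual.apply_lie_nMinus {f : Module.Dual ℂ V}
    (hf : IsLowestWeightDual b l f) {y : L} (hy : y ∈ nMinus b) (w : V) : f ⁅y, w⁆ = 0 := by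
  have := congr($(hf.singular y hy) w)
  simpa using this

theorem IsLowestWeightDual.apply_nMinus {f : Module.Dual ℂ V} (hf : IsLowestWeightDual b l f)
    (a : UniversalEnvelopingAlgebra ℂ (nMinus b)) (w : V) :
    f (uAct V (uIncl (nMinus b) a) w) = counit (nMinus b) a * f w := by
  induction a using u_induction with
  | one => simp
  | add _ _ h h' => simp only [map_add, LinearMap.add_apply, h, h', add_mul]
  | smul t _ h => simp only [map_smul, LinearMap.smul_apply, h, smul_mul_assoc]
  | mul x a h' =>
    rw [map_mul, map_mul, Module.End.mul_apply, uIncl_uι, uAct_uι, hf.apply_lie_nMinus x.2,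
      map_mul, counit_uι, zero_mul, zero_mul]

/-- For `u = a h c` in triangular order, `c` acts on `v` by its counit and `h` by its value at `l`,
while `f` absorbs `a` by its counit; these are the factors in `HC`. Note that `v` need not generate
the module. -/
theorem evalAt_HC_eq (h₁ : ∀ x : H, ⁅(x : L), v⁆ = l x • v) (h₂ : ∀ x ∈ nPlus b, ⁅x, v⁆ = 0)
    {f : Module.Dual ℂ V} (hf : IsLowestWeightDual b l f) (u : UniversalEnvelopingAlgebra ℂ L) :
    f (uAct V u v) = evalAt l (HC b u) * f v := by
  induction u using tri_induction b with
  | zero => simp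
  | add _ _ h h' => simp only [map_add, LinearMap.add_apply, h, h', add_mul]
  | mul a h c =>
    rw [uAct_tri h₁ h₂, map_smul, hf.apply_nMinus, HC_mul, map_smul]
    simp only [smul_eq_mul]
    ring

/-- The sum of the eigenspaces of `gradeElt` for the eigenvalues `t - k`, `k ≥ n`. -/
noncomputable def lowerPart (b : (rootSystem H).Base) (V : Type*) [AddCommGroup V] [Module ℂ V]
    [LieRingModule L V] [LieModule ℂ L V] (t : ℂ) (n : ℕ) : Submodule ℂ V :=
  ⨆ k : ℕ, (LieModule.toEnd ℂ L V (gradeElt b : L)).eigenspace (t - (n + k : ℕ))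

/-- A root vector for `-α` lowers the eigenvalue of `gradeElt` by the height of `α`, which is at
least one. -/
theorem lie_mem_lowerPart {y : L} (hy : y ∈ nMinus b) {t : ℂ} {n : ℕ} {w : V}
    (hw : w ∈ lowerPart b V t n) : ⁅y, w⁆ ∈ lowerPart b V t (n + 1) := by
  refine nMinus_induction b (p := fun y => ⁅y, w⁆ ∈ lowerPart b V t (n + 1)) (by simp)
    (fun _ _ h h' => by rw [add_lie]; exact add_mem h h')
    (fun t _ h => by rw [smul_lie]; exact Submodule.smul_mem _ _ h) (fun α hα y hy => ?_) hy
  refine Submodule.iSup_induction _ (motive := fun w => ⁅y, w⁆ ∈ lowerPart b V t (n + 1)) hw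
    (fun k w hw => ?_) (by simp) (fun _ _ h h' => by rw [lie_add]; exact add_mem h h')
  obtain ⟨m, hm⟩ : ∃ m : ℕ, b.height α = m + 1 := by
    rw [RootPairing.Base.isPos_iff] at hα
    exact ⟨(b.height α - 1).toNat, by omega⟩
  have h1 := lie_eq_smul_of_mem_rootSpace hy (gradeElt b)
  have h2 := root_gradeElt b α
  rw [rootSystem_root_apply, LieModule.Weight.toLinear_apply] at h2
  rw [Pi.neg_apply, h2, hm] at h1
  refine Submodule.mem_iSup_of_mem (m + k) ?_
  rw [Module.End.mem_eigenspace_iff, LieModule.toEnd_apply_apply] at hw ⊢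
  rw [leibniz_lie, hw, lie_smul]
  have h3 : ⁅(gradeElt b : L), y⁆ = -((m + 1 : ℤ) : ℂ) • y := h1
  rw [h3, smul_lie, ← add_smul]
  congr 1
  push_cast
  ring

theorem lowerPart_le {t : ℂ} {m n : ℕ} (h : n ≤ m) : lowerPart b V t m ≤ lowerPart b V t n := by
  refine iSup_le fun k => le_iSup_of_le (m - n + k) (le_of_eq ?_)
  rw [show n + (m - n + k) = m + k by omega]

variable (b V) in
/-- The subspace `𝔫₋ V`. -/
def nMinusMul : Submodule ℂ V := Submodule.span ℂ {x | ∃ y ∈ nMinus b, ∃ w : V, ⁅y, w⁆ = x}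

theorem lie_mem_nMinusMul {y : L} (hy : y ∈ nMinus b) (w : V) : ⁅y, w⁆ ∈ nMinusMul b V :=
  Submodule.subset_span ⟨y, hy, w, rfl⟩

theorem IsHighestWeight.exists_uAct_eq (hv : IsHighestWeight b l v) (w : V) :
    ∃ u : UniversalEnvelopingAlgebra ℂ L, uAct V u v = w := by
  let N : LieSubmodule ℂ L V :=
    { LinearMap.range (LinearMap.applyₗ v ∘ₗ (uAct (L := L) V).toLinearMap) with
      lie_mem := by
        rintro x _ ⟨u, rfl⟩
        exact ⟨uι L x * u, by
          change uAct V (uι L x * u) v = ⁅x, uAct V u v⁆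
          rw [map_mul, Module.End.mul_apply, uAct_uι]⟩ }
  have h : LieSubmodule.lieSpan ℂ L {v} ≤ N := by
    rw [LieSubmodule.lieSpan_le, Set.singleton_subset_iff]
    exact ⟨1, by simp⟩
  rw [hv.generates] at h
  exact h (LieSubmodule.mem_top w)

/-- In triangular order the factors from `𝔥` and `𝔫₊` act on `v` by scalars, so `𝔫₋` alone generates
the module. -/
theorem IsHighestWeight.induction (hv : IsHighestWeight b l v) {p : V → Prop}
    (add : ∀ w w', p w → p w' → p (w + w')) (smul : ∀ (t : ℂ) w, p w → p (t • w))
    (base : p v) (lie : ∀ y ∈ nMinus b, ∀ w, p w → p ⁅y, w⁆) (w : V) : p w := by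
  obtain ⟨u, rfl⟩ := hv.exists_uAct_eq w
  induction u using tri_induction b with
  | zero => simpa using smul 0 v base
  | add _ _ h h' => rw [map_add]; exact add _ _ h h'
  | mul a h c =>
    rw [uAct_tri hv.weight hv.singular]
    refine smul _ _ ?_
    induction a using u_induction with
    | one => simpa using base
    | add _ _ h h' => rw [map_add, map_add]; exact add _ _ h h'
    | smul t _ h => rw [map_smul, map_smul]; exact smul _ _ h
    | mul x a h =>
      rw [map_mul, map_mul, Module.End.mul_apply, uIncl_uι, uAct_uι]
      exact lie x x.2 _ h

theorem IsHighestWeight.mem_eigenspace (hv : IsHighestWeight b l v) :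
    v ∈ (LieModule.toEnd ℂ L V (gradeElt b : L)).eigenspace (l (gradeElt b)) := by
  rw [Module.End.mem_eigenspace_iff, LieModule.toEnd_apply_apply, hv.weight]

theorem IsHighestWeight.mem_lowerPart (hv : IsHighestWeight b l v) (w : V) :
    w ∈ lowerPart b V (l (gradeElt b)) 0 := by
  induction w using hv.induction with
  | add _ _ h h' => exact add_mem h h'
  | smul t _ h => exact Submodule.smul_mem _ _ h
  | base => exact Submodule.mem_iSup_of_mem 0 (by simpa using hv.mem_eigenspace)
  | lie y hy w h => exact lowerPart_le (Nat.le_succ 0) (lie_mem_lowerPart hy h)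

theorem IsHighestWeight.nMinusMul_le (hv : IsHighestWeight b l v) :
    nMinusMul b V ≤ lowerPart b V (l (gradeElt b)) 1 := by
  refine Submodule.span_le.2 ?_
  rintro _ ⟨y, hy, w, rfl⟩
  exact lie_mem_lowerPart hy (hv.mem_lowerPart w)

/-- The eigenvalues in the second space are `t - 1, t - 2, …`. This disjointness separates the
highest weight vector from everything below it and replaces a full weight decomposition. -/
theorem disjoint_eigenspace_lowerPart (t : ℂ) :
    Disjoint ((LieModule.toEnd ℂ L V (gradeElt b : L)).eigenspace t) (lowerPart b V t 1) := by
  refine (Module.End.eigenspaces_iSupIndep _ t).mono_right (iSup_le fun k => ?_)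
  refine le_iSup₂_of_le (t - (1 + k : ℕ)) ?_ le_rfl
  intro h
  have : ((1 + k : ℕ) : ℂ) = 0 := by linear_combination -h
  rw [Nat.cast_eq_zero] at this
  omega

theorem IsHighestWeight.exists_eq_smul_add (hv : IsHighestWeight b l v) (w : V) :
    ∃ (c : ℂ), ∃ n ∈ nMinusMul b V, w = c • v + n := by
  induction w using hv.induction with
  | add _ _ h h' =>
    obtain ⟨⟨c, n, hn, rfl⟩, c', n', hn', rfl⟩ := h, h'
    exact ⟨c + c', n + n', add_mem hn hn', by rw [add_smul]; abel⟩
  | smul t _ h =>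
    obtain ⟨c, n, hn, rfl⟩ := h
    exact ⟨t * c, t • n, Submodule.smul_mem _ _ hn, by rw [smul_add, smul_smul]⟩
  | base => exact ⟨1, 0, zero_mem _, by simp⟩
  | lie y hy w h => exact ⟨0, _, lie_mem_nMinusMul hy w, by simp⟩

theorem IsHighestWeight.notMem_nMinusMul (hv : IsHighestWeight b l v) : v ∉ nMinusMul b V :=
  fun h => hv.ne_zero (Submodule.disjoint_def.1 (disjoint_eigenspace_lowerPart _) v
    hv.mem_eigenspace (hv.nMinusMul_le h))

theorem lie_cartan_mem_nMinus (h : H) {y : L} (hy : y ∈ nMinus b) : ⁅(h : L), y⁆ ∈ nMinus b :=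
  (rootSum (negRoots b)).lie_mem (x := h) hy

/-- As `v` is not in `𝔫₋ V`, some functional vanishes on `𝔫₋ V` and not at `v`. It has weight `-l`
because `V = ℂ v + 𝔫₋ V` and `𝔥` preserves `𝔫₋ V`. -/
theorem IsHighestWeight.exists_lowestWeightDual (hv : IsHighestWeight b l v) :
    ∃ f : Module.Dual ℂ V, IsLowestWeightDual b l f ∧ f v = 1 := by
  obtain ⟨g, hg, hle⟩ := Submodule.exists_le_ker_of_notMem hv.notMem_nMinusMul
  have hN : ∀ w ∈ nMinusMul b V, g w = 0 := fun w hw => hle hw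
  refine ⟨(g v)⁻¹ • g, ⟨fun h => ?_, fun y hy => ?_⟩, by simp [hg]⟩
  · ext w
    obtain ⟨c, n, hn, rfl⟩ := hv.exists_eq_smul_add w
    have hn' : ⁅(h : L), n⁆ ∈ nMinusMul b V := by
      induction hn using Submodule.span_induction with
      | mem _ hx =>
        obtain ⟨y, hy, w, rfl⟩ := hx
        rw [leibniz_lie]
        exact add_mem (lie_mem_nMinusMul (lie_cartan_mem_nMinus h hy) _) (lie_mem_nMinusMul hy _)
      | zero => simp
      | add _ _ _ _ h h' => rw [lie_add]; exact add_mem h h'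
      | smul t _ _ h => rw [lie_smul]; exact Submodule.smul_mem _ _ h
    simp [hv.weight, hN _ hn, hN _ hn']
    ring
  · ext w
    simp [hN _ (lie_mem_nMinusMul hy w)]

theorem IsHighestWeight.lowestWeightDual_unique (hv : IsHighestWeight b l v)
    {f g : Module.Dual ℂ V} (hf : IsLowestWeightDual b l f) (hg : IsLowestWeightDual b l g)
    (h : f v = g v) : f = g := by
  ext w
  obtain ⟨u, rfl⟩ := hv.exists_uAct_eq w
  rw [evalAt_HC_eq hv.weight hv.singular hf, evalAt_HC_eq hv.weight hv.singular hg, h]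

theorem uAct_comm_of_mem_center {z : UniversalEnvelopingAlgebra ℂ L} (hz : z ∈ centerU L)
    (u : UniversalEnvelopingAlgebra ℂ L) (w : V) :
    uAct V z (uAct V u w) = uAct V u (uAct V z w) := by
  rw [← Module.End.mul_apply, ← Module.End.mul_apply, ← map_mul, ← map_mul,
    Subalgebra.mem_center_iff.1 hz u]

/-- The vector `z v` has the same `gradeElt` eigenvalue as `v`, so its component in `𝔫₋ V` is zero
and it is a multiple of `v`. The dual vector identifies the factor, and `z` commutes with all `u`
that generate the module. -/
theorem IsHighestWeight.center_apply (hv : IsHighestWeight b l v)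
    {z : UniversalEnvelopingAlgebra ℂ L} (hz : z ∈ centerU L) (w : V) :
    uAct V z w = evalAt l (HC b z) • w := by
  have key : uAct V z v = evalAt l (HC b z) • v := by
    obtain ⟨f, hf, hfv⟩ := hv.exists_lowestWeightDual
    obtain ⟨c, n, hn, h⟩ := hv.exists_eq_smul_add (uAct V z v)
    have hn0 : n = 0 := by
      refine Submodule.disjoint_def.1 (disjoint_eigenspace_lowerPart _) n ?_ (hv.nMinusMul_le hn)
      have : n = uAct V z v - c • v := by rw [h]; abel
      rw [this]
      refine sub_mem ?_ (Submodule.smul_mem _ _ hv.mem_eigenspace)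
      rw [Module.End.mem_eigenspace_iff, LieModule.toEnd_apply_apply, ← uAct_uι,
        ← uAct_comm_of_mem_center hz, uAct_uι, hv.weight, map_smul]
    rw [hn0, add_zero] at h
    have h1 := evalAt_HC_eq hv.weight hv.singular hf z
    rw [h, map_smul, hfv, smul_eq_mul, mul_one, mul_one] at h1
    rw [h, h1]
  obtain ⟨u, rfl⟩ := hv.exists_uAct_eq w
  rw [uAct_comm_of_mem_center hz, key, map_smul]

end HighestWeight

end HarishChandra

namespace HarishChandra

/-! ### Quotients of the enveloping algebra by left ideals -/

section Quotients

variable {L : Type*} [LieRing L] [LieAlgebra ℂ L]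

theorem u_induction_right {p : UniversalEnvelopingAlgebra ℂ L → Prop}
    (one : p 1) (add : ∀ a c, p a → p c → p (a + c)) (smul : ∀ (t : ℂ) a, p a → p (t • a))
    (mul : ∀ x a, p (a * uι L x)) (u : UniversalEnvelopingAlgebra ℂ L) : p u := by
  have zero : p 0 := by simpa using smul 0 1 one
  obtain ⟨n, hn⟩ := exists_mem_fil _ (adjoin_range_uι L) u
  refine fil_induction _ zero add (fun m _ a ha => ?_) hn
  refine piece_induction _ Submodule.span_univ zero add smul (fun l _ _ => ?_) ha
  rcases List.eq_nil_or_concat l with rfl | ⟨l, x, rfl⟩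
  · simpa using one
  · simpa using mul x _

noncomputable instance (J : Submodule (UniversalEnvelopingAlgebra ℂ L)
    (UniversalEnvelopingAlgebra ℂ L)) :
    LieRingModule L (UniversalEnvelopingAlgebra ℂ L ⧸ J) where
  bracket x m := uι L x • m
  add_lie x y m := by
    change uι L (x + y) • m = uι L x • m + uι L y • m
    rw [map_add, add_smul]
  lie_add x m n := smul_add (uι L x) m n
  leibniz_lie x y m := by
    change uι L x • uι L y • m = uι L ⁅x, y⁆ • m + uι L y • uι L x • m
    rw [smul_smul, smul_smul, uι_mul_uι, add_smul, add_comm]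

variable (J : Submodule (UniversalEnvelopingAlgebra ℂ L) (UniversalEnvelopingAlgebra ℂ L))

theorem lie_quot (x : L) (m : UniversalEnvelopingAlgebra ℂ L ⧸ J) : ⁅x, m⁆ = uι L x • m := rfl

noncomputable instance : LieModule ℂ L (UniversalEnvelopingAlgebra ℂ L ⧸ J) where
  smul_lie t x m := by rw [lie_quot, lie_quot, map_smul, smul_assoc]
  lie_smul t x m := by rw [lie_quot, lie_quot, smul_comm]

theorem uAct_quot (u : UniversalEnvelopingAlgebra ℂ L) (m : UniversalEnvelopingAlgebra ℂ L ⧸ J) :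
    uAct (UniversalEnvelopingAlgebra ℂ L ⧸ J) u m = u • m := by
  induction u using u_induction with
  | one => simp
  | add _ _ h h' => rw [map_add, LinearMap.add_apply, h, h', add_smul]
  | smul t _ h => rw [map_smul, LinearMap.smul_apply, h, smul_assoc]
  | mul x a h => rw [map_mul, Module.End.mul_apply, h, uAct_uι, lie_quot, smul_smul]

theorem smul_mkQ_one (u : UniversalEnvelopingAlgebra ℂ L) : u • J.mkQ 1 = J.mkQ u := by
  rw [← map_smul, smul_eq_mul, mul_one]

variable [FiniteDimensional ℂ L] [IsSemisimple ℂ L]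
  {H : LieSubalgebra ℂ L} [H.IsCartanSubalgebra] {b : (rootSystem H).Base}

theorem isHighestWeight_quot {l : Module.Dual ℂ H} (h₀ : (1 : UniversalEnvelopingAlgebra ℂ L) ∉ J)
    (h₁ : ∀ x ∈ nPlus b, uι L x ∈ J)
    (h₂ : ∀ h : H, uι L h - algebraMap ℂ _ (l h) ∈ J) : IsHighestWeight b l (J.mkQ 1) where
  ne_zero h := h₀ ((Submodule.Quotient.mk_eq_zero J).1 h)
  weight h := by
    rw [lie_quot, smul_mkQ_one, ← algebraMap_smul (UniversalEnvelopingAlgebra ℂ L) (l h),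
      smul_mkQ_one]
    exact (Submodule.Quotient.eq J).2 (h₂ h)
  singular x hx := by
    rw [lie_quot, smul_mkQ_one]
    exact (Submodule.Quotient.mk_eq_zero J).2 (h₁ x hx)
  generates := by
    rw [eq_top_iff]
    rintro m -
    obtain ⟨u, rfl⟩ := J.mkQ_surjective m
    have key : u • J.mkQ 1 ∈ LieSubmodule.lieSpan ℂ L {J.mkQ 1} := by
      induction u using u_induction with
      | one => rw [one_smul]; exact LieSubmodule.subset_lieSpan rfl
      | add _ _ h h' => rw [add_smul]; exact add_mem h h'
      | smul t _ h => rw [smul_assoc]; exact SMulMemClass.smul_mem t h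
      | mul x a h => rw [mul_smul, ← lie_quot]; exact LieSubmodule.lie_mem _ h
    exact (smul_mkQ_one J u) ▸ key

end Quotients

/-! ### Verma modules -/

section Verma

variable {L : Type*} [LieRing L] [LieAlgebra ℂ L] [FiniteDimensional ℂ L] [IsSemisimple ℂ L]
  {H : LieSubalgebra ℂ L} [H.IsCartanSubalgebra] (b : (rootSystem H).Base)
  (l : Module.Dual ℂ H)

/-- The map `a₋ h a₊ ↦ ε(a₊) h(l) a₋` from `U(𝔤)` to `U(𝔫₋)`. -/
noncomputable def vermaMap :
    UniversalEnvelopingAlgebra ℂ L →ₗ[ℂ] UniversalEnvelopingAlgebra ℂ (nMinus b) :=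
  (TensorProduct.rid ℂ _).toLinearMap ∘ₗ
    TensorProduct.map ((TensorProduct.rid ℂ _).toLinearMap ∘ₗ
      TensorProduct.map LinearMap.id ((evalAt l).comp (uToSym H)).toLinearMap)
      (counit (nPlus b)).toLinearMap ∘ₗ
    (LinearEquiv.ofBijective (triMul b) (triMul_bijective b)).symm.toLinearMap

theorem vermaMap_mul (a : UniversalEnvelopingAlgebra ℂ (nMinus b))
    (h : UniversalEnvelopingAlgebra ℂ H) (c : UniversalEnvelopingAlgebra ℂ (nPlus b)) :
    vermaMap b l (uIncl (nMinus b) a * uIncl H h * uIncl (nPlus b) c) =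
      (counit (nPlus b) c * evalAt l (uToSym H h)) • a := by
  have : (LinearEquiv.ofBijective (triMul b) (triMul_bijective b)).symm
      (uIncl (nMinus b) a * uIncl H h * uIncl (nPlus b) c) = (a ⊗ₜ h) ⊗ₜ c := by
    rw [LinearEquiv.symm_apply_eq, LinearEquiv.ofBijective_apply, triMul_tmul]
  simp [vermaMap, this, smul_smul]

theorem vermaMap_nMinus (a : UniversalEnvelopingAlgebra ℂ (nMinus b)) :
    vermaMap b l (uIncl (nMinus b) a) = a := by
  simpa using vermaMap_mul b l a 1 1

theorem vermaMap_mul_nPlus {x : L} (hx : x ∈ nPlus b) (u : UniversalEnvelopingAlgebra ℂ L) :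
    vermaMap b l (u * uι L x) = 0 := by
  induction u using tri_induction b with
  | zero => simp
  | add _ _ h h' => rw [add_mul, map_add, h, h', add_zero]
  | mul a h c =>
    rw [mul_assoc _ _ (uι L x), ← uIncl_uι (nPlus b) ⟨x, hx⟩, ← map_mul, vermaMap_mul, map_mul,
      counit_uι]
    simp

theorem lie_cartan_mem_nPlus {b : (rootSystem H).Base} (h : H) {y : L} (hy : y ∈ nPlus b) :
    ⁅(h : L), y⁆ ∈ nPlus b :=
  (rootSum (posRoots b)).lie_mem (x := h) hy

/-- If the `𝔫₊` part ends in a letter `x`, moving `h` to the left of `x` produces only terms that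
end in `𝔫₊`, which are killed. Otherwise `h` joins the part in `U(𝔥)`. -/
theorem vermaMap_mul_cartan (h : H) (u : UniversalEnvelopingAlgebra ℂ L) :
    vermaMap b l (u * uι L h) = l h • vermaMap b l u := by
  induction u using tri_induction b with
  | zero => simp
  | add _ _ h h' => rw [add_mul, map_add, h, h', map_add, smul_add]
  | mul a h' c =>
    induction c using u_induction_right with
    | one =>
      have := vermaMap_mul b l a (h' * uι H h) 1
      rw [map_mul (uIncl H), uIncl_uι] at this
      simp only [map_one, mul_one, one_mul, ← mul_assoc] at this ⊢
      rw [this]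
      have h2 := vermaMap_mul b l a h' 1
      simp only [map_one, mul_one, one_mul] at h2
      rw [h2, map_mul, map_mul, uToSym_uι, smul_smul, mul_comm]
      simp [evalAt]
    | add _ _ h h' => simp only [map_add, mul_add, add_mul, h, h', smul_add]
    | smul t _ h => simp only [map_smul, mul_smul_comm, smul_mul_assoc, h]; rw [smul_comm]
    | mul x c =>
      rw [map_mul (uIncl (nPlus b)), uIncl_uι, ← mul_assoc, vermaMap_mul_nPlus b l x.2, smul_zero,
        mul_assoc,
        uι_mul_uι, mul_add, map_add, ← mul_assoc, vermaMap_mul_nPlus b l x.2, zero_add,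
        vermaMap_mul_nPlus b l]
      rw [← lie_skew]
      exact neg_mem (lie_cartan_mem_nPlus h x.2)

/-- The left ideal that defines the Verma module of highest weight `l`. -/
noncomputable def vermaIdeal :
    Submodule (UniversalEnvelopingAlgebra ℂ L) (UniversalEnvelopingAlgebra ℂ L) where
  -- This is the largest left ideal in the kernel of `vermaMap`. With this description, rather than
  -- one by generators, it is clear that `U(𝔫₋)` embeds in the quotient.
  carrier := {u | ∀ w, vermaMap b l (w * u) = 0}
  add_mem' h h' w := by rw [mul_add, map_add, h, h', add_zero]
  zero_mem' w := by simp
  smul_mem' c u h w := by rw [smul_eq_mul, ← mul_assoc]; exact h _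

theorem vermaMap_eq_zero_of_mem {u : UniversalEnvelopingAlgebra ℂ L} (hu : u ∈ vermaIdeal b l) :
    vermaMap b l u = 0 := by
  simpa using hu 1

theorem uι_mem_vermaIdeal {x : L} (hx : x ∈ nPlus b) : uι L x ∈ vermaIdeal b l :=
  fun w => vermaMap_mul_nPlus b l hx w

theorem uι_sub_mem_vermaIdeal (h : H) :
    uι L h - algebraMap ℂ _ (l h) ∈ vermaIdeal b l := fun w => by
  rw [mul_sub, map_sub, vermaMap_mul_cartan, ← Algebra.commutes, ← Algebra.smul_def, map_smul,
    sub_self]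

theorem isHighestWeight_verma : IsHighestWeight b l ((vermaIdeal b l).mkQ 1) :=
  isHighestWeight_quot _ (fun h => by
    have h1 := vermaMap_eq_zero_of_mem b l h
    have h2 := vermaMap_nMinus b l 1
    rw [map_one, h1] at h2
    have h3 := congr(counit _ $h2)
    simp at h3)
    (fun _ hx => uι_mem_vermaIdeal b l hx) (uι_sub_mem_vermaIdeal b l)

/-- At each weight `l`, both sides are computed as matrix coefficients in the Verma module, where
`c` acts by the scalar `HC(c)(l)`. -/
theorem HC_mul_of_mem_center (u : UniversalEnvelopingAlgebra ℂ L)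
    {c : UniversalEnvelopingAlgebra ℂ L} (hc : c ∈ centerU L) :
    HC b (u * c) = HC b u * HC b c := by
  refine ext_evalAt fun l => ?_
  have hv := isHighestWeight_verma b l
  obtain ⟨f, hf, hfv⟩ := hv.exists_lowestWeightDual
  have key := fun u => evalAt_HC_eq hv.weight hv.singular hf u
  simp only [hfv, mul_one] at key
  rw [map_mul (evalAt l), ← key, ← key u, map_mul (uAct _), Module.End.mul_apply,
    hv.center_apply hc, map_smul, map_smul, smul_eq_mul, mul_comm]

theorem HC_one : HC b 1 = 1 := by
  simpa using HC_mul b 1 1 1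

/-- The restriction of `HC` to the centre, as a homomorphism of algebras. -/
noncomputable def HCCenter : centerU L →ₐ[ℂ] SymmetricAlgebra ℂ H :=
  AlgHom.ofLinearMap ((HC b) ∘ₗ (centerU L).val.toLinearMap) (HC_one b)
    fun x y => HC_mul_of_mem_center b x y.2

theorem HCCenter_apply (z : centerU L) : HCCenter b z = HC b z := rfl

end Verma

end HarishChandra

namespace HarishChandra

/-! ### Singular vectors -/

/-- The power is the symmetrization of the power of `x` in the symmetric algebra, which is nonzero
because a suitable functional does not vanish on `x`. -/
theorem pow_uι_ne_zero {L : Type*} [LieRing L] [LieAlgebra ℂ L] [FiniteDimensional ℂ L] {x : L}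
    (hx : x ≠ 0) (n : ℕ) : uι L x ^ n ≠ 0 := by
  intro h
  have h1 : symmetrize L n (SymmetricAlgebra.ι ℂ L x ^ n) = 0 := by
    have := symmetrize_prod fun _ : Fin n => x
    rw [symU_apply] at this
    simpa [List.ofFn_const, h] using this
  have h2 : SymmetricAlgebra.ι ℂ L x ^ n = 0 := by
    refine eq_zero_of_symmetrize_mem_fil
      (Submodule.pow_mem_pow _ (LinearMap.mem_range_self _ x) n) ?_
    rw [h1]
    exact zero_mem _
  obtain ⟨f, hf⟩ := Module.Projective.exists_dual_ne_zero ℂ hx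
  have h3 := congr(evalAt f $h2)
  rw [map_pow, map_zero] at h3
  exact hf (by simpa [evalAt] using eq_zero_of_pow_eq_zero h3)

theorem uAct_uι_pow {L : Type*} [LieRing L] [LieAlgebra ℂ L] {V : Type*} [AddCommGroup V]
    [Module ℂ V] [LieRingModule L V] [LieModule ℂ L V] (x : L) (n : ℕ) (v : V) :
    uAct V (uι L x ^ n) v = (LieModule.toEnd ℂ L V x ^ n) v := by
  have : uAct V (uι L x) = LieModule.toEnd ℂ L V x := LinearMap.ext (uAct_uι x)
  rw [map_pow, this]

section Singular

variable {L : Type*} [LieRing L] [LieAlgebra ℂ L] [FiniteDimensional ℂ L] [IsSemisimple ℂ L]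
  {H : LieSubalgebra ℂ L} [H.IsCartanSubalgebra] {b : (rootSystem H).Base}
  {V : Type*} [AddCommGroup V] [Module ℂ V] [LieRingModule L V] [LieModule ℂ L V]
  {l : Module.Dual ℂ H} {v : V}

theorem mem_eigenspace_gradeElt (h : ∀ x : H, ⁅(x : L), v⁆ = l x • v) :
    v ∈ (LieModule.toEnd ℂ L V (gradeElt b : L)).eigenspace (l (gradeElt b)) := by
  rw [Module.End.mem_eigenspace_iff, LieModule.toEnd_apply_apply, h]

theorem uAct_nMinus_sub_mem_lowerPart (h : ∀ x : H, ⁅(x : L), v⁆ = l x • v)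
    (a : UniversalEnvelopingAlgebra ℂ (nMinus b)) :
    uAct V (uIncl (nMinus b) a) v - counit (nMinus b) a • v ∈
      lowerPart b V (l (gradeElt b)) 1 := by
  induction a using u_induction with
  | one => simp
  | add _ _ h h' =>
    simp only [map_add, LinearMap.add_apply, add_smul, add_sub_add_comm]
    exact add_mem h h'
  | smul t _ h =>
    simp only [map_smul, LinearMap.smul_apply, smul_assoc, ← smul_sub]
    exact Submodule.smul_mem _ _ h
  | mul x a h' =>
    rw [map_mul (uIncl _), map_mul (uAct V), Module.End.mul_apply, uIncl_uι, uAct_uι,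
      map_mul (counit _), counit_uι, zero_mul, zero_smul, sub_zero]
    refine lie_mem_lowerPart x.2 ?_
    have h0 : v ∈ lowerPart b V (l (gradeElt b)) 0 :=
      Submodule.mem_iSup_of_mem 0 (by simpa using mem_eigenspace_gradeElt (b := b) h)
    have := add_mem (lowerPart_le (Nat.zero_le 1) h')
      (Submodule.smul_mem _ (counit (nMinus b) a) h0)
    rwa [sub_add_cancel] at this

theorem uAct_sub_mem_lowerPart (h₁ : ∀ x : H, ⁅(x : L), v⁆ = l x • v)
    (h₂ : ∀ x ∈ nPlus b, ⁅x, v⁆ = 0) (u : UniversalEnvelopingAlgebra ℂ L) :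
    uAct V u v - evalAt l (HC b u) • v ∈ lowerPart b V (l (gradeElt b)) 1 := by
  induction u using tri_induction b with
  | zero => simp
  | add _ _ h h' =>
    simp only [map_add, LinearMap.add_apply, add_smul, add_sub_add_comm]
    exact add_mem h h'
  | mul a h c =>
    have := Submodule.smul_mem _ (counit (nPlus b) c * evalAt l (uToSym H h))
      (uAct_nMinus_sub_mem_lowerPart (b := b) h₁ a)
    rw [uAct_tri h₁ h₂, HC_mul, map_smul, smul_eq_mul]
    convert this using 1
    rw [smul_sub, smul_smul]
    congr 2
    ring

/-- This version is for singular vectors inside a larger module, such as the vectors `f^(n+1) v` of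
a Verma module; they need not generate it. -/
theorem eq_evalAt_HC_of_uAct_eq_smul (h₁ : ∀ x : H, ⁅(x : L), v⁆ = l x • v)
    (h₂ : ∀ x ∈ nPlus b, ⁅x, v⁆ = 0) (hv : v ≠ 0) {u : UniversalEnvelopingAlgebra ℂ L} {t : ℂ}
    (hu : uAct V u v = t • v) : t = evalAt l (HC b u) := by
  have h := uAct_sub_mem_lowerPart h₁ h₂ u
  rw [hu, ← sub_smul] at h
  have h0 := Submodule.disjoint_def.1 (disjoint_eigenspace_lowerPart _) _
    (Submodule.smul_mem _ _ (mem_eigenspace_gradeElt (b := b) h₁)) h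
  rw [smul_eq_zero, sub_eq_zero] at h0
  exact h0.resolve_right hv

theorem lie_cartan_pow_lie {l χ : H → ℂ} {f : L} (hf : f ∈ rootSpace H χ)
    (h₁ : ∀ x : H, ⁅(x : L), v⁆ = l x • v) (k : ℕ) (x : H) :
    ⁅(x : L), (LieModule.toEnd ℂ L V f ^ k) v⁆ =
      (l x + k * χ x) • (LieModule.toEnd ℂ L V f ^ k) v := by
  induction k with
  | zero => simp [h₁]
  | succ k ih =>
    have h1 : ⁅(x : L), f⁆ = χ x • f := lie_eq_smul_of_mem_rootSpace hf x
    rw [pow_succ', Module.End.mul_apply, LieModule.toEnd_apply_apply, leibniz_lie, ih, lie_smul,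
      h1, smul_lie, ← add_smul]
    congr 1
    push_cast
    ring

/-- Commuting `y` past one `f` gives a vector in the root space of `α - i`. If that space is
nonzero, `α - i` is again a positive root other than `i`, so induction on `k` over all such roots
applies. -/
theorem lie_pow_lie_eq_zero {i : H.root} (hi : i ∈ b.support) {f : L}
    (hf : f ∈ rootSpace H (-(i.1 : H → ℂ))) (h₂ : ∀ x ∈ nPlus b, ⁅x, v⁆ = 0) (k : ℕ)
    {α : H.root} (hα : b.IsPos α) (hαi : α ≠ i) {y : L} (hy : y ∈ rootSpace H α.1) :
    ⁅y, (LieModule.toEnd ℂ L V f ^ k) v⁆ = 0 := by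
  induction k generalizing α y with
  | zero => simpa using h₂ y (mem_nPlus_of_mem_rootSpace b hα hy)
  | succ k ih =>
    rw [pow_succ', Module.End.mul_apply, LieModule.toEnd_apply_apply, leibniz_lie, ih hα hαi hy,
      lie_zero, add_zero]
    have hyf : ⁅y, f⁆ ∈ rootSpace H ((α.1 : H → ℂ) + -(i.1 : H → ℂ)) :=
      LieAlgebra.lie_mem_genWeightSpace_of_mem_genWeightSpace hy hf
    by_cases hb : rootSpace H ((α.1 : H → ℂ) + -(i.1 : H → ℂ)) = ⊥
    · rw [hb, LieSubmodule.mem_bot] at hyf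
      rw [hyf, zero_lie]
    have hne : (α.1 : H → ℂ) + -(i.1 : H → ℂ) ≠ 0 := by
      rw [← sub_eq_add_neg, sub_ne_zero]
      exact fun h => hαi (Subtype.ext (DFunLike.coe_injective h))
    let γ : H.root := ⟨⟨_, hb⟩, by
      simp only [LieSubalgebra.root, Finset.mem_filter]
      exact ⟨Finset.mem_univ _, hne⟩⟩
    have hγ : (rootSystem H).root γ = (rootSystem H).root α - (rootSystem H).root i := by
      ext x; simp [γ, sub_eq_add_neg]
    refine ih (α := γ) (hα.sub hi hγ) ?_ hyf
    rintro hγi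
    rw [hγi] at hγ
    -- If `α - i = i`, then `α` would be twice a root.
    have := IsAddTorsionFree.of_isTorsionFree ℂ (Module.Dual ℂ H)
    refine (rootSystem H).nsmul_notMem_range_root (n := 2) (i := i) ⟨α, ?_⟩
    rw [two_smul, eq_comm, ← eq_sub_iff_add_eq]
    exact hγ

theorem isNonZero_root (i : H.root) : i.1.IsNonZero := by
  have := i.2
  simp only [LieSubalgebra.root, Finset.mem_filter] at this
  exact this.2

theorem exists_eq_smul_of_mem_rootSpace {i : LieModule.Weight ℂ H L} (hi : i.IsNonZero) {e x : L}
    (he : e ∈ rootSpace H i) (he0 : e ≠ 0) (hx : x ∈ rootSpace H i) : ∃ c : ℂ, x = c • e := by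
  obtain ⟨c, hc⟩ := (finrank_eq_one_iff_of_nonzero' ⟨e, he⟩ (by simpa using he0)).mp
    (finrank_rootSpace_eq_one i hi) ⟨x, hx⟩
  exact ⟨c, by simpa using congr(($hc : L)).symm⟩

/-- For the simple root itself this is the `sl₂` formula `e f^(n+1) v = (n+1)(n-n) f^n v`; for other
positive roots it is `lie_pow_lie_eq_zero`. -/
theorem lie_nPlus_pow_lie {i : H.root} (hi : i ∈ b.support) {h e f : L} (t : IsSl2Triple h e f)
    (he : e ∈ rootSpace H i.1) (hf : f ∈ rootSpace H (-(i.1 : H → ℂ)))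
    (h₁ : ∀ x : H, ⁅(x : L), v⁆ = l x • v) (h₂ : ∀ x ∈ nPlus b, ⁅x, v⁆ = 0) {n : ℕ}
    (hn : l (coroot i.1) = n) {x : L} (hx : x ∈ nPlus b) :
    ⁅x, (LieModule.toEnd ℂ L V f ^ (n + 1)) v⁆ = 0 := by
  refine nPlus_induction b (p := fun x => ⁅x, (LieModule.toEnd ℂ L V f ^ (n + 1)) v⁆ = 0)
    (zero_lie _) (fun _ _ h h' => by rw [add_lie, h, h', add_zero])
    (fun t _ h => by rw [smul_lie, h, smul_zero]) (fun α hα x hx => ?_) hx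
  · by_cases hαi : α = i
    · subst hαi
      obtain ⟨c, rfl⟩ := exists_eq_smul_of_mem_rootSpace (isNonZero_root α) he t.e_ne_zero hx
      by_cases hv : v = 0
      · simp [hv]
      have P : t.HasPrimitiveVectorWith v (n : ℂ) :=
        { ne_zero := hv
          lie_h := by rw [t.h_eq_coroot (isNonZero_root α) he hf, h₁, hn]
          lie_e := h₂ e (mem_nPlus_of_mem_rootSpace b hα he) }
      rw [smul_lie, P.lie_e_pow_succ_toEnd_f]
      simp
    · exact lie_pow_lie_eq_zero hi hf h₂ _ hα hαi hx

end Singular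

/-! ### Half the sum of the positive roots -/

section Rho

variable {L : Type*} [LieRing L] [LieAlgebra ℂ L] [FiniteDimensional ℂ L] [IsSemisimple ℂ L]
  {H : LieSubalgebra ℂ L} [H.IsCartanSubalgebra] (b : (rootSystem H).Base)

/-- A simple reflection permutes the positive roots other than its own root, whose sign it changes.
-/
theorem reflection_rho {i : H.root} (hi : i ∈ b.support) :
    (rootSystem H).reflection i (rho b) = rho b - (rootSystem H).root i := by
  classical
  have hpos : b.IsPos i := RootPairing.Base.isPos_of_mem_support hi
  have h1 : ∑ α : H.root with b.IsPos α, (rootSystem H).root α =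
      (rootSystem H).root i + ∑ α ∈ {α : H.root | b.IsPos α}.toFinset.erase i,
        (rootSystem H).root α := by
    rw [Finset.add_sum_erase]
    · congr 1; ext; simp
    · simpa using hpos
  have h2 : ∑ α ∈ {α : H.root | b.IsPos α}.toFinset.erase i,
      (rootSystem H).reflection i ((rootSystem H).root α) =
      ∑ α ∈ {α : H.root | b.IsPos α}.toFinset.erase i, (rootSystem H).root α := by
    refine Finset.sum_nbij' ((rootSystem H).reflectionPerm i) ((rootSystem H).reflectionPerm i)
      ?_ ?_ (by simp) (by simp) (by simp [RootPairing.root_reflectionPerm])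
    all_goals
      intro α hα
      simp only [Finset.mem_erase, Set.mem_toFinset, Set.mem_ofPred_eq] at hα ⊢
      have h3 := hα.2.reflectionPerm hi hα.1
      refine ⟨fun h => ?_, h3⟩
      have h4 : α = (rootSystem H).reflectionPerm i i := by
        rw [← (rootSystem H).reflectionPerm_self i α, h]
      let := (rootSystem H).indexNeg
      have h5 : ¬ b.IsPos (-i) := by rw [RootPairing.Base.IsPos.neg_iff_not]; simpa
      rw [RootPairing.indexNeg_neg, ← h4] at h5
      exact h5 hα.2
  unfold rho
  rw [h1, map_smul, map_add, map_sum, h2, RootPairing.reflection_apply_self]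
  module

theorem rho_coroot {i : H.root} (hi : i ∈ b.support) : rho b (coroot i.1) = 1 := by
  have h := reflection_rho b hi
  rw [RootPairing.reflection_apply, sub_right_inj] at h
  have h2 := congr($h (coroot i.1))
  have h3 : (i.1 : H → ℂ) (coroot i.1) = 2 := root_apply_coroot (isNonZero_root i)
  have h4 : (rho b (coroot i.1)) • ((i.1 : H → ℂ) (coroot i.1)) = (i.1 : H → ℂ) (coroot i.1) := h2
  rw [h3, smul_eq_mul] at h4
  linear_combination h4 / 2

open Classical in
theorem fundamentalWeight_coroot (i j : b.support) :
    fundamentalWeight b i (coroot j.1.1) = if j = i then 1 else 0 := by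
  have : coroot j.1.1 = b.toCoweightBasis j := by simp
  rw [this, fundamentalWeight, Module.Basis.coord_apply, Module.Basis.repr_self,
    Finsupp.single_apply]

theorem rho_eq_sum_fundamentalWeight : rho b = ∑ i, fundamentalWeight b i := by
  refine b.toCoweightBasis.ext fun j => ?_
  have : b.toCoweightBasis j = coroot j.1.1 := by simp
  rw [this, rho_coroot b j.2, LinearMap.sum_apply]
  simp [fundamentalWeight_coroot]

/-- Every reflection is obtained from simple ones by conjugation with simple reflections. The target
is an arbitrary sort so that the lemma also applies to predicates such as `IsWeight V`. -/
theorem weyl_smul_eq_of_simple {α : Sort*} (F : Module.Dual ℂ H → α)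
    (h : ∀ i ∈ b.support, ∀ l, F ((rootSystem H).reflection i l) = F l)
    (w : (rootSystem H).weylGroup) (l : Module.Dual ℂ H) : F (w • l) = F l := by
  have h1 : ∀ i, ∀ l, F ((rootSystem H).reflection i l) = F l := by
    intro i
    induction i using b.induction_reflect with
    | h₀ i hi =>
      intro l
      rw [RootPairing.reflection_reflectionPerm]
      simp [hi]
    | h₁ i hi => exact h i hi
    | h₂ i j hi hj =>
      intro l
      rw [RootPairing.reflection_reflectionPerm]
      simp [hi, h j hj]
  obtain ⟨w, hw⟩ := w
  revert l
  induction hw using RootPairing.weylGroup.induction with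
  | mem i => exact fun l => h1 i l
  | one => intro l; exact congrArg F (one_smul (rootSystem H).weylGroup l)
  | mul w w' hw hw' ih ih' =>
    intro l
    have := mul_smul (⟨w, hw⟩ : (rootSystem H).weylGroup) ⟨w', hw'⟩ l
    exact (congrArg F this).trans ((ih _).trans (ih' l))

end Rho

/-! ### Invariance of the image of the centre -/

section Shift

variable {M : Type*} [AddCommGroup M] [Module ℂ M]

/-- The restriction of a polynomial on `M*` to the line `t ↦ l + t m`. -/
noncomputable def evalLine (l m : Module.Dual ℂ M) :
    SymmetricAlgebra ℂ M →ₐ[ℂ] Polynomial ℂ :=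
  SymmetricAlgebra.lift (Polynomial.CAlgHom.toLinearMap ∘ₗ l +
    LinearMap.mulLeft ℂ Polynomial.X ∘ₗ Polynomial.CAlgHom.toLinearMap ∘ₗ m)

theorem eval_evalLine (l m : Module.Dual ℂ M) (t : ℂ) (p : SymmetricAlgebra ℂ M) :
    (evalLine l m p).eval t = evalAt (l + t • m) p := by
  have : (Polynomial.aeval t).comp (evalLine l m) = evalAt (l + t • m) := by
    ext x
    simp [evalLine, evalAt, mul_comm (m x) t]
  exact congr($this p)

/-- The translation `p ↦ p(· + m)` of polynomials on `M*`. -/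
noncomputable def symShift (m : Module.Dual ℂ M) :
    SymmetricAlgebra ℂ M →ₐ[ℂ] SymmetricAlgebra ℂ M :=
  SymmetricAlgebra.lift (SymmetricAlgebra.ι ℂ M + Algebra.linearMap ℂ _ ∘ₗ m)

theorem evalAt_symShift (l m : Module.Dual ℂ M) (p : SymmetricAlgebra ℂ M) :
    evalAt l (symShift m p) = evalAt (l + m) p := by
  have : (evalAt l).comp (symShift m) = evalAt (l + m) := by
    ext x
    simp [symShift, evalAt]
  exact congr($this p)

end Shift

/-! ### Central characters at weights linked by simple reflections. -/

section Invariance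

variable {L : Type*} [LieRing L] [LieAlgebra ℂ L] [FiniteDimensional ℂ L] [IsSemisimple ℂ L]
  {H : LieSubalgebra ℂ L} [H.IsCartanSubalgebra] (b : (rootSystem H).Base)

theorem mem_weylInvariants {p : SymmetricAlgebra ℂ H} : p ∈ weylInvariants H ↔
    ∀ (w : (rootSystem H).weylGroup) (l : Module.Dual ℂ H), evalAt (w • l) p = evalAt l p := by
  simp [weylInvariants, Algebra.mem_iInf]

theorem mem_dotInvariants {p : SymmetricAlgebra ℂ H} : p ∈ dotInvariants b ↔
    ∀ (w : (rootSystem H).weylGroup) (l : Module.Dual ℂ H),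
      evalAt (dotAct b w l) p = evalAt l p := by
  simp [dotInvariants, Algebra.mem_iInf]

theorem mem_dotInvariants_iff {p : SymmetricAlgebra ℂ H} :
    p ∈ dotInvariants b ↔ symShift (-rho b) p ∈ weylInvariants H := by
  rw [mem_dotInvariants, mem_weylInvariants]
  simp only [evalAt_symShift, dotAct, ← sub_eq_add_neg]
  refine ⟨fun h w l => ?_, fun h w l => ?_⟩
  · simpa using h w (l - rho b)
  · simpa using h w (l + rho b)

theorem mem_weylInvariants_iff {p : SymmetricAlgebra ℂ H} :
    p ∈ weylInvariants H ↔ symShift (rho b) p ∈ dotInvariants b := by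
  rw [mem_dotInvariants_iff, mem_weylInvariants, mem_weylInvariants]
  simp only [evalAt_symShift, neg_add_cancel_right]

/-- The vector `f^(n+1) v` of the Verma module is singular of the weight on the left, and nonzero as
`U(𝔫₋)` embeds. So `z` acts on it by the values of `HC(z)` at both weights. -/
theorem evalAt_HC_center_of_nat {z : UniversalEnvelopingAlgebra ℂ L} (hz : z ∈ centerU L)
    {i : H.root} (hi : i ∈ b.support) (l : Module.Dual ℂ H) {n : ℕ}
    (hn : l (coroot i.1) = n) :
    evalAt (l - (n + 1 : ℂ) • (rootSystem H).root i) (HC b z) = evalAt l (HC b z) := by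
  have hpos : b.IsPos i := RootPairing.Base.isPos_of_mem_support hi
  obtain ⟨h, e, f, t, he, hf⟩ := exists_isSl2Triple_of_weight_isNonZero (isNonZero_root i)
  have hv := isHighestWeight_verma b l
  refine (eq_evalAt_HC_of_uAct_eq_smul
    (v := (LieModule.toEnd ℂ L _ f ^ (n + 1)) ((vermaIdeal b l).mkQ 1)) (fun x => ?_)
    (fun x hx => lie_nPlus_pow_lie hi t he hf hv.weight hv.singular hn hx) ?_
    (hv.center_apply hz _)).symm
  · rw [lie_cartan_pow_lie hf hv.weight]
    congr 1
    simp
    ring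
  · rw [← uAct_uι_pow, uAct_quot, smul_mkQ_one]
    intro h0
    have h1 := vermaMap_eq_zero_of_mem b l ((Submodule.Quotient.mk_eq_zero _).1 h0)
    let f' : nMinus b := ⟨f, mem_nMinus_of_mem_rootSpace b hpos hf⟩
    have h2 : uι L f ^ (n + 1) = uIncl (nMinus b) (uι _ f' ^ (n + 1)) := by
      rw [map_pow, uIncl_uι]
    rw [h2, vermaMap_nMinus] at h1
    exact pow_uι_ne_zero (x := f') (fun h => t.f_ne_zero congr(($h : L))) _ h1

theorem evalAt_HC_center_reflection {z : UniversalEnvelopingAlgebra ℂ L} (hz : z ∈ centerU L)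
    {i : H.root} (hi : i ∈ b.support) (l : Module.Dual ℂ H) :
    evalAt (l - (l (coroot i.1) + 1) • (rootSystem H).root i) (HC b z) = evalAt l (HC b z) := by
  set ω := fundamentalWeight b ⟨i, hi⟩ with hω
  have hωi : ω (coroot i.1) = 1 := by
    simpa using fundamentalWeight_coroot b ⟨i, hi⟩ ⟨i, hi⟩
  -- Since `ω` pairs to one with the coroot, moving `l` to `l + t ω` moves its shifted reflection by
  -- `t (ω - α)`. The two polynomials in `t` agree whenever `l + t ω` pairs to a natural number with
  -- the coroot.
  have key : evalLine (l - (l (coroot i.1) + 1) • (rootSystem H).root i)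
      (ω - (rootSystem H).root i) (HC b z) = evalLine l ω (HC b z) := by
    refine Polynomial.eq_of_infinite_eval_eq _ _ (Set.Infinite.mono ?_
      (Set.infinite_range_of_injective (f := fun n : ℕ => (n : ℂ) - l (coroot i.1)) ?_))
    · rintro _ ⟨n, rfl⟩
      simp only [Set.mem_ofPred_eq, eval_evalLine]
      rw [← evalAt_HC_center_of_nat b hz hi (l + ((n : ℂ) - l (coroot i.1)) • ω) (n := n)
        (by simp [hωi])]
      congr 2
      module
    · intro m n h
      simpa using h
  have := congr(Polynomial.eval 0 $key)
  simpa [eval_evalLine] using this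

theorem HC_mem_dotInvariants {z : UniversalEnvelopingAlgebra ℂ L} (hz : z ∈ centerU L) :
    HC b z ∈ dotInvariants b := by
  rw [mem_dotInvariants_iff, mem_weylInvariants]
  refine weyl_smul_eq_of_simple b (fun l => evalAt l (symShift (-rho b) (HC b z)))
    fun i hi l => ?_
  rw [evalAt_symShift, evalAt_symShift, ← evalAt_HC_center_reflection b hz hi (l + -rho b)]
  congr 2
  have : (rootSystem H).reflection i l = l - l (coroot i.1) • (rootSystem H).root i := by
    rw [RootPairing.reflection_apply]; rfl
  rw [this]
  -- Here `ρ(α^∨) = 1` cancels the one in the shifted reflection.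
  simp only [LinearMap.add_apply, LinearMap.neg_apply, rho_coroot b hi]
  module

end Invariance

end HarishChandra

namespace HarishChandra

/-! ### Injectivity of the restriction map on invariants -/

section BiGrade

theorem symMap_ι {M N : Type*} [AddCommGroup M] [Module ℂ M] [AddCommGroup N] [Module ℂ N]
    (p : M →ₗ[ℂ] N) (x : M) :
    symMap p (SymmetricAlgebra.ι ℂ M x) = SymmetricAlgebra.ι ℂ N (p x) := by
  simp [symMap]

theorem symMap_symMap {M N K : Type*} [AddCommGroup M] [Module ℂ M] [AddCommGroup N] [Module ℂ N]
    [AddCommGroup K] [Module ℂ K] (p : M →ₗ[ℂ] N) (q : N →ₗ[ℂ] K) (s : SymmetricAlgebra ℂ M) :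
    symMap q (symMap p s) = symMap (q ∘ₗ p) s := by
  have : (symMap q).comp (symMap p) = symMap (q ∘ₗ p) := by
    ext x
    simp [symMap_ι]
  exact congr($this s)

open Polynomial

variable {A : Type*} [CommRing A] [Algebra ℂ A]

/-- The action of a derivation on the coefficients of polynomials. -/
noncomputable def coeffDer (D : Derivation ℂ A A) : Derivation ℂ A[X] A[X] :=
  Derivation.mk' (((PolynomialModule.equivPolynomialSelf (R := A)).restrictScalars ℂ).toLinearMap ∘ₗ
    D.mapCoeffs.toLinearMap) (by
    intro p q
    ext n
    rw [smul_eq_mul, smul_eq_mul, mul_comm q, coeff_add, coeff_mul, coeff_mul,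
      ← Finset.sum_add_distrib]
    change D ((p * q).coeff n) = ∑ x ∈ Finset.HasAntidiagonal.antidiagonal n,
      (p.coeff x.1 * D (q.coeff x.2) + D (p.coeff x.1) * q.coeff x.2)
    rw [coeff_mul, map_sum]
    refine Finset.sum_congr rfl fun x _ => ?_
    rw [Derivation.leibniz, smul_eq_mul, smul_eq_mul, mul_comm (q.coeff _)])

theorem coeff_coeffDer (D : Derivation ℂ A A) (p : A[X]) (n : ℕ) :
    (coeffDer D p).coeff n = D (p.coeff n) := rfl

theorem coeffDer_C (D : Derivation ℂ A A) (a : A) : coeffDer D (C a) = C (D a) := by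
  ext n
  rw [coeff_coeffDer, coeff_C, coeff_C]
  split_ifs <;> simp

theorem coeffDer_X (D : Derivation ℂ A A) : coeffDer D (X : A[X]) = 0 := by
  ext n
  rw [coeff_coeffDer, coeff_X]
  split_ifs <;> simp

variable {M : Type*} [AddCommGroup M] [Module ℂ M] (Q P : M →ₗ[ℂ] M)

/-- The algebra map `S(M) → S(M)[X]`, `x ↦ Q x + P x X`; for complementary projections `Q`, `P` it
records the degree in the image of `P`. -/
noncomputable def biGrade : SymmetricAlgebra ℂ M →ₐ[ℂ] (SymmetricAlgebra ℂ M)[X] :=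
  SymmetricAlgebra.lift ((CAlgHom (R := ℂ) (A := SymmetricAlgebra ℂ M)).toLinearMap ∘ₗ
      SymmetricAlgebra.ι ℂ M ∘ₗ Q +
    LinearMap.mulLeft ℂ X ∘ₗ (CAlgHom (R := ℂ) (A := SymmetricAlgebra ℂ M)).toLinearMap ∘ₗ
      SymmetricAlgebra.ι ℂ M ∘ₗ P)

theorem biGrade_ι (x : M) : biGrade Q P (SymmetricAlgebra.ι ℂ M x) =
    C (SymmetricAlgebra.ι ℂ M (Q x)) + X * C (SymmetricAlgebra.ι ℂ M (P x)) := by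
  simp [biGrade]

variable {Q P}

theorem eval_one_biGrade (h : Q + P = LinearMap.id) (s : SymmetricAlgebra ℂ M) :
    (biGrade Q P s).eval 1 = s := by
  induction s using SymmetricAlgebra.induction with
  | algebraMap t => simp [biGrade, Polynomial.algebraMap_apply]
  | ι x =>
    rw [biGrade_ι]
    simp only [eval_add, eval_mul, eval_C, eval_X, one_mul, ← map_add]
    exact congr(SymmetricAlgebra.ι ℂ M ($h x))
  | mul _ _ h h' => rw [map_mul, eval_mul, h, h']
  | add _ _ h h' => rw [map_add, eval_add, h, h']

theorem coeff_zero_biGrade (s : SymmetricAlgebra ℂ M) :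
    (biGrade Q P s).coeff 0 = symMap Q s := by
  rw [coeff_zero_eq_eval_zero]
  induction s using SymmetricAlgebra.induction with
  | algebraMap t => simp [biGrade, Polynomial.algebraMap_apply, symMap]
  | ι x =>
    rw [biGrade_ι]
    simp [symMap]
  | mul _ _ h h' => rw [map_mul, eval_mul, h, h', map_mul]
  | add _ _ h h' => rw [map_add, eval_add, h, h', map_add]

/-- The derivation extending the projection `P` is the Euler operator in the directions of its
image, so it corresponds to `X d/dX`. -/
theorem coeffDer_symDer_biGrade (hPQ : P ∘ₗ Q = 0) (hPP : P ∘ₗ P = P) (s : SymmetricAlgebra ℂ M) :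
    coeffDer (symDer P) (biGrade Q P s) = X * derivative (biGrade Q P s) := by
  induction s using SymmetricAlgebra.induction with
  | algebraMap t => simp [Polynomial.algebraMap_apply, coeffDer_C]
  | ι x =>
    have h1 : P (Q x) = 0 := congr($hPQ x)
    have h2 : P (P x) = P x := congr($hPP x)
    rw [biGrade_ι]
    simp [coeffDer_C, coeffDer_X, symDer_ι, h1, h2]
  | mul _ _ h h' =>
    rw [map_mul, Derivation.leibniz, h, h', derivative_mul]
    simp only [smul_eq_mul]
    ring
  | add _ _ h h' => rw [map_add, map_add, h, h', derivative_add, mul_add]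

theorem symDer_coeff_biGrade (hPQ : P ∘ₗ Q = 0) (hPP : P ∘ₗ P = P) (s : SymmetricAlgebra ℂ M)
    (k : ℕ) : symDer P ((biGrade Q P s).coeff k) = k * (biGrade Q P s).coeff k := by
  rw [← coeff_coeffDer, coeffDer_symDer_biGrade hPQ hPP]
  cases k with
  | zero => simp
  | succ k => rw [coeff_X_mul, coeff_derivative, mul_comm]; push_cast; rfl

/-- Of the four blocks of `A`, `Q A P` lowers the degree in the image of `P` by one, the diagonal
blocks preserve it and `P A Q` raises it. The factor `X` on the left avoids a negative power. -/
theorem biGrade_symDer (h : Q + P = LinearMap.id) (hPQ : P ∘ₗ Q = 0) (hQP : Q ∘ₗ P = 0)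
    (A : M →ₗ[ℂ] M) (s : SymmetricAlgebra ℂ M) :
    X * biGrade Q P (symDer A s) = coeffDer (symDer (Q ∘ₗ A ∘ₗ P)) (biGrade Q P s) +
      X * coeffDer (symDer (Q ∘ₗ A ∘ₗ Q + P ∘ₗ A ∘ₗ P)) (biGrade Q P s) +
      X ^ 2 * coeffDer (symDer (P ∘ₗ A ∘ₗ Q)) (biGrade Q P s) := by
  induction s using SymmetricAlgebra.induction with
  | algebraMap t => simp [Polynomial.algebraMap_apply, coeffDer_C]
  | ι x =>
    have e : ∀ x, Q x + P x = x := fun x => congr($h x)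
    have h1 : P (Q x) = 0 := congr($hPQ x)
    have h2 : Q (P x) = 0 := congr($hQP x)
    have h3 : P (P x) = P x := by have := e (P x); rwa [h2, zero_add] at this
    have h4 : Q (Q x) = Q x := by have := e (Q x); rwa [h1, add_zero] at this
    rw [biGrade_ι, symDer_ι, biGrade_ι]
    conv_lhs => rw [← e x]
    simp [coeffDer_C, coeffDer_X, symDer_ι, h1, h2, h3, h4]
    ring
  | mul a c h h' =>
    simp only [map_mul, Derivation.leibniz, map_add, smul_eq_mul, mul_add] at *
    linear_combination biGrade Q P a * h' + biGrade Q P c * h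
  | add _ _ h h' => simp only [map_add, mul_add] at *; linear_combination h + h'

/-- In the lowest occurring degree only the lowering block contributes. -/
theorem symDer_coeff_biGrade_eq_zero (h : Q + P = LinearMap.id) (hPQ : P ∘ₗ Q = 0)
    (hQP : Q ∘ₗ P = 0) {A : M →ₗ[ℂ] M} {s : SymmetricAlgebra ℂ M} (hs : symDer A s = 0) {k : ℕ}
    (hk : ∀ j < k, (biGrade Q P s).coeff j = 0) :
    symDer (Q ∘ₗ A ∘ₗ P) ((biGrade Q P s).coeff k) = 0 := by
  have := congr(($(biGrade_symDer h hPQ hQP A s)).coeff k)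
  rw [hs, map_zero, mul_zero, coeff_zero, coeff_add, coeff_add, coeff_coeffDer] at this
  have h1 : (X * coeffDer (symDer (Q ∘ₗ A ∘ₗ Q + P ∘ₗ A ∘ₗ P)) (biGrade Q P s)).coeff k = 0 := by
    cases k with
    | zero => simp
    | succ k => rw [coeff_X_mul, coeff_coeffDer, hk k k.lt_succ_self, map_zero]
  have h2 : (X ^ 2 * coeffDer (symDer (P ∘ₗ A ∘ₗ Q)) (biGrade Q P s)).coeff k = 0 := by
    rw [coeff_X_pow_mul']
    split_ifs
    · rw [coeff_coeffDer, hk _ (by omega), map_zero]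
    · rfl
  rw [h1, h2, add_zero, add_zero] at this
  exact this.symm

/-- The derivation attached to `c ⊗ y` is `y` times the directional derivative along `c`, so both
sides are `x y` times that derivative. -/
theorem ι_mul_symDer (c : Module.Dual ℂ M) (x y : M) (s : SymmetricAlgebra ℂ M) :
    SymmetricAlgebra.ι ℂ M x * symDer (c.smulRight y) s =
      SymmetricAlgebra.ι ℂ M y * symDer (c.smulRight x) s := by
  induction s using SymmetricAlgebra.induction with
  | algebraMap t => simp
  | ι z => rw [symDer_ι, symDer_ι]; simp [mul_comm]
  | mul a c h h' =>
    simp only [Derivation.leibniz, smul_eq_mul]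
    linear_combination a * h' + c * h
  | add _ _ h h' => simp only [map_add, mul_add, h, h']

theorem symDer_add (D E : M →ₗ[ℂ] M) (s : SymmetricAlgebra ℂ M) :
    symDer (D + E) s = symDer D s + symDer E s := by
  induction s using SymmetricAlgebra.induction with
  | algebraMap t => simp
  | ι z => simp [symDer_ι]
  | mul _ _ h h' => simp only [Derivation.leibniz, smul_eq_mul, h, h']; ring
  | add _ _ h h' => simp only [map_add, h, h']; abel

theorem symDer_smul (t : ℂ) (D : M →ₗ[ℂ] M) (s : SymmetricAlgebra ℂ M) :
    symDer (t • D) s = t • symDer D s := by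
  induction s using SymmetricAlgebra.induction with
  | algebraMap t => simp
  | ι z => simp [symDer_ι]
  | mul _ _ h h' => simp only [Derivation.leibniz, smul_eq_mul, h, h', mul_smul_comm, smul_add]
  | add _ _ h h' => simp only [map_add, h, h', smul_add]

end BiGrade

/-! ### Rank one derivations from root vectors and the Killing form. -/

section ResInjective

variable {L : Type*} [LieRing L] [LieAlgebra ℂ L] [FiniteDimensional ℂ L] [IsSemisimple ℂ L]
  {H : LieSubalgebra ℂ L} [H.IsCartanSubalgebra] (b : (rootSystem H).Base)

/-- The projection onto `𝔥` along `𝔫₋ ⊕ 𝔫₊`, as an endomorphism of `𝔤`. -/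
noncomputable def projH : L →ₗ[ℂ] L := H.toSubmodule.subtype ∘ₗ cartanProj b

/-- The projection onto `𝔫₋ ⊕ 𝔫₊` along `𝔥`. -/
noncomputable def projN : L →ₗ[ℂ] L := LinearMap.id - projH b

theorem projH_add_projN : projH b + projN b = LinearMap.id := by simp [projN]

theorem projH_cartan (h : H) : projH b h = h :=
  congrArg Subtype.val (cartanProj_cartan b h)

theorem projH_comp_self : projH b ∘ₗ projH b = projH b :=
  LinearMap.ext fun x => projH_cartan b (cartanProj b x)

theorem projN_comp_projH : projN b ∘ₗ projH b = 0 := by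
  rw [projN, LinearMap.sub_comp, projH_comp_self, LinearMap.id_comp, sub_self]

theorem projH_comp_projN : projH b ∘ₗ projN b = 0 := by
  rw [projN, LinearMap.comp_sub, projH_comp_self, LinearMap.comp_id, sub_self]

theorem projN_mem (x : L) :
    projN b x ∈ (nMinus b).toSubmodule ⊔ (nPlus b).toSubmodule := by
  have h : cartanProj b (projN b x) = 0 :=
    Subtype.ext (congr($(projH_comp_projN b) x))
  exact (Submodule.projectionOnto_apply_eq_zero_iff (isCompl_cartan b)).1 h

theorem killingForm_cartan_root (h : H) {χ : H → ℂ} (hχ : χ ≠ 0) {x : L}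
    (hx : x ∈ rootSpace H χ) : killingForm ℂ L h x = 0 := by
  refine killingForm_apply_eq_zero_of_mem_rootSpace_of_add_ne_zero ℂ L H (α := 0) ?_ hx (by simpa)
  have := h.2
  rw [← LieSubalgebra.mem_toLieSubmodule] at this
  rwa [rootSpace_zero_eq]

theorem killingForm_cartan_projN (h : H) (x : L) : killingForm ℂ L h (projN b x) = 0 := by
  have key : (nMinus b).toSubmodule ⊔ (nPlus b).toSubmodule ≤
      LinearMap.ker (killingForm ℂ L h) := by
    rw [nMinus_eq_span, nPlus_eq_span, sup_le_iff, Submodule.span_le, Submodule.span_le]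
    constructor
    · rintro x ⟨α, -, hx⟩
      exact killingForm_cartan_root h (neg_ne_zero.2 (isNonZero_root α)) hx
    · rintro x ⟨α, -, hx⟩
      exact killingForm_cartan_root h (isNonZero_root α) hx
  exact key (projN_mem b x)

theorem killingForm_projH (x : L) (h : H) :
    killingForm ℂ L (projH b x) h = killingForm ℂ L x h := by
  have h1 : projH b x + projN b x = x := congr($(projH_add_projN b) x)
  conv_rhs => rw [← h1]
  rw [map_add, LinearMap.add_apply, LieModule.traceForm_comm ℂ L L (projN b x),
    killingForm_cartan_projN, add_zero]

/-- Pairing with `h ∈ 𝔥`, invariance of the Killing form `κ` gives `κ(h, [e, y]) = κ([h, e], y) =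
α(h) κ(e, y)`. So the lowering block of `ad e` has rank one. -/
theorem projH_lie_projN (α : LieModule.Weight ℂ H L) {e : L} (he : e ∈ rootSpace H α) (y : L) :
    projH b ⁅e, projN b y⁆ =
      killingForm ℂ L e (projN b y) • ((cartanEquivDual H).symm α.toLinear : L) := by
  suffices cartanProj b ⁅e, projN b y⁆ =
      killingForm ℂ L e (projN b y) • (cartanEquivDual H).symm α.toLinear from congr(($this : L))
  apply (cartanEquivDual H).injective
  rw [map_smul, LinearEquiv.apply_symm_apply]
  ext h
  have h1 : cartanEquivDual H (cartanProj b ⁅e, projN b y⁆) h =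
      killingForm ℂ L (projH b ⁅e, projN b y⁆) h := rfl
  have h2 : ⁅(h : L), e⁆ = α h • e := lie_eq_smul_of_mem_rootSpace he h
  rw [h1, killingForm_projH, ← lie_skew, map_neg, LinearMap.neg_apply,
    LieModule.traceForm_apply_lie_apply, ← lie_skew, h2, map_neg, neg_neg, map_smul,
    LieModule.traceForm_comm, LinearMap.smul_apply, LieModule.Weight.toLinear_apply, smul_eq_mul,
    smul_eq_mul, mul_comm]

theorem symMap_projH_eq_zero {s : SymmetricAlgebra ℂ L} (h : res b s = 0) :
    symMap (projH b) s = 0 := by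
  have h1 := symMap_symMap (cartanProj b) H.toSubmodule.subtype s
  have h2 : symMap (cartanProj b) s = 0 := h
  rw [h2, map_zero] at h1
  exact h1.symm

/-- The symmetric algebra is a domain, so `t` can be cancelled in `ι_mul_symDer` and the vanishing
depends only on the form `c`. -/
theorem symDer_smulRight_projN {s : SymmetricAlgebra ℂ L} {t : L} (ht : t ≠ 0)
    {c : Module.Dual ℂ L} (h : symDer (c.smulRight t) s = 0) (y : L) :
    symDer (c.smulRight y) s = 0 := by
  have h1 := ι_mul_symDer c t y s
  rw [h, mul_zero, mul_eq_zero] at h1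
  refine h1.resolve_left fun h2 => ht ?_
  by_contra h3
  obtain ⟨f, hf⟩ := Module.Projective.exists_dual_ne_zero ℂ h3
  have h4 := congr(evalAt f $h2)
  exact hf (by simpa [evalAt] using h4)

/-- The lowering blocks of root vectors are rank one operators. Their forms `κ(e, ·)`, restricted to
`𝔫₋ ⊕ 𝔫₊`, may be paired with any vector, and by nondegeneracy the projection is a sum of such rank
one operators. -/
theorem symDer_projN_eq_zero {s : SymmetricAlgebra ℂ L}
    (h : ∀ x : L, symDer (projH b ∘ₗ LieModule.toEnd ℂ L L x ∘ₗ projN b) s = 0) :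
    symDer (projN b) s = 0 := by
  have key : ∀ x y : L, symDer ((killingForm ℂ L x ∘ₗ projN b).smulRight y) s = 0 := by
    intro x y
    let F : L →ₗ[ℂ] SymmetricAlgebra ℂ L :=
      { toFun := fun x => symDer ((killingForm ℂ L x ∘ₗ projN b).smulRight y) s
        map_add' := fun x x' => by
          rw [← symDer_add]; congr 2; ext z; simp [add_smul]
        map_smul' := fun t x => by
          rw [RingHom.id_apply, ← symDer_smul]; congr 2; ext z; simp [mul_smul] }
    have hroot : ∀ α : LieModule.Weight ℂ H L, α.IsNonZero → ∀ e ∈ rootSpace H α, F e = 0 := by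
      intro α hα e he
      refine symDer_smulRight_projN (t := ((cartanEquivDual H).symm α.toLinear : L)) ?_ ?_ y
      · intro h0
        have h1 : (cartanEquivDual H).symm α.toLinear = 0 := Subtype.ext h0
        rw [LinearEquiv.map_eq_zero_iff] at h1
        exact hα (funext fun x => congr($h1 x))
      · rw [← h e]
        congr 2
        ext z
        exact (projH_lie_projN b α he z).symm
    have hF : (⊤ : Submodule ℂ L) ≤ LinearMap.ker F := by
      rw [← nMinus_sup_cartan_sup_nPlus b, nMinus_eq_span, nPlus_eq_span]
      refine sup_le (sup_le (Submodule.span_le.2 ?_) ?_) (Submodule.span_le.2 ?_)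
      · rintro x ⟨α, -, hx⟩
        exact hroot (-α.1) (isNonZero_root α).neg x hx
      -- For `x` in `𝔥` the form itself is zero, since `𝔥` is orthogonal to the root spaces.
      · intro x hx
        have h1 : (killingForm ℂ L x ∘ₗ projN b).smulRight y = 0 := by
          ext z
          have := killingForm_cartan_projN b ⟨x, hx⟩ z
          simp [this]
        change symDer ((killingForm ℂ L x ∘ₗ projN b).smulRight y) s = 0
        rw [h1, ← zero_smul ℂ (0 : L →ₗ[ℂ] L), symDer_smul, zero_smul]
      · rintro x ⟨α, -, hx⟩
        exact hroot α.1 (isNonZero_root α) x hx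
    exact hF (Submodule.mem_top (x := x))
  let β := Module.finBasis ℂ L
  have hN : projN b = ∑ i, (β.coord i ∘ₗ projN b).smulRight (β i) := by
    ext x
    simp [LinearMap.sum_apply, β.sum_repr]
  have hsum : ∀ (S : Finset (Fin (Module.finrank ℂ L))),
      symDer (∑ i ∈ S, (β.coord i ∘ₗ projN b).smulRight (β i)) s = 0 := by
    intro S
    classical
    induction S using Finset.induction_on with
    | empty => rw [Finset.sum_empty, ← zero_smul ℂ (0 : L →ₗ[ℂ] L), symDer_smul, zero_smul]
    | insert i S hi ih =>
      rw [Finset.sum_insert hi, symDer_add, ih, add_zero]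
      obtain ⟨x, hx⟩ := ((killingForm ℂ L).toDual
        (LieAlgebra.IsKilling.killingForm_nondegenerate ℂ L)).surjective (β.coord i)
      rw [← hx]
      exact key x (β i)
  rw [hN]
  exact hsum _

/-- Let `k` be the lowest degree of `s` in `𝔫₋ ⊕ 𝔫₊`. The component of degree zero is the
restriction, so `k > 0`; but the Euler operator multiplies the component of degree `k` by `k` and
also kills it. -/
theorem eq_zero_of_res_eq_zero {s : SymmetricAlgebra ℂ L} (hs : s ∈ symInvariants L)
    (h : res b s = 0) : s = 0 := by
  have hF : biGrade (projH b) (projN b) s = 0 := by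
    by_contra hne
    have hex : ∃ k, (biGrade (projH b) (projN b) s).coeff k ≠ 0 := by
      by_contra! hall
      exact hne (Polynomial.ext fun k => by simpa using hall k)
    classical
    obtain ⟨k, hk, hmin⟩ : ∃ k, (biGrade (projH b) (projN b) s).coeff k ≠ 0 ∧
        ∀ j < k, (biGrade (projH b) (projN b) s).coeff j = 0 :=
      ⟨Nat.find hex, Nat.find_spec hex, fun j hj => by simpa using Nat.find_min hex hj⟩
    have h0 : k ≠ 0 := by
      rintro rfl
      exact hk (by rw [coeff_zero_biGrade, symMap_projH_eq_zero b h])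
    have h1 := symDer_projN_eq_zero b fun x => symDer_coeff_biGrade_eq_zero (projH_add_projN b)
      (projN_comp_projH b) (projH_comp_projN b) (mem_symInvariants.1 hs x) hmin
    rw [symDer_coeff_biGrade (projN_comp_projH b) ?_, mul_eq_zero] at h1
    · refine h1.elim (fun h => h0 ?_) hk
      have : CharZero (SymmetricAlgebra ℂ L) := Algebra.charZero_of_charZero ℂ _
      exact_mod_cast h
    · rw [projN, LinearMap.comp_sub, ← projN, projN_comp_projH, LinearMap.comp_id, sub_zero]
  rw [← eval_one_biGrade (projH_add_projN b) s, hF, Polynomial.eval_zero]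

end ResInjective

end HarishChandra

namespace HarishChandra

/-! ### A criterion for finite dimensionality -/

section Finiteness

variable {L : Type*} [LieRing L] [LieAlgebra ℂ L] [FiniteDimensional ℂ L]
  {V : Type*} [AddCommGroup V] [Module ℂ V] [LieRingModule L V] [LieModule ℂ L V]

theorem finite_fil (n : ℕ) : (fil (uι L) n).FG := by
  refine Submodule.fg_iSup _ fun i => ?_
  rw [piece]
  exact (Submodule.FG.of_finite (N := LinearMap.range (uι L))).pow _

/-- The vectors `u v` with `u` of degree less than `n`. -/
noncomputable def filSpan (L : Type*) [LieRing L] [LieAlgebra ℂ L] {V : Type*} [AddCommGroup V]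
    [Module ℂ V] [LieRingModule L V] [LieModule ℂ L V] (v : V) (n : ℕ) : Submodule ℂ V :=
  (fil (uι L) n).map (LinearMap.applyₗ v ∘ₗ (uAct (L := L) V).toLinearMap)

theorem uAct_mem_filSpan {u : UniversalEnvelopingAlgebra ℂ L} {n : ℕ} (hu : u ∈ fil (uι L) n)
    (v : V) : uAct V u v ∈ filSpan L v n := ⟨u, hu, rfl⟩

theorem exists_le_count {α : Type*} [DecidableEq α] {S : Finset α} {l : List α}
    (hl : ∀ x ∈ l, x ∈ S) {k : ℕ} (hk : S.card * k < l.length) : ∃ x ∈ S, k ≤ l.count x := by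
  by_contra! h
  have h1 : l.length = ∑ x ∈ l.toFinset, l.count x := (List.sum_toFinset_count_eq_length l).symm
  have h2 : ∑ x ∈ l.toFinset, l.count x ≤ ∑ x ∈ S, l.count x :=
    Finset.sum_le_sum_of_subset fun x hx => hl x (by simpa using hx)
  have h3 := Finset.sum_le_card_nsmul S (fun x => l.count x) k fun x hx => (h x hx).le
  rw [smul_eq_mul] at h3
  omega

theorem uAct_pow_mem_filSpan_of_le {v : V} {x : L} {m n : ℕ} (hmn : m ≤ n)
    (h : uAct V (uι L x ^ m) v ∈ filSpan L v m) : uAct V (uι L x ^ n) v ∈ filSpan L v n := by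
  obtain ⟨u, hu, h⟩ := h
  obtain ⟨k, rfl⟩ := Nat.exists_eq_add_of_le' hmn
  refine ⟨uι L x ^ k * u, piece_mul_mem_fil _ ?_ hu, ?_⟩
  · exact Submodule.pow_mem_pow _ (LinearMap.mem_range_self _ x) k
  · have h' : uAct V u v = uAct V (uι L x ^ m) v := h
    change uAct V (uι L x ^ k * u) v = _
    rw [map_mul, Module.End.mul_apply, h', pow_add, map_mul, Module.End.mul_apply]

/-- A long word in finitely many letters contains some letter `x` at least `K` times. These copies
can be moved next to `v` modulo lower degree, and `x^K v` itself comes from lower degree, so the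
filtration of `V` becomes stationary. -/
theorem finiteDimensional_of_pow_mem_filSpan {v : V}
    (hv : ∀ w : V, ∃ u : UniversalEnvelopingAlgebra ℂ L, uAct V u v = w) {s : Set L}
    (hs : Submodule.span ℂ s = ⊤)
    (h : ∀ x ∈ s, ∃ k, uAct V (uι L x ^ k) v ∈ filSpan L v k) : FiniteDimensional ℂ V := by
  classical
  let β := Module.Basis.ofSpan hs.ge
  have := Module.Finite.finite_basis β
  have := Fintype.ofFinite ((linearIndepOn_empty ℂ id).extend (Set.empty_subset s))
  let S : Finset L := Finset.univ.image β
  have hS : Submodule.span ℂ (S : Set L) = ⊤ := by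
    rw [Finset.coe_image, Finset.coe_univ, Set.image_univ]
    exact β.span_eq
  have hSs : ∀ x ∈ S, ∃ k, uAct V (uι L x ^ k) v ∈ filSpan L v k := by
    intro x hx
    refine h x (Module.Basis.ofSpan_subset hs.ge ?_)
    obtain ⟨i, -, rfl⟩ := Finset.mem_image.1 hx
    exact Set.mem_range_self i
  choose! k hk using hSs
  let K := S.sup k
  have hK : ∀ x ∈ S, uAct V (uι L x ^ K) v ∈ filSpan L v K := fun x hx =>
    uAct_pow_mem_filSpan_of_le (Finset.le_sup hx) (hk x hx)
  set N := S.card * K + 1 with hN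
  have step : ∀ n, N ≤ n → filSpan L v (n + 1) ≤ filSpan L v n := by
    intro n hn
    rw [filSpan, fil_succ, Submodule.map_sup, sup_le_iff]
    refine ⟨le_rfl, ?_⟩
    rintro _ ⟨u, hu, rfl⟩
    change uAct V u v ∈ filSpan L v n
    refine piece_induction _ hS (p := fun u => uAct V u v ∈ filSpan L v n) (by simp)
      (fun _ _ h h' => by rw [map_add]; exact add_mem h h')
      (fun t _ h => by rw [map_smul]; exact Submodule.smul_mem _ _ h) (fun l hl hlS => ?_) hu
    obtain ⟨x, hx, hxl⟩ := exists_le_count (S := S) hlS (k := K) (by omega)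
    obtain ⟨l', hl'⟩ := (List.replicate_sublist_iff.2 hxl).exists_perm_append
    have hperm := hl'.trans List.perm_append_comm
    have hlen : l'.length + K = n := by
      rw [← hl, hperm.length_eq]; simp
    have h1 := uι_perm hperm
    rw [hl] at h1
    have h2 := uAct_mem_filSpan h1 v
    rw [map_sub, LinearMap.sub_apply] at h2
    rw [← sub_add_cancel (uAct V _ v)
      (uAct V ((l' ++ List.replicate K x).map (uι L)).prod v)]
    refine add_mem h2 ?_
    obtain ⟨u, hu, h⟩ := hK x hx
    have h' : uAct V u v = uAct V (uι L x ^ K) v := h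
    rw [List.map_append, List.prod_append, List.map_replicate, List.prod_replicate, map_mul,
      Module.End.mul_apply, ← h', ← Module.End.mul_apply, ← map_mul]
    refine uAct_mem_filSpan ?_ v
    rw [← hlen]
    exact piece_mul_mem_fil _ (prod_mem_piece _ l') hu
  have hall : ∀ n, filSpan L v n ≤ filSpan L v N := by
    intro n
    rcases le_total n N with h | h
    · exact Submodule.map_mono (fil_mono _ h)
    · induction n, h using Nat.le_induction with
      | base => exact le_rfl
      | succ n hn ih => exact (step n hn).trans ih
  have htop : filSpan L v N = ⊤ := by
    rw [eq_top_iff]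
    rintro w -
    obtain ⟨u, rfl⟩ := hv w
    obtain ⟨n, hn⟩ := exists_mem_fil _ (adjoin_range_uι L) u
    exact hall n (uAct_mem_filSpan hn v)
  rw [FiniteDimensional, Module.finite_def, ← htop]
  exact (finite_fil N).map _

end Finiteness

/-! ### Weights of integrable modules -/

section Integrable

variable {L : Type*} [LieRing L] [LieAlgebra ℂ L] {V : Type*} [AddCommGroup V] [Module ℂ V]
  [LieRingModule L V] [LieModule ℂ L V]

/-- The last nonzero `e^a w` is primitive, and nilpotency of `f` forces its weight to be a natural
number `n`. For `a ≤ n`, `f^(n-a) e^a w` has weight `-c`; the condition excludes truncated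
subtraction. -/
theorem exists_pow_lie_ne_zero {h e f : L} (t : IsSl2Triple h e f) {w : V} (hw : w ≠ 0) {c : ℂ}
    (hc : ⁅h, w⁆ = c • w) (he : ∃ k, (LieModule.toEnd ℂ L V e ^ k) w = 0)
    (hf : ∀ w : V, ∃ k, (LieModule.toEnd ℂ L V f ^ k) w = 0) :
    ∃ a n : ℕ, c = n - 2 * a ∧ (a ≤ n →
      (LieModule.toEnd ℂ L V f ^ (n - a)) ((LieModule.toEnd ℂ L V e ^ a) w) ≠ 0) := by
  obtain ⟨a, ha, ha'⟩ := Nat.exists_not_and_succ_of_not_zero_of_exists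
    (p := fun k => (LieModule.toEnd ℂ L V e ^ k) w = 0) (by simpa using hw) he
  have P : t.HasPrimitiveVectorWith ((LieModule.toEnd ℂ L V e ^ a) w) (c + 2 * a) :=
    { ne_zero := ha
      lie_h := t.lie_h_pow_toEnd_e hc a
      lie_e := by
        rw [pow_succ', Module.End.mul_apply, LieModule.toEnd_apply_apply] at ha'
        exact ha' }
  obtain ⟨n, hn, hn'⟩ := Nat.exists_not_and_succ_of_not_zero_of_exists
    (p := fun k => (LieModule.toEnd ℂ L V f ^ k) ((LieModule.toEnd ℂ L V e ^ a) w) = 0)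
    (by simpa using ha) (hf _)
  have hcn : c + 2 * a = n := by
    have := P.lie_e_pow_succ_toEnd_f n
    rw [hn', lie_zero, eq_comm, smul_eq_zero_iff_left hn, mul_eq_zero, sub_eq_zero] at this
    exact this.resolve_left (Nat.cast_add_one_ne_zero n)
  exact ⟨a, n, by linear_combination hcn, fun h =>
    P.pow_toEnd_f_ne_zero_of_eq_nat hcn (Nat.sub_le n a)⟩

end Integrable

/-! ### Weyl symmetry of weights and construction of finite-dimensional modules. -/

section Weights

variable {L : Type*} [LieRing L] [LieAlgebra ℂ L] [FiniteDimensional ℂ L] [IsSemisimple ℂ L]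
  {H : LieSubalgebra ℂ L} [H.IsCartanSubalgebra] {b : (rootSystem H).Base}
  {V : Type*} [AddCommGroup V] [Module ℂ V] [LieRingModule L V] [LieModule ℂ L V]
  {l : Module.Dual ℂ H} {v : V}

theorem uAct_mem_lowerPart (h₁ : ∀ x : H, ⁅(x : L), v⁆ = l x • v)
    (h₂ : ∀ x ∈ nPlus b, ⁅x, v⁆ = 0) (u : UniversalEnvelopingAlgebra ℂ L) :
    uAct V u v ∈ lowerPart b V (l (gradeElt b)) 0 := by
  have h0 : v ∈ lowerPart b V (l (gradeElt b)) 0 :=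
    Submodule.mem_iSup_of_mem 0 (by simpa using mem_eigenspace_gradeElt (b := b) h₁)
  have := add_mem (lowerPart_le (Nat.zero_le 1) (uAct_sub_mem_lowerPart h₁ h₂ u))
    (Submodule.smul_mem _ (evalAt l (HC b u)) h0)
  rwa [sub_add_cancel] at this

variable (V) in
/-- `l` is a weight of `V`. -/
def IsWeight (l : Module.Dual ℂ H) : Prop := ∃ w : V, w ≠ 0 ∧ ∀ h : H, ⁅(h : L), w⁆ = l h • w

theorem isWeight_reflection_of_isWeight (i : H.root)
    (h₁ : ∀ x ∈ rootSpace H i.1, ∀ w : V, ∃ k, (LieModule.toEnd ℂ L V x ^ k) w = 0)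
    (h₂ : ∀ x ∈ rootSpace H (-(i.1 : H → ℂ)), ∀ w : V, ∃ k, (LieModule.toEnd ℂ L V x ^ k) w = 0)
    {m : Module.Dual ℂ H} (hm : IsWeight V m) :
    IsWeight V ((rootSystem H).reflection i m) := by
  obtain ⟨w, hw, hwt⟩ := hm
  obtain ⟨h, e, f, t, he, hf⟩ := exists_isSl2Triple_of_weight_isNonZero (isNonZero_root i)
  have hh := t.h_eq_coroot (isNonZero_root i) he hf
  have hrefl : (rootSystem H).reflection i m = m - m (coroot i.1) • (rootSystem H).root i := by
    rw [RootPairing.reflection_apply]; rfl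
  have hc : ⁅h, w⁆ = m (coroot i.1) • w := by rw [hh, hwt]
  have hwt' : ∀ {e f : L} {χ : H → ℂ} (a k : ℕ), e ∈ rootSpace H χ → f ∈ rootSpace H (-χ) →
      ∀ x : H, ⁅(x : L), (LieModule.toEnd ℂ L V f ^ k) ((LieModule.toEnd ℂ L V e ^ a) w)⁆ =
        (m x + a * χ x - k * χ x) •
          (LieModule.toEnd ℂ L V f ^ k) ((LieModule.toEnd ℂ L V e ^ a) w) := by
    intro e f χ a k he hf x
    rw [lie_cartan_pow_lie (l := fun x => m x + a * χ x) hf fun x => lie_cartan_pow_lie he hwt a x]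
    congr 1
    simp
    ring
  obtain ⟨a, n, hn, ha⟩ := exists_pow_lie_ne_zero t hw hc (h₁ e he w) (h₂ f hf)
  by_cases han : a ≤ n
  · refine ⟨_, ha han, fun x => ?_⟩
    rw [hwt' a (n - a) he hf, hrefl, hn]
    congr 1
    simp [Nat.cast_sub han]
    ring
  -- If the string upwards through `e` fails, the one with `e` and `f` exchanged works: failure of
  -- both would give `n + n' = 2a + 2a'` with `a > n` and `a' > n'`.
  obtain ⟨a', n', hn', ha'⟩ := exists_pow_lie_ne_zero t.symm hw
    (c := -m (coroot i.1)) (by rw [neg_lie, hc, neg_smul]) (h₂ f hf w) (h₁ e he)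
  have han' : a' ≤ n' := by
    by_contra h0
    rw [hn] at hn'
    have : (n : ℂ) + n' = 2 * a + 2 * a' := by linear_combination -hn'
    have : n + n' = 2 * a + 2 * a' := by exact_mod_cast this
    omega
  refine ⟨_, ha' han', fun x => ?_⟩
  have hfe : e ∈ rootSpace H (-(-(i.1 : H → ℂ))) := by rwa [neg_neg]
  rw [hwt' a' (n' - a') hf hfe, hrefl]
  congr 1
  have : m (coroot i.1) = 2 * a' - n' := by linear_combination -hn'
  rw [this]
  simp [Nat.cast_sub han']
  ring

/-- As `ad x` is nilpotent, the vectors killed by powers of `x` form a submodule; it contains the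
generator. -/
theorem exists_pow_lie_eq_zero (hv : LieSubmodule.lieSpan ℂ L {v} = ⊤) {χ : H → ℂ} (hχ : χ ≠ 0)
    {x : L} (hx : x ∈ rootSpace H χ) (h : ∃ k, (LieModule.toEnd ℂ L V x ^ k) v = 0) (w : V) :
    ∃ k, (LieModule.toEnd ℂ L V x ^ k) w = 0 := by
  have hnil : ∀ y : L, y ∈ (LieModule.toEnd ℂ L L x).maxGenEigenspace 0 := by
    intro y
    obtain ⟨k, hk⟩ := LieAlgebra.isNilpotent_ad_of_mem_rootSpace H hχ hx
    rw [Module.End.mem_maxGenEigenspace]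
    refine ⟨k, ?_⟩
    rw [zero_smul, sub_zero]
    exact congr($hk y)
  let N : LieSubmodule ℂ L V :=
    { (LieModule.toEnd ℂ L V x).maxGenEigenspace 0 with
      lie_mem := by
        intro y m hm
        have := LieModule.lie_mem_maxGenEigenspace_toEnd (hnil y) hm
        rwa [add_zero] at this }
  have hN : LieSubmodule.lieSpan ℂ L {v} ≤ N := by
    rw [LieSubmodule.lieSpan_le, Set.singleton_subset_iff]
    obtain ⟨k, hk⟩ := h
    refine Module.End.mem_maxGenEigenspace _ _ _ |>.2 ⟨k, ?_⟩
    rwa [zero_smul, sub_zero]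
  rw [hv] at hN
  obtain ⟨k, hk⟩ := (Module.End.mem_maxGenEigenspace _ _ _).1 (hN (LieSubmodule.mem_top w))
  rw [zero_smul, sub_zero] at hk
  exact ⟨k, hk⟩

theorem IsHighestWeight.exists_gradeElt_eq (hv : IsHighestWeight b l v) {m : Module.Dual ℂ H}
    (hm : IsWeight V m) : ∃ k : ℕ, m (gradeElt b) = l (gradeElt b) - k := by
  obtain ⟨w, hw, hwt⟩ := hm
  by_contra! h
  refine hw (Submodule.disjoint_def.1 ?_ w (mem_eigenspace_gradeElt (b := b) hwt)
    (hv.mem_lowerPart w))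
  refine (Module.End.eigenspaces_iSupIndep _ (m (gradeElt b))).mono_right (iSup_le fun k => ?_)
  refine le_iSup₂_of_le (l (gradeElt b) - (0 + k : ℕ)) ?_ le_rfl
  intro h'
  exact h k (by rw [← h']; simp)

theorem IsHighestWeight.isWeight_weyl (hv : IsHighestWeight b l v)
    (h : ∀ i ∈ b.support, ∀ x ∈ rootSpace H (-(i.1 : H → ℂ)),
      ∃ k, (LieModule.toEnd ℂ L V x ^ k) v = 0)
    (w : (rootSystem H).weylGroup) (m : Module.Dual ℂ H) :
    IsWeight V (w • m) = IsWeight V m := by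
  have key : ∀ i ∈ b.support, ∀ m : Module.Dual ℂ H, IsWeight V m →
      IsWeight V ((rootSystem H).reflection i m) := by
    intro i hi m hm
    refine isWeight_reflection_of_isWeight i (fun x hx w => ?_) (fun x hx w => ?_) hm
    · refine exists_pow_lie_eq_zero hv.generates (isNonZero_root i) hx ⟨1, ?_⟩ w
      rw [pow_one]
      exact hv.singular x (mem_nPlus_of_mem_rootSpace b
        (RootPairing.Base.isPos_of_mem_support hi) hx)
    · exact exists_pow_lie_eq_zero hv.generates (neg_ne_zero.2 (isNonZero_root i)) hx
        (h i hi x hx) w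
  refine weyl_smul_eq_of_simple b (IsWeight V)
    (fun i hi m => propext ⟨fun hm => ?_, key i hi m⟩) w m
  simpa using key i hi _ hm

/-- The weights are stable under the Weyl group. A nonzero `x^k v` of weight `l - k i` with `k`
large would reflect to a weight above `l`, so all negative root vectors, not only the simple ones,
act nilpotently on `v`. -/
theorem IsHighestWeight.finiteDimensional (hv : IsHighestWeight b l v)
    (hl : ∀ i : H.root, ∃ n : ℤ, l (coroot i.1) = n)
    (h : ∀ i ∈ b.support, ∀ x ∈ rootSpace H (-(i.1 : H → ℂ)),
      ∃ k, (LieModule.toEnd ℂ L V x ^ k) v = 0) : FiniteDimensional ℂ V := by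
  have hneg : ∀ i : H.root, b.IsPos i → ∀ x ∈ rootSpace H (-(i.1 : H → ℂ)),
      ∃ k, uAct V (uι L x ^ k) v = 0 := by
    intro i hi x hx
    obtain ⟨n, hn⟩ := hl i
    -- Only `k > n` and `k > 0` are needed, and `n` may be negative here.
    refine ⟨n.toNat + 1, ?_⟩
    rw [uAct_uι_pow]
    by_contra hne
    set k := n.toNat + 1 with hk
    have hw : IsWeight V (l - (k : ℂ) • (rootSystem H).root i) :=
      ⟨_, hne, fun y => by
        rw [lie_cartan_pow_lie hx hv.weight]
        congr 1
        simp
        ring⟩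
    rw [← hv.isWeight_weyl h (RootPairing.weylGroup.ofIdx _ i)] at hw
    obtain ⟨j, hj⟩ := hv.exists_gradeElt_eq hw
    have hrefl : RootPairing.weylGroup.ofIdx (rootSystem H) i •
        (l - (k : ℂ) • (rootSystem H).root i) = l + ((k : ℂ) - n) • (rootSystem H).root i := by
      have h1 : (rootSystem H).reflection i l = l - l (coroot i.1) • (rootSystem H).root i := by
        rw [RootPairing.reflection_apply]; rfl
      change (rootSystem H).reflection i (l - (k : ℂ) • (rootSystem H).root i) = _
      rw [map_sub, map_smul, RootPairing.reflection_apply_self, h1, hn]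
      module
    rw [hrefl, LinearMap.add_apply, LinearMap.smul_apply, root_gradeElt] at hj
    have h2 : ((k : ℂ) - n) * (b.height i : ℂ) = -j := by
      rw [← smul_eq_mul]; linear_combination hj
    have h3 : ((k : ℤ) - n) * b.height i = -j := by exact_mod_cast h2
    rw [RootPairing.Base.isPos_iff] at hi
    have h4 : 0 < ((k : ℤ) - n) * b.height i := mul_pos (by omega) hi
    omega
  refine finiteDimensional_of_pow_mem_filSpan (L := L) hv.exists_uAct_eq
    (s := {x | ∃ k, uAct V (uι L x ^ k) v ∈ filSpan L v k}) ?_ (fun x hx => hx)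
  rw [eq_top_iff, ← nMinus_sup_cartan_sup_nPlus b, nMinus_eq_span, nPlus_eq_span]
  refine sup_le (sup_le (Submodule.span_mono ?_) ?_) (Submodule.span_mono ?_)
  · rintro x ⟨i, hi, hx⟩
    obtain ⟨k, hk⟩ := hneg i hi x hx
    exact ⟨k, by rw [hk]; exact zero_mem _⟩
  · intro x hx
    refine Submodule.subset_span ⟨1, ?_⟩
    rw [pow_one, uAct_uι]
    have h1 := hv.weight ⟨x, hx⟩
    rw [h1]
    refine Submodule.smul_mem _ _ ⟨1, piece_le_fil _ 0 (one_mem_piece _), by simp⟩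
  · rintro x ⟨i, hi, hx⟩
    refine ⟨1, ?_⟩
    rw [pow_one, uAct_uι, hv.singular x (mem_nPlus_of_mem_rootSpace b hi hx)]
    exact zero_mem _

theorem exists_int_coroot {l : Module.Dual ℂ H}
    (hl : ∀ i ∈ b.support, ∃ n : ℤ, l (coroot i.1) = n) (i : H.root) :
    ∃ n : ℤ, l (coroot i.1) = n := by
  obtain ⟨f, -, -, hf⟩ := b.flip.exists_root_eq_sum_int i
  choose! n hn using hl
  refine ⟨∑ j ∈ b.support, f j * n j, ?_⟩
  have h1 : coroot i.1 = ∑ j ∈ b.support, f j • coroot j.1 := hf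
  rw [h1, map_sum]
  push_cast
  refine Finset.sum_congr rfl fun j hj => ?_
  rw [map_zsmul, hn j hj, zsmul_eq_mul]

variable (b) in
/-- The left ideal that defines the largest highest weight module with highest weight `l` on which
`x ^ n` kills the highest weight vector, for the root vectors `x` of a negative simple root `-i`
and `n = l (coroot i) + 1`. -/
noncomputable def integrableIdeal (l : Module.Dual ℂ H) :
    Submodule (UniversalEnvelopingAlgebra ℂ L) (UniversalEnvelopingAlgebra ℂ L) :=
  vermaIdeal b l ⊔ Submodule.span _ {u | ∃ i ∈ b.support, ∃ n : ℕ, l (coroot i.1) = n ∧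
    ∃ x ∈ rootSpace H (-(i.1 : H → ℂ)), u = uι L x ^ (n + 1)}

/-- In the Verma module the added generators are multiples of singular vectors `f^(n+1) v`. These
generate only vectors strictly below `v`, so `v` survives in the quotient. -/
theorem one_notMem_integrableIdeal (l : Module.Dual ℂ H) : 1 ∉ integrableIdeal b l := by
  intro h1
  have hv := isHighestWeight_verma b l
  set v := (vermaIdeal b l).mkQ 1 with hvdef
  have key : ∀ u ∈ integrableIdeal b l, u • v ∈
      lowerPart b (UniversalEnvelopingAlgebra ℂ L ⧸ vermaIdeal b l) (l (gradeElt b)) 1 := by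
    intro u hu
    obtain ⟨a, ha, c, hc, rfl⟩ := Submodule.mem_sup.1 hu
    have ha' : a • v = 0 := by
      rw [hvdef, smul_mkQ_one]
      exact (Submodule.Quotient.mk_eq_zero _).2 ha
    rw [add_smul, ha', zero_add]
    have : ∀ d : UniversalEnvelopingAlgebra ℂ L, (d * c) • v ∈
        lowerPart b (UniversalEnvelopingAlgebra ℂ L ⧸ vermaIdeal b l) (l (gradeElt b)) 1 := by
      clear hu
      induction hc using Submodule.span_induction with
      | zero => simp
      | add x y _ _ hx hy => intro d; rw [mul_add, add_smul]; exact add_mem (hx d) (hy d)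
      | smul r x _ hx => intro d; rw [smul_eq_mul, ← mul_assoc]; exact hx _
      | mem x hx =>
        obtain ⟨i, hi, n, hn, x, hx, rfl⟩ := hx
        intro d
        obtain ⟨h, e, f, t, he, hf⟩ := exists_isSl2Triple_of_weight_isNonZero (isNonZero_root i)
        obtain ⟨r, rfl⟩ := exists_eq_smul_of_mem_rootSpace (i := -i.1) (isNonZero_root i).neg hf
          t.f_ne_zero hx
        rw [map_smul, smul_pow, mul_smul_comm, smul_assoc, mul_smul]
        refine Submodule.smul_mem _ _ ?_
        have h2 := uAct_mem_lowerPart (b := b)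
          (l := l - ((n + 1 : ℕ) : ℂ) • (rootSystem H).root i)
          (fun x => by
            rw [lie_cartan_pow_lie hf hv.weight (n + 1)]
            congr 1
            simp
            ring)
          (fun x hx => lie_nPlus_pow_lie hi t he hf hv.weight hv.singular hn hx) d
        rw [← uAct_uι_pow, uAct_quot, uAct_quot] at h2
        have h3 : (l - ((n + 1 : ℕ) : ℂ) • (rootSystem H).root i) (gradeElt b) =
            l (gradeElt b) - (n + 1 : ℕ) := by
          rw [LinearMap.sub_apply, LinearMap.smul_apply, simpleRoot_gradeElt b hi, smul_eq_mul,
            mul_one]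
        rw [h3] at h2
        -- Everything from `n + 1` steps below `l` onwards is at least one step below.
        refine (iSup_le fun k => le_iSup_of_le (n + k) (le_of_eq ?_) :
          lowerPart b _ (l (gradeElt b) - (n + 1 : ℕ)) 0 ≤ lowerPart b _ (l (gradeElt b)) 1) h2
        congr 1
        push_cast
        ring
    simpa using this 1
  have h2 := key 1 h1
  rw [one_smul] at h2
  exact hv.ne_zero (Submodule.disjoint_def.1 (disjoint_eigenspace_lowerPart _) v
    hv.mem_eigenspace h2)

/-- For a dominant integral weight there is a finite-dimensional highest weight module. -/
theorem exists_finiteDimensional_isHighestWeight {l : Module.Dual ℂ H}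
    (hl : ∀ i ∈ b.support, ∃ n : ℕ, l (coroot i.1) = n) :
    ∃ J : Submodule (UniversalEnvelopingAlgebra ℂ L) (UniversalEnvelopingAlgebra ℂ L),
      IsHighestWeight b l (J.mkQ 1) ∧
        FiniteDimensional ℂ (UniversalEnvelopingAlgebra ℂ L ⧸ J) := by
  have hv : IsHighestWeight b l ((integrableIdeal b l).mkQ 1) :=
    isHighestWeight_quot _ (one_notMem_integrableIdeal l)
      (fun x hx => Submodule.mem_sup_left (uι_mem_vermaIdeal b l hx))
      (fun h => Submodule.mem_sup_left (uι_sub_mem_vermaIdeal b l h))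
  refine ⟨integrableIdeal b l, hv, hv.finiteDimensional (exists_int_coroot (b := b)
    fun i hi => ?_) fun i hi x hx => ?_⟩
  · obtain ⟨n, hn⟩ := hl i hi
    exact ⟨n, by simpa using hn⟩
  · obtain ⟨n, hn⟩ := hl i hi
    refine ⟨n + 1, ?_⟩
    rw [← uAct_uι_pow, uAct_quot, smul_mkQ_one]
    exact (Submodule.Quotient.mk_eq_zero _).2
      (Submodule.mem_sup_right (Submodule.subset_span ⟨i, hi, n, hn, x, hx, rfl⟩))

end Weights

end HarishChandra

namespace HarishChandra

/-! ### Homogeneous components of invariants -/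

section Components

variable {M : Type*} [AddCommGroup M] [Module ℂ M]

theorem evalAt_smul_eq_eval (l : Module.Dual ℂ M) (t : ℂ) (p : SymmetricAlgebra ℂ M) :
    evalAt (t • l) p = ((symGrade M p).map (evalAt l : SymmetricAlgebra ℂ M →+* ℂ)).eval t := by
  have : evalAt (t • l) = (Polynomial.aeval t).comp
      ((Polynomial.mapAlgHom (evalAt l)).comp (symGrade M)) := by
    ext x
    simp [evalAt, symGrade, mul_comm t]
  have h := congr($this p)
  rw [h]
  simp

theorem evalAt_symComp_eq {l m : Module.Dual ℂ M} {p : SymmetricAlgebra ℂ M}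
    (h : ∀ t : ℂ, evalAt (t • l) p = evalAt (t • m) p) (n : ℕ) :
    evalAt l (symComp M n p) = evalAt m (symComp M n p) := by
  have key : (symGrade M p).map (evalAt l : SymmetricAlgebra ℂ M →+* ℂ) =
      (symGrade M p).map (evalAt m : SymmetricAlgebra ℂ M →+* ℂ) :=
    Polynomial.funext fun t => by rw [← evalAt_smul_eq_eval, ← evalAt_smul_eq_eval, h]
  have := congr(($key).coeff n)
  rwa [Polynomial.coeff_map, Polynomial.coeff_map] at this

theorem symShift_sub_mem_fil (m : Module.Dual ℂ M) {n : ℕ} {p : SymmetricAlgebra ℂ M}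
    (hp : p ∈ fil (SymmetricAlgebra.ι ℂ M) (n + 1)) :
    symShift m p - p ∈ fil (SymmetricAlgebra.ι ℂ M) n := by
  refine fil_induction _ (p := fun p => symShift m p - p ∈ fil (SymmetricAlgebra.ι ℂ M) n)
    (by simp) (fun a c h h' => by rw [map_add, add_sub_add_comm]; exact add_mem h h')
    (fun k hk a ha => ?_) hp
  refine fil_mono _ (Nat.lt_succ_iff.1 hk) ?_
  refine piece_induction _ Submodule.span_univ
    (p := fun p => symShift m p - p ∈ fil (SymmetricAlgebra.ι ℂ M) k) (by simp)
    (fun a c h h' => by rw [map_add, add_sub_add_comm]; exact add_mem h h')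
    (fun t a h => by rw [map_smul, ← smul_sub]; exact Submodule.smul_mem _ _ h)
    (fun l hl _ => ?_) ha
  subst hl
  clear ha hk
  induction l with
  | nil => simp
  | cons x l ih =>
    replace ih := ih (by simp)
    rw [List.map_cons, List.prod_cons, map_mul, List.length_cons]
    have h1 : symShift m (SymmetricAlgebra.ι ℂ M x) =
        SymmetricAlgebra.ι ℂ M x + algebraMap ℂ _ (m x) := by simp [symShift]
    set P := (l.map (SymmetricAlgebra.ι ℂ M)).prod with hP
    have h2 : symShift m (SymmetricAlgebra.ι ℂ M x) * symShift m P -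
        SymmetricAlgebra.ι ℂ M x * P = SymmetricAlgebra.ι ℂ M x * (symShift m P - P) +
          m x • ((symShift m P - P) + P) := by
      rw [h1, Algebra.smul_def]; ring
    rw [h2]
    refine add_mem ?_ (Submodule.smul_mem _ _ (add_mem (fil_mono _ (Nat.le_succ _) ih) ?_))
    · rw [add_comm l.length]
      exact piece_mul_mem_fil _ (mem_piece_one _ x) ih
    · exact piece_le_fil _ _ (prod_mem_piece _ l)

end Components

/-! ### Weyl invariance of restrictions and leading terms. -/

section WeylInvariants

variable {L : Type*} [LieRing L] [LieAlgebra ℂ L] [FiniteDimensional ℂ L] [IsSemisimple ℂ L]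
  {H : LieSubalgebra ℂ L} [H.IsCartanSubalgebra] (b : (rootSystem H).Base)

theorem weyl_smul_smul (w : (rootSystem H).weylGroup) (t : ℂ) (l : Module.Dual ℂ H) :
    w • (t • l) = t • (w • l) :=
  map_smul ((rootSystem H).weylGroupRootRep w) t l

theorem weyl_smul_add (w : (rootSystem H).weylGroup) (l m : Module.Dual ℂ H) :
    w • (l + m) = w • l + w • m :=
  map_add ((rootSystem H).weylGroupRootRep w) l m

theorem symComp_mem_weylInvariants {p : SymmetricAlgebra ℂ H} (hp : p ∈ weylInvariants H) (n : ℕ) :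
    symComp H n p ∈ weylInvariants H := by
  rw [mem_weylInvariants] at hp ⊢
  refine fun w l => evalAt_symComp_eq (fun t => ?_) n
  rw [← weyl_smul_smul, hp]

/-- The leading component of an invariant of the shifted action is Weyl invariant. -/
theorem symComp_mem_weylInvariants_of_dot {n : ℕ} {p : SymmetricAlgebra ℂ H}
    (hp : p ∈ dotInvariants b) (hn : p ∈ fil (SymmetricAlgebra.ι ℂ H) (n + 1)) :
    symComp H n p ∈ weylInvariants H := by
  have h1 := symComp_mem_weylInvariants ((mem_dotInvariants_iff b).1 hp) n
  have h2 := symComp_of_mem_fil le_rfl (symShift_sub_mem_fil (-rho b) hn)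
  rw [map_sub, sub_eq_zero] at h2
  rwa [← h2]

theorem res_mem_piece {n : ℕ} {s : SymmetricAlgebra ℂ L}
    (hs : s ∈ piece (SymmetricAlgebra.ι ℂ L) n) :
    res b s ∈ piece (SymmetricAlgebra.ι ℂ H) n :=
  symMap_mem_piece _ n s hs

/-- The restriction is the leading component of `HC` of the central element `symmetrize L n s`, so
its Weyl invariance follows from shifted invariance without using the adjoint group. -/
theorem res_mem_weylInvariants_of_mem_piece {n : ℕ} {s : SymmetricAlgebra ℂ L}
    (hs : s ∈ piece (SymmetricAlgebra.ι ℂ L) n) (hi : s ∈ symInvariants L) :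
    res b s ∈ weylInvariants H := by
  have h1 := symComp_mem_weylInvariants_of_dot b
    (HC_mem_dotInvariants b (symmetrize_mem_center hs hi)) (HC_mem_fil b (symmetrize_mem_fil hs))
  have h2 := symComp_of_mem_fil le_rfl (HC_symmetrize_sub_mem b hs)
  rw [map_sub, sub_eq_zero, symComp_self (res_mem_piece b hs)] at h2
  rwa [← h2]

theorem res_mem_weylInvariants {s : SymmetricAlgebra ℂ L} (hi : s ∈ symInvariants L) :
    res b s ∈ weylInvariants H := by
  obtain ⟨n, hn⟩ := exists_mem_fil _ (adjoin_range_ι L) s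
  rw [← sum_symComp hn, map_sum]
  refine sum_mem fun k _ => res_mem_weylInvariants_of_mem_piece b (symComp_mem k s) ?_
  rw [mem_symInvariants] at hi ⊢
  intro y
  rw [← symComp_symDer, hi, map_zero]

/-! ### The invariant bilinear form on weights -/

/-- The bilinear form on `𝔥*` dual to the restriction of the Killing form. -/
noncomputable def dualForm (l m : Module.Dual ℂ H) : ℂ := l ((cartanEquivDual H).symm m)

theorem dualForm_comm (l m : Module.Dual ℂ H) : dualForm l m = dualForm m l := by
  have h : ∀ l m : Module.Dual ℂ H, dualForm l m = LieModule.traceForm ℂ H L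
      ((cartanEquivDual H).symm l) ((cartanEquivDual H).symm m) := by
    intro l m
    conv_lhs => rw [dualForm, ← (cartanEquivDual H).apply_symm_apply l]
    rfl
  rw [h, h, LieModule.traceForm_comm]

theorem dualForm_reflection (i : H.root) (l m : Module.Dual ℂ H) :
    dualForm ((rootSystem H).reflection i l) ((rootSystem H).reflection i m) = dualForm l m := by
  have hrefl : ∀ m, (rootSystem H).reflection i m = m - m (coroot i.1) • i.1.toLinear := by
    intro m
    rw [RootPairing.reflection_apply]; rfl
  set t := (cartanEquivDual H).symm i.1.toLinear with ht
  have hc : coroot i.1 = (2 * (i.1 t)⁻¹) • t := by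
    rw [coroot, mul_smul, ← ht, two_smul, two_smul]
  have h0 : i.1 t ≠ 0 := root_apply_cartanEquivDual_symm_ne_zero (isNonZero_root i)
  have h1 : i.1 ((cartanEquivDual H).symm m) = m t := dualForm_comm (i.1.toLinear) m
  rw [hrefl, hrefl, dualForm, dualForm, map_sub, map_smul, ← ht, hc]
  simp only [LinearMap.sub_apply, LinearMap.smul_apply, map_sub, map_smul, smul_eq_mul,
    LieModule.Weight.toLinear_apply, h1]
  field_simp
  ring

theorem dualForm_weyl (w : (rootSystem H).weylGroup) (l m : Module.Dual ℂ H) :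
    dualForm (w • l) (w • m) = dualForm l m := by
  revert l m
  obtain ⟨w, hw⟩ := w
  induction hw using RootPairing.weylGroup.induction with
  | mem i => exact fun l m => dualForm_reflection i l m
  | one =>
    intro l m
    exact congrArg₂ dualForm (one_smul (rootSystem H).weylGroup l)
      (one_smul (rootSystem H).weylGroup m)
  | mul w w' hw hw' ih ih' =>
    intro l m
    have h := fun l : Module.Dual ℂ H =>
      mul_smul (⟨w, hw⟩ : (rootSystem H).weylGroup) ⟨w', hw'⟩ l
    exact (congrArg₂ dualForm (h l) (h m)).trans ((ih _ _).trans (ih' l m))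

theorem dualForm_weyl_left (w : (rootSystem H).weylGroup) (l m : Module.Dual ℂ H) :
    dualForm (w • l) m = dualForm l (w⁻¹ • m) := by
  rw [← dualForm_weyl w⁻¹ (w • l), inv_smul_smul]

/-- The Weyl group acts faithfully on the finite set of roots, since the roots span `𝔥*`. -/
instance finite_weylGroup : Finite (rootSystem H).weylGroup := by
  refine Finite.of_injective (rootSystem H).weylGroupToPerm fun w w' h => ?_
  have h1 : ∀ l : Module.Dual ℂ H, w • l = w' • l := by
    intro l
    have hl : l ∈ Submodule.span ℂ (Set.range (rootSystem H).root) := by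
      rw [RootPairing.IsRootSystem.span_root_eq_top]; trivial
    induction hl using Submodule.span_induction with
    | mem _ hx =>
      obtain ⟨i, rfl⟩ := hx
      rw [RootPairing.weylGroup_apply_root, RootPairing.weylGroup_apply_root, h]
    | zero => simp
    | add x y _ _ hx hy => rw [weyl_smul_add, weyl_smul_add, hx, hy]
    | smul t x _ hx => rw [weyl_smul_smul, weyl_smul_smul, hx]
  refine Subtype.ext (RootPairing.Equiv.weightHom_injective (rootSystem H) ?_)
  exact LinearEquiv.ext h1

end WeylInvariants

end HarishChandra

namespace HarishChandra

/-! ### Invariants from traces -/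

section Trace

theorem map_derivation_mul {A ι : Type*} [CommRing A] [Algebra ℂ A] [Fintype ι]
    (D : Derivation ℂ A A) (M N : Matrix ι ι A) :
    (M * N).map D = M.map D * N + M * N.map D := by
  ext p q
  simp only [Matrix.map_apply, Matrix.mul_apply, Matrix.add_apply, map_sum, Derivation.leibniz,
    smul_eq_mul, ← Finset.sum_add_distrib]
  exact Finset.sum_congr rfl fun r _ => by ring

theorem map_derivation_pow {A ι : Type*} [CommRing A] [Algebra ℂ A] [Fintype ι] [DecidableEq ι]
    (D : Derivation ℂ A A) {M X : Matrix ι ι A} (h : M.map D = M * X - X * M) (n : ℕ) :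
    (M ^ n).map D = M ^ n * X - X * M ^ n := by
  induction n with
  | zero =>
    rw [pow_zero, one_mul, mul_one, sub_self]
    ext p q
    rw [Matrix.map_apply, Matrix.one_apply]
    split_ifs <;> simp
  | succ n ih =>
    rw [pow_succ, map_derivation_mul, ih, h]
    noncomm_ring

variable {L : Type*} [LieRing L] [LieAlgebra ℂ L] [FiniteDimensional ℂ L] [IsSemisimple ℂ L]

variable (L) in
/-- The identification of `𝔤*` with `𝔤` given by the Killing form. -/
noncomputable def killingSharp : Module.Dual ℂ L ≃ₗ[ℂ] L :=
  ((killingForm ℂ L).toDual (LieAlgebra.IsKilling.killingForm_nondegenerate ℂ L)).symm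

theorem killingForm_killingSharp (f : Module.Dual ℂ L) (y : L) :
    killingForm ℂ L (killingSharp L f) y = f y :=
  congr($(((killingForm ℂ L).toDual
    (LieAlgebra.IsKilling.killingForm_nondegenerate ℂ L)).apply_symm_apply f) y)

theorem eq_killingSharp {x : L} {f : Module.Dual ℂ L} (h : ∀ y, killingForm ℂ L x y = f y) :
    x = killingSharp L f := by
  apply (killingSharp L).symm.injective
  rw [LinearEquiv.symm_apply_apply]
  exact LinearMap.ext h

theorem lie_killingSharp (x : L) (f : Module.Dual ℂ L) :
    ⁅x, killingSharp L f⁆ = -killingSharp L (f ∘ₗ LieModule.toEnd ℂ L L x) := by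
  rw [← map_neg]
  refine eq_killingSharp fun y => ?_
  rw [← lie_skew, map_neg, LinearMap.neg_apply, LieModule.traceForm_apply_lie_apply,
    killingForm_killingSharp]
  rfl

variable {V ι : Type*} [AddCommGroup V] [Module ℂ V] [LieRingModule L V] [LieModule ℂ L V]
  [Fintype ι] [DecidableEq ι] (β : Module.Basis ι ℂ V)

variable (L) in
/-- The matrix coefficient at `(p, q)` as a linear form on `𝔤`. -/
noncomputable def matCoeff (p q : ι) : Module.Dual ℂ L :=
  Matrix.entryLinearMap ℂ ℂ p q ∘ₗ (LinearMap.toMatrix β β).toLinearMap ∘ₗ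
    (LieModule.toEnd ℂ L V : L →ₗ[ℂ] Module.End ℂ V)

theorem matCoeff_apply (p q : ι) (y : L) :
    matCoeff L β p q y = LinearMap.toMatrix β β (LieModule.toEnd ℂ L V y) p q := rfl

variable (L) in
/-- The generic matrix of `V`, with entries in `S(𝔤)`. -/
noncomputable def genericMatrix : Matrix ι ι (SymmetricAlgebra ℂ L) :=
  fun p q => SymmetricAlgebra.ι ℂ L (killingSharp L (matCoeff L β p q))

theorem matCoeff_comp (x : L) (p q : ι) : matCoeff L β p q ∘ₗ LieModule.toEnd ℂ L L x =
    ∑ r, LinearMap.toMatrix β β (LieModule.toEnd ℂ L V x) p r • matCoeff L β r q -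
      ∑ r, LinearMap.toMatrix β β (LieModule.toEnd ℂ L V x) r q • matCoeff L β p r := by
  ext y
  have h : LieModule.toEnd ℂ L V ⁅x, y⁆ = LieModule.toEnd ℂ L V x * LieModule.toEnd ℂ L V y -
      LieModule.toEnd ℂ L V y * LieModule.toEnd ℂ L V x := by
    ext w; simp
  simp only [LinearMap.comp_apply, LieModule.toEnd_apply_apply, matCoeff_apply, h,
    LinearMap.sub_apply, LinearMap.sum_apply, LinearMap.smul_apply, map_sub,
    LinearMap.toMatrix_mul, Matrix.sub_apply, Matrix.mul_apply, smul_eq_mul]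
  congr 1
  exact Finset.sum_congr rfl fun r _ => mul_comm _ _

/-- The map sending `y` to its matrix is equivariant, so the adjoint action differentiates the
generic matrix to a commutator with a constant matrix; traces of powers are then invariant. -/
theorem genericMatrix_map_symDer (x : L) :
    (genericMatrix L β).map (symDer (LieModule.toEnd ℂ L L x)) =
      genericMatrix L β * (LinearMap.toMatrix β β (LieModule.toEnd ℂ L V x)).map
          (algebraMap ℂ (SymmetricAlgebra ℂ L)) -
        (LinearMap.toMatrix β β (LieModule.toEnd ℂ L V x)).map
          (algebraMap ℂ (SymmetricAlgebra ℂ L)) * genericMatrix L β := by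
  ext p q
  rw [Matrix.map_apply, genericMatrix, symDer_ι, LieModule.toEnd_apply_apply, lie_killingSharp,
    matCoeff_comp]
  simp only [map_sub, map_sum, map_smul, neg_sub, Matrix.sub_apply, Matrix.mul_apply,
    Matrix.map_apply, Algebra.smul_def]
  congr 1
  exact Finset.sum_congr rfl fun r _ => mul_comm _ _

theorem trace_genericMatrix_pow_mem_symInvariants (n : ℕ) :
    ((genericMatrix L β) ^ n).trace ∈ symInvariants L := by
  rw [mem_symInvariants]
  intro x
  have h : symDer (LieModule.toEnd ℂ L L x) ((genericMatrix L β) ^ n).trace =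
      (((genericMatrix L β) ^ n).map (symDer (LieModule.toEnd ℂ L L x))).trace := by
    simp [Matrix.trace]
  rw [h, map_derivation_pow _ (genericMatrix_map_symDer β x), Matrix.trace_sub,
    Matrix.trace_mul_comm, sub_self]

theorem genericMatrix_pow_mem_piece (n : ℕ) (p q : ι) :
    ((genericMatrix L β) ^ n) p q ∈ piece (SymmetricAlgebra.ι ℂ L) n := by
  induction n generalizing p q with
  | zero =>
    rw [pow_zero, Matrix.one_apply]
    split_ifs
    · exact one_mem_piece _
    · exact zero_mem _
  | succ n ih =>
    rw [pow_succ, Matrix.mul_apply]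
    exact sum_mem fun r _ => mul_mem_piece _ (ih p r) (mem_piece_one _ _)

variable {H : LieSubalgebra ℂ L} [H.IsCartanSubalgebra] (b : (rootSystem H).Base)

theorem cartanProj_killingSharp (f : Module.Dual ℂ L) :
    cartanProj b (killingSharp L f) = (cartanEquivDual H).symm (f ∘ₗ H.toSubmodule.subtype) := by
  apply (cartanEquivDual H).injective
  rw [LinearEquiv.apply_symm_apply]
  ext h
  have h1 : cartanEquivDual H (cartanProj b (killingSharp L f)) h =
      killingForm ℂ L (projH b (killingSharp L f)) h := rfl
  rw [h1, killingForm_projH, killingForm_killingSharp]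
  rfl

/-- Elements of `𝔥` act diagonally in a weight basis, so the generic matrix restricts to a diagonal
matrix with the weights as entries. -/
theorem res_trace_genericMatrix_pow {μ : ι → Module.Dual ℂ H}
    (hβ : ∀ p, ∀ h : H, ⁅(h : L), β p⁆ = μ p h • β p) (n : ℕ) :
    res b ((genericMatrix L β) ^ n).trace =
      ∑ p, SymmetricAlgebra.ι ℂ H ((cartanEquivDual H).symm (μ p)) ^ n := by
  have h1 : (genericMatrix L β).map (res b) = Matrix.diagonal fun p =>
      SymmetricAlgebra.ι ℂ H ((cartanEquivDual H).symm (μ p)) := by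
    ext p q
    rw [Matrix.map_apply, genericMatrix, res, symMap_ι, cartanProj_killingSharp]
    have h2 : matCoeff L β p q ∘ₗ H.toSubmodule.subtype = if p = q then μ p else 0 := by
      ext h
      have h3 : (matCoeff L β p q ∘ₗ H.toSubmodule.subtype) h =
          β.repr ⁅(h : L), β q⁆ p := LinearMap.toMatrix_apply _ _ _ _ _
      rw [h3, hβ, map_smul, Finsupp.smul_apply, Module.Basis.repr_self, Finsupp.single_apply]
      by_cases hpq : p = q
      · subst hpq; simp
      · simp [hpq, Ne.symm hpq]
    rw [h2, Matrix.diagonal_apply]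
    split_ifs <;> simp
  have h4 : res b ((genericMatrix L β) ^ n).trace =
      (((genericMatrix L β) ^ n).map (res b)).trace := by
    simp [Matrix.trace]
  have h5 : ((genericMatrix L β) ^ n).map (res b) = ((genericMatrix L β).map (res b)) ^ n :=
    map_pow (res b).mapMatrix (genericMatrix L β) n
  rw [h4, h5, h1, Matrix.diagonal_pow, Matrix.trace_diagonal]
  rfl

end Trace

/-! ### Orbit sums of powers -/

section Orbit

variable {L : Type*} [LieRing L] [LieAlgebra ℂ L] [FiniteDimensional ℂ L] [IsSemisimple ℂ L]
  {H : LieSubalgebra ℂ L} [H.IsCartanSubalgebra] (b : (rootSystem H).Base)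

noncomputable instance : Fintype (rootSystem H).weylGroup := Fintype.ofFinite _

theorem evalAt_ι_symm (l m : Module.Dual ℂ H) :
    evalAt l (SymmetricAlgebra.ι ℂ H ((cartanEquivDual H).symm m)) = dualForm l m := by
  simp [evalAt, dualForm]

/-- The sum of the `n`-th powers of the elements of the Weyl group orbit of `m`, with
multiplicities. -/
noncomputable def orbitSum (n : ℕ) (m : Module.Dual ℂ H) : SymmetricAlgebra ℂ H :=
  ∑ w : (rootSystem H).weylGroup,
    SymmetricAlgebra.ι ℂ H ((cartanEquivDual H).symm (w • m)) ^ n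

theorem orbitSum_weyl (n : ℕ) (w : (rootSystem H).weylGroup) (m : Module.Dual ℂ H) :
    orbitSum n (w • m) = orbitSum n m := by
  simp only [orbitSum, smul_smul]
  exact Fintype.sum_equiv (Equiv.mulRight w) _ _ fun _ => rfl

theorem evalAt_orbitSum (n : ℕ) (l m : Module.Dual ℂ H) :
    evalAt l (orbitSum n m) = ∑ w : (rootSystem H).weylGroup, dualForm (w • l) m ^ n := by
  rw [orbitSum, map_sum]
  refine Fintype.sum_equiv (Equiv.inv _) _ _ fun w => ?_
  rw [map_pow, evalAt_ι_symm, dualForm_weyl_left]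
  simp

/-- Summing over orbits amounts to summing the translates of the power sum, all equal by invariance.
-/
theorem sum_orbitSum {ι : Type*} [Fintype ι] {n : ℕ} {μ : ι → Module.Dual ℂ H}
    (h : ∑ p, SymmetricAlgebra.ι ℂ H ((cartanEquivDual H).symm (μ p)) ^ n ∈ weylInvariants H) :
    ∑ p, orbitSum n (μ p) = (Fintype.card (rootSystem H).weylGroup : ℂ) •
      ∑ p, SymmetricAlgebra.ι ℂ H ((cartanEquivDual H).symm (μ p)) ^ n := by
  refine ext_evalAt fun l => ?_
  rw [mem_weylInvariants] at h
  rw [map_sum, map_smul, smul_eq_mul, ← nsmul_eq_mul, ← Finset.card_univ, ← Finset.sum_const]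
  simp only [evalAt_orbitSum]
  rw [Finset.sum_comm]
  refine Finset.sum_congr rfl fun w _ => ?_
  rw [← h w l, map_sum]
  simp only [map_pow, evalAt_ι_symm]

/-- The image in `Sⁿ(𝔥)` of the invariants of degree `n`. -/
noncomputable def resImage (n : ℕ) : Submodule ℂ (SymmetricAlgebra ℂ H) :=
  (symInvariants L ⊓ piece (SymmetricAlgebra.ι ℂ L) n).map (res b).toLinearMap

end Orbit

end HarishChandra

namespace HarishChandra

/-! ### Weights of finite-dimensional highest weight modules -/

section FiniteWeights

variable {L : Type*} [LieRing L] [LieAlgebra ℂ L] [FiniteDimensional ℂ L] [IsSemisimple ℂ L]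
  {H : LieSubalgebra ℂ L} [H.IsCartanSubalgebra] {b : (rootSystem H).Base}
  {V : Type*} [AddCommGroup V] [Module ℂ V] [LieRingModule L V] [LieModule ℂ L V]
  {l : Module.Dual ℂ H} {v : V}

variable (b) in
/-- `l` takes natural values at the simple coroots. -/
def IsDominantIntegral (l : Module.Dual ℂ H) : Prop :=
  ∀ i ∈ b.support, ∃ n : ℕ, l (coroot i.1) = n

theorem IsHighestWeight.span_weightVectors (hv : IsHighestWeight b l v) :
    Submodule.span ℂ {w : V | ∃ m : Module.Dual ℂ H, ∀ h : H, ⁅(h : L), w⁆ = m h • w} = ⊤ := by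
  rw [eq_top_iff]
  rintro w -
  induction w using hv.induction with
  | add _ _ h h' => exact add_mem h h'
  | smul t _ h => exact Submodule.smul_mem _ _ h
  | base => exact Submodule.subset_span ⟨l, hv.weight⟩
  | lie y hy w hw =>
    refine nMinus_induction b (p := fun y => ⁅y, w⁆ ∈ Submodule.span ℂ _) (by simp)
      (fun _ _ h h' => by rw [add_lie]; exact add_mem h h')
      (fun t _ h => by rw [smul_lie]; exact Submodule.smul_mem _ _ h) (fun α hα y hy => ?_) hy
    induction hw using Submodule.span_induction with
    | zero => simp
    | add _ _ _ _ h h' => rw [lie_add]; exact add_mem h h'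
    | smul t _ _ h => rw [lie_smul]; exact Submodule.smul_mem _ _ h
    | mem w hw =>
      obtain ⟨m, hm⟩ := hw
      refine Submodule.subset_span ⟨m - (rootSystem H).root α, fun h => ?_⟩
      have := lie_cartan_pow_lie hy hm 1 h
      rw [pow_one, LieModule.toEnd_apply_apply] at this
      rw [this]
      congr 1
      simp
      ring

theorem IsHighestWeight.eq_of_gradeElt_eq (hv : IsHighestWeight b l v) {m : Module.Dual ℂ H}
    (hm : IsWeight V m) (h : m (gradeElt b) = l (gradeElt b)) : m = l := by
  obtain ⟨w, hw, hwt⟩ := hm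
  obtain ⟨c, n, hn, rfl⟩ := hv.exists_eq_smul_add w
  have h1 := mem_eigenspace_gradeElt (b := b) hwt
  rw [h] at h1
  have h2 := sub_mem h1 (Submodule.smul_mem _ c hv.mem_eigenspace)
  rw [add_sub_cancel_left] at h2
  have h3 := Submodule.disjoint_def.1 (disjoint_eigenspace_lowerPart _) n h2 (hv.nMinusMul_le hn)
  rw [h3, add_zero] at hw hwt
  ext x
  have h4 := hwt x
  rw [lie_smul, hv.weight, ← smul_comm, ← sub_eq_zero, ← sub_smul, smul_eq_zero] at h4
  exact (sub_eq_zero.1 (h4.resolve_right hw)).symm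

/-- The coroots span `𝔥`, and each is a commutator `[e, f]`. -/
theorem trace_toEnd_cartan [FiniteDimensional ℂ V] (h : H) :
    LinearMap.trace ℂ V (LieModule.toEnd ℂ L V (h : L)) = 0 := by
  have hh : h ∈ Submodule.span ℂ (Set.range (rootSystem H).coroot) := by
    rw [RootPairing.IsRootSystem.span_coroot_eq_top]; trivial
  induction hh using Submodule.span_induction with
  | zero => simp
  | add x y _ _ hx hy => rw [H.coe_add, map_add, map_add, hx, hy, add_zero]
  | smul t x _ hx => rw [H.coe_smul, map_smul, map_smul, hx, smul_zero]
  | mem x hx =>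
    obtain ⟨i, rfl⟩ := hx
    obtain ⟨h, e, f, t, he, hf⟩ := exists_isSl2Triple_of_weight_isNonZero (isNonZero_root i)
    rw [rootSystem_coroot_apply, ← t.h_eq_coroot (isNonZero_root i) he hf, ← t.lie_e_f]
    have h1 : LieModule.toEnd ℂ L V ⁅e, f⁆ = LieModule.toEnd ℂ L V e * LieModule.toEnd ℂ L V f -
        LieModule.toEnd ℂ L V f * LieModule.toEnd ℂ L V e := by
      ext w; simp
    rw [h1, map_sub, LinearMap.trace_mul_comm, sub_self]

theorem IsHighestWeight.exists_weightBasis [FiniteDimensional ℂ V] (hv : IsHighestWeight b l v) :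
    ∃ (n : ℕ) (β : Module.Basis (Fin n) ℂ V) (μ : Fin n → Module.Dual ℂ H),
      ∀ p, ∀ h : H, ⁅(h : L), β p⁆ = μ p h • β p := by
  let β := Module.Basis.ofSpan hv.span_weightVectors.ge
  have := Module.Finite.finite_basis β
  let β' := β.reindex (Finite.equivFin _)
  have h : ∀ p, ∃ m : Module.Dual ℂ H, ∀ h : H, ⁅(h : L), β' p⁆ = m h • β' p := by
    intro p
    have h1 : β' p ∈ Set.range β := by
      rw [Module.Basis.reindex_apply]
      exact Set.mem_range_self _
    exact Module.Basis.ofSpan_subset hv.span_weightVectors.ge h1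
  choose μ hμ using h
  exact ⟨_, β', μ, hμ⟩

/-- The trace of `gradeElt` is zero and all its eigenvalues are `l(gradeElt) - k` with `k` natural.
This bounds the induction in `orbitSum_mem_resImage` from below. -/
theorem IsHighestWeight.gradeElt_re_nonneg [FiniteDimensional ℂ V] (hv : IsHighestWeight b l v) :
    0 ≤ (l (gradeElt b)).re := by
  obtain ⟨n, β, μ, hβ⟩ := hv.exists_weightBasis
  have hμ : ∀ p, IsWeight V (μ p) := fun p => ⟨β p, β.ne_zero p, hβ p⟩
  choose k hk using fun p => hv.exists_gradeElt_eq (hμ p)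
  have h1 := trace_toEnd_cartan (V := V) (gradeElt b)
  rw [LinearMap.trace_eq_matrix_trace ℂ β] at h1
  have h2 : ∀ p, LinearMap.toMatrix β β (LieModule.toEnd ℂ L V (gradeElt b : L)) p p =
      l (gradeElt b) - k p := by
    intro p
    rw [LinearMap.toMatrix_apply, LieModule.toEnd_apply_apply, hβ, hk]
    simp
  simp only [Matrix.trace, Matrix.diag_apply, h2, Finset.sum_sub_distrib, Finset.sum_const,
    Finset.card_univ, Fintype.card_fin, nsmul_eq_mul] at h1
  have hn : 0 < n := by
    rcases Nat.eq_zero_or_pos n with rfl | h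
    · exact absurd (by simpa using β.sum_repr v) hv.ne_zero.symm
    · exact h
  have h3 := congrArg Complex.re h1
  rw [← Nat.cast_sum] at h3
  simp only [Complex.sub_re, Complex.mul_re, Complex.natCast_re, Complex.natCast_im, zero_mul,
    sub_zero, Complex.zero_re] at h3
  have h4 : (0 : ℝ) ≤ n * (l (gradeElt b)).re := by
    rw [sub_eq_zero.1 h3]; positivity
  exact nonneg_of_mul_nonneg_right h4 (by exact_mod_cast hn)

theorem exists_pow_lie_eq_zero_of_finiteDimensional [FiniteDimensional ℂ V] {χ : H → ℂ}
    (hχ : χ ≠ 0) {x : L} (hx : x ∈ rootSpace H χ) (w : V) :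
    ∃ k, (LieModule.toEnd ℂ L V x ^ k) w = 0 := by
  obtain ⟨k, hk⟩ := LieModule.isNilpotent_toEnd_of_mem_rootSpace (M := V) H hχ hx
  exact ⟨k, congr($hk w)⟩

theorem exists_int_of_isWeight [FiniteDimensional ℂ V] {m : Module.Dual ℂ H} (hm : IsWeight V m)
    (i : H.root) : ∃ n : ℤ, m (coroot i.1) = n := by
  obtain ⟨w, hw, hwt⟩ := hm
  obtain ⟨h, e, f, t, he, hf⟩ := exists_isSl2Triple_of_weight_isNonZero (isNonZero_root i)
  have hc : ⁅h, w⁆ = m (coroot i.1) • w := by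
    rw [t.h_eq_coroot (isNonZero_root i) he hf, hwt]
  obtain ⟨a, n, hn, -⟩ := exists_pow_lie_ne_zero t hw hc
    (exists_pow_lie_eq_zero_of_finiteDimensional (isNonZero_root i) he w)
    (exists_pow_lie_eq_zero_of_finiteDimensional (neg_ne_zero.2 (isNonZero_root i)) hf)
  exact ⟨n - 2 * a, by rw [hn]; push_cast; rfl⟩

/-- Every weight is conjugate to a dominant one. -/
theorem IsHighestWeight.exists_weyl_isDominantIntegral [FiniteDimensional ℂ V]
    (hv : IsHighestWeight b l v) {m : Module.Dual ℂ H} (hm : IsWeight V m) :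
    ∃ w : (rootSystem H).weylGroup, IsWeight V (w • m) ∧ IsDominantIntegral b (w • m) := by
  have hW : ∀ w : (rootSystem H).weylGroup, IsWeight V (w • m) := by
    intro w
    rw [hv.isWeight_weyl (fun i _ x hx => exists_pow_lie_eq_zero_of_finiteDimensional
      (neg_ne_zero.2 (isNonZero_root i)) hx v)]
    exact hm
  choose k hk using fun w => hv.exists_gradeElt_eq (hW w)
  -- The conjugate with the largest value at `gradeElt` is dominant: a negative value at a simple
  -- coroot would let the reflection raise it.
  obtain ⟨w, hw⟩ : ∃ w, ∀ w', k w ≤ k w' := by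
    obtain ⟨w, hw⟩ := Finite.exists_min k
    exact ⟨w, hw⟩
  refine ⟨w, hW w, fun i hi => ?_⟩
  obtain ⟨n, hn⟩ := exists_int_of_isWeight (hW w) i
  by_cases h0 : 0 ≤ n
  · obtain ⟨n, rfl⟩ := Int.eq_ofNat_of_zero_le h0
    exact ⟨n, by simpa using hn⟩
  exfalso
  have h1 := hw (RootPairing.weylGroup.ofIdx _ i * w)
  have h2 := hk (RootPairing.weylGroup.ofIdx _ i * w)
  have h3 : (RootPairing.weylGroup.ofIdx (rootSystem H) i * w) • m =
      w • m - (n : ℂ) • (rootSystem H).root i := by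
    rw [mul_smul, ← hn]
    change (rootSystem H).reflection i (w • m) = _
    rw [RootPairing.reflection_apply]
    rfl
  rw [h3, LinearMap.sub_apply, LinearMap.smul_apply, simpleRoot_gradeElt b hi, hk w] at h2
  have h4 : (n : ℂ) = k (RootPairing.weylGroup.ofIdx _ i * w) - k w := by
    rw [smul_eq_mul, mul_one] at h2; linear_combination -h2
  have h5 : n = (k (RootPairing.weylGroup.ofIdx _ i * w) : ℤ) - k w := by exact_mod_cast h4
  omega

theorem IsHighestWeight.exists_eq_of_weightBasis {n : ℕ} (hv : IsHighestWeight b l v)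
    (β : Module.Basis (Fin n) ℂ V) {μ : Fin n → Module.Dual ℂ H}
    (hβ : ∀ p, ∀ h : H, ⁅(h : L), β p⁆ = μ p h • β p) : ∃ p, μ p = l := by
  by_contra! h
  have key : ∀ p, β p ∈ lowerPart b V (l (gradeElt b)) 1 := by
    intro p
    have hw : IsWeight V (μ p) := ⟨β p, β.ne_zero p, hβ p⟩
    obtain ⟨k, hk⟩ := hv.exists_gradeElt_eq hw
    cases k with
    | zero => exact absurd (hv.eq_of_gradeElt_eq hw (by simpa using hk)) (h p)
    | succ k =>
      refine Submodule.mem_iSup_of_mem k ?_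
      have := mem_eigenspace_gradeElt (b := b) (hβ p)
      rw [hk] at this
      rwa [add_comm 1 k]
  have h1 : v ∈ lowerPart b V (l (gradeElt b)) 1 := by
    rw [← β.sum_repr v]
    exact sum_mem fun p _ => Submodule.smul_mem _ _ (key p)
  exact hv.ne_zero (Submodule.disjoint_def.1 (disjoint_eigenspace_lowerPart _) v
    hv.mem_eigenspace h1)

/-- The trace on the module with highest weight `l` puts a sum of orbit sums into the image. Weights
conjugate to `l` contribute a positive multiple of the wanted one; the others are conjugate to
dominant weights whose value at `gradeElt` is smaller by at least one, so they are covered by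
induction. -/
theorem orbitSum_mem_resImage (n N : ℕ) : ∀ l : Module.Dual ℂ H, IsDominantIntegral b l →
    (l (gradeElt b)).re < N → orbitSum n l ∈ resImage b n := by
  induction N with
  | zero =>
    intro l hl hN
    obtain ⟨J, hv, hJ⟩ := exists_finiteDimensional_isHighestWeight hl
    have := hv.gradeElt_re_nonneg
    rw [Nat.cast_zero] at hN
    linarith
  | succ N ih =>
    intro l hl hN
    obtain ⟨J, hv, hJ⟩ := exists_finiteDimensional_isHighestWeight hl
    obtain ⟨d, β, μ, hβ⟩ := hv.exists_weightBasis
    have htr := trace_genericMatrix_pow_mem_symInvariants (L := L) β n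
    have hsum : ∑ p, orbitSum n (μ p) ∈ resImage b n := by
      rw [sum_orbitSum]
      · refine Submodule.smul_mem _ _ ⟨_, ⟨htr, ?_⟩, res_trace_genericMatrix_pow β b hβ n⟩
        exact sum_mem fun p _ => genericMatrix_pow_mem_piece β n p p
      · rw [← res_trace_genericMatrix_pow β b hβ n]
        exact res_mem_weylInvariants b htr
    classical
    have hp : ∀ p, orbitSum n (μ p) = orbitSum n l ∨ orbitSum n (μ p) ∈ resImage b n := by
      intro p
      obtain ⟨w, hw, hdom⟩ := hv.exists_weyl_isDominantIntegral ⟨β p, β.ne_zero p, hβ p⟩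
      rw [← orbitSum_weyl n w (μ p)]
      obtain ⟨k, hk⟩ := hv.exists_gradeElt_eq hw
      cases k with
      | zero => exact Or.inl (by rw [hv.eq_of_gradeElt_eq hw (by simpa using hk)])
      | succ k =>
        refine Or.inr (ih _ hdom ?_)
        rw [hk]
        push_cast at hN ⊢
        simp only [Complex.sub_re, Complex.add_re, Complex.natCast_re, Complex.one_re]
        have : (0 : ℝ) ≤ k := Nat.cast_nonneg k
        linarith
    set S := Finset.univ.filter fun p => orbitSum n (μ p) = orbitSum n l with hS
    obtain ⟨p₀, hp₀⟩ := hv.exists_eq_of_weightBasis β hβ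
    have hcard : (S.card : ℂ) ≠ 0 := by
      rw [Nat.cast_ne_zero, Finset.card_ne_zero]
      exact ⟨p₀, by simp [hS, hp₀]⟩
    rw [← Finset.sum_filter_add_sum_filter_not Finset.univ
      (fun p => orbitSum n (μ p) = orbitSum n l)] at hsum
    have h1 : ∑ p ∈ S, orbitSum n (μ p) = (S.card : ℂ) • orbitSum n l := by
      rw [Finset.sum_congr rfl fun p hp => (Finset.mem_filter.1 hp).2, Finset.sum_const,
        Nat.cast_smul_eq_nsmul]
    rw [← hS, h1] at hsum
    have h2 := (Submodule.add_mem_iff_left _ (sum_mem fun p hp' =>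
      (hp p).resolve_left (Finset.mem_filter.1 hp').2)).1 hsum
    exact (Submodule.smul_mem_iff _ hcard).1 h2

end FiniteWeights

end HarishChandra

/-! ### Surjectivity of the restriction map -/

namespace HarishChandra

section Polarization

variable {M A : Type*} [AddCommGroup M] [Module ℂ M] [CommRing A] [Algebra ℂ A]

/-- A polynomial with all values at natural numbers in a subspace has its coefficients there. -/
theorem coeff_mem_of_eval_natCast_mem (N : Submodule ℂ A) (p : Polynomial A)
    (h : ∀ m : ℕ, p.eval (m : A) ∈ N) (i : ℕ) : p.coeff i ∈ N := by
  by_contra hi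
  -- A functional that vanishes on `N` reduces the claim to a complex polynomial with infinitely
  -- many zeros.
  obtain ⟨g, hg, hle⟩ := Submodule.exists_le_ker_of_notMem hi
  let q : Polynomial ℂ := ∑ j ∈ p.support, Polynomial.monomial j (g (p.coeff j))
  have hq : q = 0 := by
    refine Polynomial.eq_zero_of_infinite_isRoot q (Set.infinite_of_injective_forall_mem
      (f := fun m : ℕ => (m : ℂ)) Nat.cast_injective fun m => ?_)
    have h1 : g (p.eval (m : A)) = 0 := hle (h m)
    rw [Polynomial.eval_eq_sum, Polynomial.sum, map_sum] at h1
    simp only [Set.mem_ofPred_eq, Polynomial.IsRoot, q, Polynomial.eval_finsetSum,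
      Polynomial.eval_monomial]
    rw [← h1]
    refine Finset.sum_congr rfl fun j _ => ?_
    have : p.coeff j * (m : A) ^ j = ((m : ℂ) ^ j) • p.coeff j := by
      rw [Algebra.smul_def, map_pow, map_natCast, mul_comm]
    rw [this, map_smul, smul_eq_mul, mul_comm]
  have h2 := congr(($hq).coeff i)
  simp only [q, Polynomial.finsetSum_coeff, Polynomial.coeff_monomial, Polynomial.coeff_zero,
    Finset.sum_ite_eq'] at h2
  rw [if_pos (Polynomial.mem_support_iff.2 fun h0 => hi (h0 ▸ zero_mem N))] at h2
  exact hg h2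

/-- This is polarization, one factor at a time: in `(m x + y)^(j+1)`, as a polynomial in `m`, the
linear coefficient is `(j+1) x y^j`. Only natural `m` are used because `S` is just a submonoid. -/
theorem prod_mul_pow_mem_of_pow_mem (f : M →ₗ[ℂ] A) (S : AddSubmonoid M) (N : Submodule ℂ A)
    {n : ℕ} (h : ∀ y ∈ S, f y ^ n ∈ N) (l : List M) (hl : ∀ x ∈ l, x ∈ S) :
    ∀ j, l.length + j = n → ∀ y ∈ S, (l.map f).prod * f y ^ j ∈ N := by
  induction l with
  | nil => rintro j rfl y hy; simpa using h y hy
  | cons x l ih =>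
    intro j hj y hy
    have hl' := List.forall_mem_cons.1 hl
    have key := coeff_mem_of_eval_natCast_mem N (Polynomial.C (l.map f).prod *
      ((Polynomial.X + Polynomial.C (f y)) ^ (j + 1)).comp (Polynomial.C (f x) * Polynomial.X))
      (fun m => by
        have := ih hl'.2 (j + 1) (by simp at hj; omega) (m • x + y)
          (add_mem (S.nsmul_mem hl'.1 m) hy)
        simpa [mul_comm (f x)] using this) 1
    rw [Polynomial.coeff_C_mul, Polynomial.comp_C_mul_X_coeff, Polynomial.coeff_X_add_C_pow,
      Nat.add_sub_cancel, Nat.choose_one_right, pow_one] at key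
    have h1 : (l.map f).prod * (f y ^ j * ((j + 1 : ℕ) : A) * f x) =
        ((j + 1 : ℕ) : ℂ) • (((x :: l).map f).prod * f y ^ j) := by
      rw [Algebra.smul_def, map_natCast, List.map_cons, List.prod_cons]
      ring
    rw [h1] at key
    exact (Submodule.smul_mem_iff _ (Nat.cast_ne_zero.2 j.succ_ne_zero)).1 key

/-- The `n`-th powers of the elements of a submonoid that spans `M` span the `n`-th piece. -/
theorem piece_le_of_pow_mem (f : M →ₗ[ℂ] A) (S : AddSubmonoid M)
    (hS : Submodule.span ℂ (S : Set M) = ⊤) (N : Submodule ℂ A)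
    {n : ℕ} (h : ∀ y ∈ S, f y ^ n ∈ N) : piece f n ≤ N := fun _ ha =>
  piece_induction f hS (p := (· ∈ N)) (zero_mem N) (fun _ _ => add_mem)
    (fun _ _ => N.smul_mem _) (fun l hl hS => by
      simpa using prod_mul_pow_mem_of_pow_mem f S N h l hS 0 (by simpa using hl) 0 S.zero_mem) ha

end Polarization

section Surjective

variable {L : Type*} [LieRing L] [LieAlgebra ℂ L] [FiniteDimensional ℂ L] [IsSemisimple ℂ L]
  {H : LieSubalgebra ℂ L} [H.IsCartanSubalgebra] (b : (rootSystem H).Base)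

/-- The elements of `𝔥` that correspond to dominant integral weights. -/
noncomputable def dominantCone : AddSubmonoid H where
  carrier := {x | IsDominantIntegral b (cartanEquivDual H x)}
  zero_mem' := fun i _ => ⟨0, by simp⟩
  add_mem' := fun hx hy i hi => by
    obtain ⟨m, hm⟩ := hx i hi
    obtain ⟨n, hn⟩ := hy i hi
    exact ⟨m + n, by simp [hm, hn]⟩

theorem isDominantIntegral_fundamentalWeight (i : b.support) :
    IsDominantIntegral b (fundamentalWeight b i) := fun j hj => by
  rw [fundamentalWeight_coroot b i ⟨j, hj⟩]
  split_ifs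
  exacts [⟨1, by simp⟩, ⟨0, by simp⟩]

theorem span_dominantCone : Submodule.span ℂ (dominantCone b : Set H) = ⊤ := by
  have h1 : Submodule.span ℂ (Set.range (fundamentalWeight b)) = ⊤ := by
    classical
    have := b.toCoweightBasis.dualBasis.span_eq
    rwa [Module.Basis.coe_dualBasis] at this
  have h2 := congr(($h1).map (cartanEquivDual H).symm.toLinearMap)
  rw [Submodule.map_top, LinearEquiv.range, Submodule.map_span] at h2
  rw [eq_top_iff, ← h2]
  refine Submodule.span_mono ?_
  rintro _ ⟨_, ⟨i, rfl⟩, rfl⟩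
  change IsDominantIntegral b (cartanEquivDual H ((cartanEquivDual H).symm _))
  rw [LinearEquiv.apply_symm_apply]
  exact isDominantIntegral_fundamentalWeight b i

/-- The condition is linear in `p`, so `p` may be a power of an element of the dominant cone; its
sum over the Weyl group is then an orbit sum. -/
theorem exists_resImage_eval_eq_sum {n : ℕ} {p : SymmetricAlgebra ℂ H}
    (hp : p ∈ piece (SymmetricAlgebra.ι ℂ H) n) :
    ∃ q ∈ resImage b n, ∀ l : Module.Dual ℂ H,
      evalAt l q = ∑ w : (rootSystem H).weylGroup, evalAt (w • l) p := by
  let N : Submodule ℂ (SymmetricAlgebra ℂ H) :=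
    { carrier := {p | ∃ q ∈ resImage b n, ∀ l : Module.Dual ℂ H,
        evalAt l q = ∑ w : (rootSystem H).weylGroup, evalAt (w • l) p}
      zero_mem' := ⟨0, zero_mem _, by simp⟩
      add_mem' := by
        rintro p p' ⟨q, hq, h⟩ ⟨q', hq', h'⟩
        exact ⟨q + q', add_mem hq hq', fun l => by simp [h, h', Finset.sum_add_distrib]⟩
      smul_mem' := by
        rintro t p ⟨q, hq, h⟩
        exact ⟨t • q, Submodule.smul_mem _ _ hq, fun l => by simp [h, Finset.mul_sum]⟩ }
  refine piece_le_of_pow_mem (SymmetricAlgebra.ι ℂ H) (dominantCone b) (span_dominantCone b) N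
    (fun y hy => ?_) hp
  obtain ⟨K, hK⟩ := exists_nat_gt (cartanEquivDual H y (gradeElt b)).re
  refine ⟨orbitSum n (cartanEquivDual H y), orbitSum_mem_resImage n K _ hy hK, fun l => ?_⟩
  rw [evalAt_orbitSum]
  refine Finset.sum_congr rfl fun w _ => ?_
  rw [← evalAt_ι_symm, LinearEquiv.symm_apply_apply, map_pow]

/-- For invariant `p` the sum over the group is the order of the group times `p`. -/
theorem mem_resImage {n : ℕ} {p : SymmetricAlgebra ℂ H}
    (hp : p ∈ piece (SymmetricAlgebra.ι ℂ H) n) (hi : p ∈ weylInvariants H) :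
    p ∈ resImage b n := by
  obtain ⟨q, hq, h⟩ := exists_resImage_eval_eq_sum b hp
  have hqp : q = (Fintype.card (rootSystem H).weylGroup : ℂ) • p := by
    refine ext_evalAt fun l => ?_
    rw [h, map_smul, Finset.sum_congr rfl fun w _ => mem_weylInvariants.1 hi w l]
    simp
  rw [hqp] at hq
  exact (Submodule.smul_mem_iff _ (Nat.cast_ne_zero.2 Fintype.card_ne_zero)).1 hq

end Surjective

/-! ### The Harish-Chandra isomorphism -/

theorem sub_symComp_mem_fil {M : Type*} [AddCommGroup M] [Module ℂ M] {n : ℕ}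
    {p : SymmetricAlgebra ℂ M} (hp : p ∈ fil (SymmetricAlgebra.ι ℂ M) (n + 1)) :
    p - symComp M n p ∈ fil (SymmetricAlgebra.ι ℂ M) n := by
  have h := sum_symComp hp
  rw [Finset.sum_range_succ] at h
  rw [← eq_sub_iff_add_eq.2 h]
  exact sum_mem fun i hi => piece_le_fil_of_lt _ (Finset.mem_range.1 hi) (symComp_mem i p)

section Isomorphism

variable {L : Type*} [LieRing L] [LieAlgebra ℂ L] [FiniteDimensional ℂ L] [IsSemisimple ℂ L]
  {H : LieSubalgebra ℂ L} [H.IsCartanSubalgebra] (b : (rootSystem H).Base)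

theorem res_eq_zero_of_HC_mem_fil {n : ℕ} {s : SymmetricAlgebra ℂ L}
    (hs : s ∈ piece (SymmetricAlgebra.ι ℂ L) n) {z : UniversalEnvelopingAlgebra ℂ L}
    (h : z - symmetrize L n s ∈ fil (uι L) n)
    (hz : HC b z ∈ fil (SymmetricAlgebra.ι ℂ H) n) : res b s = 0 := by
  refine eq_zero_of_mem_piece_of_mem_fil (res_mem_piece b hs) ?_
  have h1 := HC_symmetrize_sub_mem b hs
  have h2 := HC_mem_fil b h
  rw [map_sub] at h2
  simpa using sub_mem hz (add_mem h1 h2)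

/-- The symbol of `z` is an invariant with zero restriction, so it vanishes; the degree of `z` can
be lowered until nothing is left. -/
theorem eq_zero_of_HC_eq_zero {z : UniversalEnvelopingAlgebra ℂ L} (hz : z ∈ centerU L)
    (h : HC b z = 0) : z = 0 := by
  suffices ∀ n, z ∈ fil (uι L) n → z = 0 by
    obtain ⟨n, hn⟩ := exists_mem_fil _ (adjoin_range_uι L) z
    exact this n hn
  intro n
  induction n with
  | zero => intro hn; simpa [fil_zero] using hn
  | succ n ih =>
    intro hn
    obtain ⟨s, hs, hsn⟩ := exists_symbol hn
    have h0 := eq_zero_of_res_eq_zero b (symbol_mem_symInvariants hs hz hsn)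
      (res_eq_zero_of_HC_mem_fil b hs hsn (by rw [h]; exact zero_mem _))
    rw [h0, map_zero, sub_zero] at hsn
    exact ih hsn

/-- The leading component of `p` is the restriction of an invariant, whose symmetrization is
central. Subtracting its image under `HC` lowers the degree and stays in the shifted invariants. -/
theorem exists_HC_eq {p : SymmetricAlgebra ℂ H} (hp : p ∈ dotInvariants b) :
    ∃ z ∈ centerU L, HC b z = p := by
  suffices ∀ n, ∀ p ∈ dotInvariants b, p ∈ fil (SymmetricAlgebra.ι ℂ H) n →
      ∃ z ∈ centerU L, HC b z = p by
    obtain ⟨n, hn⟩ := exists_mem_fil _ (adjoin_range_ι H) p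
    exact this n p hp hn
  intro n
  induction n with
  | zero =>
    intro p _ hn
    have h0 : p = 0 := by simpa [fil_zero] using hn
    exact ⟨0, zero_mem _, by rw [h0, map_zero]⟩
  | succ n ih =>
    intro p hp hn
    obtain ⟨s, ⟨hi, hs⟩, hsp⟩ :=
      mem_resImage b (symComp_mem n p) (symComp_mem_weylInvariants_of_dot b hp hn)
    have hc := symmetrize_mem_center hs hi
    obtain ⟨z, hz, hzp⟩ := ih (p - HC b (symmetrize L n s))
      (sub_mem hp (HC_mem_dotInvariants b hc)) (by
        have h1 := HC_symmetrize_sub_mem b hs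
        have h2 := sub_symComp_mem_fil hn
        have h3 : res b s = symComp H n p := hsp
        rw [← h3] at h2
        simpa using sub_mem h2 h1)
    exact ⟨z + symmetrize L n s, add_mem hz hc, by rw [map_add, hzp, sub_add_cancel]⟩

/-- Translation by `ρ` turns Weyl invariants into shifted invariants with the same leading
component. -/
theorem range_grIncl_dotInvariants (n : ℕ) :
    LinearMap.range (grIncl (Subalgebra.toSubmodule (dotInvariants b))
      (fil (SymmetricAlgebra.ι ℂ H)) n) =
      ((Subalgebra.toSubmodule (weylInvariants H)).submoduleOf
        (piece (SymmetricAlgebra.ι ℂ H) n)).map (toGr (SymmetricAlgebra.ι ℂ H) n) := by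
  ext a
  constructor
  · rintro ⟨p, rfl⟩
    obtain ⟨⟨p, hp⟩, rfl⟩ := Submodule.mkQ_surjective _ p
    refine ⟨⟨symComp H n p, symComp_mem n p⟩,
      symComp_mem_weylInvariants_of_dot b hp.1 hp.2, Eq.symm ?_⟩
    exact (Submodule.Quotient.eq _).2 (sub_symComp_mem_fil hp.2)
  · rintro ⟨p, hp, rfl⟩
    have h1 := piece_le_fil _ n p.2
    have h2 := symShift_sub_mem_fil (rho b) h1
    refine ⟨Submodule.mkQ _ ⟨symShift (rho b) p.1, (mem_weylInvariants_iff b).1 hp, ?_⟩,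
      (Submodule.Quotient.eq _).2 h2⟩
    rw [← sub_add_cancel (symShift (rho b) p.1) p.1]
    exact add_mem (fil_mono _ n.le_succ h2) h1

/-- The isomorphism from the centre to the invariants of the shifted action. -/
noncomputable def HCEquiv : centerU L ≃ₐ[ℂ] dotInvariants b :=
  AlgEquiv.ofBijective ((HCCenter b).codRestrict (dotInvariants b)
    fun z => HC_mem_dotInvariants b z.2) (by
    constructor
    · rw [injective_iff_map_eq_zero]
      exact fun z hz => Subtype.ext (eq_zero_of_HC_eq_zero b z.2 congr(($hz).1))
    · intro p
      obtain ⟨z, hz, h⟩ := exists_HC_eq b p.2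
      exact ⟨⟨z, hz⟩, Subtype.ext h⟩)

theorem coe_HCEquiv (z : centerU L) : (HCEquiv b z : SymmetricAlgebra ℂ H) = HC b z := rfl

theorem HC_mem_subFil (n : ℕ) : subFil (Subalgebra.toSubmodule (centerU L)) (fil (uι L)) n ≤
    (subFil (Subalgebra.toSubmodule (dotInvariants b))
      (fil (SymmetricAlgebra.ι ℂ H)) n).comap (HC b) :=
  fun _ hz => ⟨HC_mem_dotInvariants b hz.1, HC_mem_fil b hz.2⟩

theorem grIncl_grMap_HC (n : ℕ)
    (z : Gr (subFil (Subalgebra.toSubmodule (centerU L)) (fil (uι L))) n)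
    (s : piece (SymmetricAlgebra.ι ℂ L) n)
    (h : grIncl (Subalgebra.toSubmodule (centerU L)) (fil (uι L)) n z = symbolEquiv L n s) :
    grIncl (Subalgebra.toSubmodule (dotInvariants b)) (fil (SymmetricAlgebra.ι ℂ H)) n
      (grMap (HC b) (HC_mem_subFil b) n z) =
      toGr (SymmetricAlgebra.ι ℂ H) n (resPiece b n s) := by
  obtain ⟨⟨z, hz⟩, rfl⟩ := Submodule.mkQ_surjective _ z
  have h1 := HC_mem_fil b ((mkQ_eq_symbolEquiv_iff ⟨z, hz.2⟩ s).1 h)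
  rw [map_sub] at h1
  have h2 := add_mem h1 (HC_symmetrize_sub_mem b s.2)
  rw [sub_add_sub_cancel] at h2
  exact (Submodule.Quotient.eq _).2 h2

end Isomorphism

end HarishChandra

/-! ### Assembly of the theorem. -/

theorem mainTheorem5 {L : Type*} [LieRing L] [LieAlgebra ℂ L] [FiniteDimensional ℂ L]
    [IsSemisimple ℂ L] (H : LieSubalgebra ℂ L) [H.IsCartanSubalgebra]
    (b : (rootSystem H).Base) :
    -- the map `μ` in the definition of `HC = β ∘ μ⁻¹` is a linear isomorphism
    Function.Bijective (triMul b) ∧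
    -- (i)
    (∀ u : UniversalEnvelopingAlgebra ℂ L, ∀ c ∈ centerU L,
      HC b (u * c) = HC b u * HC b c) ∧
    (∃ φ : centerU L →ₐ[ℂ] SymmetricAlgebra ℂ H, ∀ z : centerU L, φ z = HC b z) ∧
    -- (ii)
    rho b = ∑ i, fundamentalWeight b i ∧
    (∀ z ∈ centerU L, HC b z ∈ dotInvariants b) ∧
    (∀ z ∈ centerU L, ∃ p ∈ weylInvariants H, ∀ l : Module.Dual ℂ H,
      evalAt l (HC b z) = evalAt (l + rho b) p) ∧
    -- (iii)
    (∀ (V : Type*) [AddCommGroup V] [Module ℂ V] [LieRingModule L V] [LieModule ℂ L V]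
      (l : Module.Dual ℂ H) (v : V), IsHighestWeight b l v →
      (∃! f : Module.Dual ℂ V, IsLowestWeightDual b l f ∧ f v = 1) ∧
      (∀ f : Module.Dual ℂ V, IsLowestWeightDual b l f → f v = 1 →
        (∀ u : UniversalEnvelopingAlgebra ℂ L, evalAt l (HC b u) = f (uAct V u v)) ∧
        (∀ z ∈ centerU L, ∀ p ∈ weylInvariants H,
          (∀ m : Module.Dual ℂ H, evalAt m (HC b z) = evalAt (m + rho b) p) →
          evalAt (l + rho b) p = f (uAct V z v))) ∧
      (∀ z ∈ centerU L, ∀ w : V, uAct V z w = evalAt l (HC b z) • w)) ∧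
    -- (iv): `σ` is the identification `S(𝔤) = gr U(𝔤)`, in each degree
    (∀ s ∈ symInvariants L, res b s ∈ weylInvariants H) ∧
    (∃ hHC : ∀ n, subFil (Subalgebra.toSubmodule (centerU L)) (fil (uι L)) n ≤
        (subFil (Subalgebra.toSubmodule (dotInvariants b))
          (fil (SymmetricAlgebra.ι ℂ H)) n).comap (HC b),
      ∃ σ : ∀ n, piece (SymmetricAlgebra.ι ℂ L) n ≃ₗ[ℂ] Gr (fil (uι L)) n,
        (∀ n (x : Fin n → L),
          σ n (monomial (SymmetricAlgebra.ι ℂ L) x) = toGr (uι L) n (monomial (uι L) x)) ∧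
        ∀ n,
          -- inside `Sⁿ(𝔤)`, the space `grₙ Z(𝔤)` is `Sⁿ(𝔤)^𝔤`
          Function.Injective (grIncl (Subalgebra.toSubmodule (centerU L)) (fil (uι L)) n) ∧
          LinearMap.range (grIncl (Subalgebra.toSubmodule (centerU L)) (fil (uι L)) n) =
            ((symInvariants L).submoduleOf (piece (SymmetricAlgebra.ι ℂ L) n)).map
              (σ n).toLinearMap ∧
          -- inside `Sⁿ(𝔥) = grₙ S(𝔥)`, the space `grₙ ℂ[𝔥*]^{W•}` is `Sⁿ(𝔥)^W`
          Function.Bijective (toGr (SymmetricAlgebra.ι ℂ H) n) ∧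
          Function.Injective (grIncl (Subalgebra.toSubmodule (dotInvariants b))
            (fil (SymmetricAlgebra.ι ℂ H)) n) ∧
          LinearMap.range (grIncl (Subalgebra.toSubmodule (dotInvariants b))
            (fil (SymmetricAlgebra.ι ℂ H)) n) =
            ((Subalgebra.toSubmodule (weylInvariants H)).submoduleOf
              (piece (SymmetricAlgebra.ι ℂ H) n)).map (toGr (SymmetricAlgebra.ι ℂ H) n) ∧
          -- under these identifications `grₙ HC` is the restriction map
          ∀ (z : Gr (subFil (Subalgebra.toSubmodule (centerU L)) (fil (uι L))) n)
            (s : piece (SymmetricAlgebra.ι ℂ L) n),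
            grIncl (Subalgebra.toSubmodule (centerU L)) (fil (uι L)) n z = σ n s →
            grIncl (Subalgebra.toSubmodule (dotInvariants b)) (fil (SymmetricAlgebra.ι ℂ H)) n
              (grMap (HC b) hHC n z) =
              toGr (SymmetricAlgebra.ι ℂ H) n (resPiece b n s)) ∧
    -- (v)
    ∃ Φ : centerU L ≃ₐ[ℂ] dotInvariants b,
      ∀ z : centerU L, (Φ z : SymmetricAlgebra ℂ H) = HC b z := by
  refine ⟨triMul_bijective b, fun u c hc => HC_mul_of_mem_center b u hc,
    ⟨HCCenter b, HCCenter_apply b⟩, rho_eq_sum_fundamentalWeight b,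
    fun z hz => HC_mem_dotInvariants b hz,
    fun z hz => ⟨symShift (-rho b) (HC b z),
      (mem_dotInvariants_iff b).1 (HC_mem_dotInvariants b hz), fun l => ?_⟩,
    fun V _ _ _ _ l v hv => ⟨?_, fun f hf hfv => ?_, fun z hz w => hv.center_apply hz w⟩,
    fun s hs => res_mem_weylInvariants b hs,
    ⟨HC_mem_subFil b, symbolEquiv L, fun n x => symbolEquiv_monomial x, fun n =>
      ⟨grIncl_injective _ _ n, range_grIncl_centerU n, toGr_ι_bijective n,
        grIncl_injective _ _ n, range_grIncl_dotInvariants b n, grIncl_grMap_HC b n⟩⟩,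
    HCEquiv b, coe_HCEquiv b⟩
  · rw [evalAt_symShift, add_neg_cancel_right]
  · obtain ⟨f, hf, hfv⟩ := hv.exists_lowestWeightDual
    exact ⟨f, ⟨hf, hfv⟩, fun g hg => hv.lowestWeightDual_unique hg.1 hf (hg.2.trans hfv.symm)⟩
  · have key : ∀ u, evalAt l (HC b u) = f (uAct V u v) := fun u => by
      rw [evalAt_HC_eq hv.weight hv.singular hf, hfv, mul_one]
    exact ⟨key, fun z _ p _ h => by rw [← h, key]⟩
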